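/- **Setting.** Let $M\ge 2$ and let ${\bf m}=(m_n)_{n\ge1}$ be a nonnegative kernel concentrated at $M$: $m_n=0$ for $n\notin\{1,M\}$, and $m_M>0$ ($m_1\ge 0$ is allowed to vanish). Let $z^*\in\mathbb R$ and let $f:\mathbb R\to[0,\infty)$ be lower semicontinuous with convex restrictions to $(-\infty,z^*]$ and to $[z^*,\infty)$, and suppose that for some $c>0$ $$f(z)\le c(z^2+1),\qquad \tfrac1c z^2\le f(z)+m_1z^2\qquad(z\in\mathbb R).$$ For $u:\{0,\dots,k\}\to\mathbb R$ put $F(u;k)=\sum_{i=1}^k f(u_i-u_{i-1})+\sum_{i,j=0}^k m_{|i-j|}(u_i-u_j)^2$, let $\mathcal A(k;z)=\{u:u_0=0,\ u_k=kz\}$, and let $\mathcal V(k;\theta)$ be the set of $u$ with $\#\{i:u_i-u_{i-1}>z^*\}\le\theta k$ and $\#\{i:u_i-u_{i-1}<z^*\}\le(1-\theta)k$. Define $$\widehat Q_{\bf m}f(z)=\lim_{k\to\infty}\frac1k\inf_{\mathcal A(k;z)}F(\cdot;k),\qquad \widehat Q_{\bf m}f(\theta,z)=\liminf_{\substack{N\to\infty\\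 \theta N\in\mathbb N}}\frac1N\inf_{\mathcal A(N;z)\cap\mathcal V(N;\theta)}F(\cdot;N)\quad(\theta\in\mathbb Q\cap[0,1]),$$ with $\inf\emptyset=+\infty$; extend $\widehat Q_{\bf m}f(\cdot,z)$ to irrational $\theta\in(0,1)$ by continuity. Let $\Theta(z)$ be the set of $\theta\in[0,1]$ at which the lower semicontinuous envelope in $\theta$ of $\widehat Q_{\bf m}f(\cdot,z)$ equals $\widehat Q_{\bf m}f(z)$; the phase function is $\theta(z)=\min\Theta(z)$. A number $\theta\in[0,1]$ is a locking state if $\{z:\widehat Q_{\bf m}f(\theta,z)=\widehat Q_{\bf m}f(z)\}$ contains a nonempty open interval. Let $f_{2m_1}(z)=f(z)+2m_1z^2$, $\theta_n=n/M$ for $0\le n\le M$, and $$P^{M,n}(z)=\min\{(1-\theta_n)f_{2m_1}(z^-)+\theta_nf_{2m_1}(z^+):\ z^-\le z^*\le z^+,\ (1-\theta_n)z^-+\theta_nz^+=z\}+2m_M(Mz)^2,$$ with value $+\infty$ if no such $z^\pm$ exist. Let $^{**}$ denote the convex envelope, and let $0\cdot(+\infty)=0$. **Theorem.** The limit defining $\widehat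 Q_{\bf m}f$ exists and is finite, the minima defining $P^{M,n}$ (where the constraint set is nonempty) and $\theta(z)$ are attained, and the following hold. (0) (Interpolation between locking states.) For $0\le n<M$, $\theta\in\mathbb Q\cap[\theta_n,\theta_{n+1}]$ and $z\in\mathbb R$, $$\widehat Q_{\bf m}f(\theta,z)=\min\{M(\theta_{n+1}-\theta)P^{M,n}(w)+M(\theta-\theta_n)P^{M,n+1}(w'):\ M(\theta_{n+1}-\theta)w+M(\theta-\theta_n)w'=z\},$$ the minimum being attained; in particular $\widehat Q_{\bf m}f(\theta_n,\cdot)=P^{M,n}$ for $0\le n\le M$. Moreover $\widehat Q_{\bf m}f=(\min_{0\le n\le M}P^{M,n})^{**}$. There are points $-\infty=s_0^-<s_0^+\le s_1^-\le s_1^+\le\dots\le s_M^-<s_M^+=+\infty$ such that (i) $\widehat Q_{\bf m}f=P^{M,n}$ on $(s_n^-,s_n^+)$ for $0\le n\le M$, and $\widehat Q_{\bf m}f$ is affine on $[s_n^+,s_{n+1}^-]$ for $0\le n<M$; (ii) $\theta(z)=\theta_n$ for $z\in(s_n^-,s_n^+)$, and $\theta$ is affine on $[s_n^+,s_{n+1}^-]$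 for $0\le n<M$. Suppose in addition that $f_{2m_1}$ is not convex on $\mathbb R$, that $f_{2m_1}$ is strictly convex on $(-\infty,z^*]$ and on $[z^*,\infty)$ (which is automatic if $m_1>0$), and that $f$ is differentiable at every $z\ne z^*$. Then $s_n^-<s_n^+$ for all $n\le M$ and $s_n^+<s_{n+1}^-$ for all $n<M$, and (iii) the set of locking states is exactly $\{\theta_n:0\le n\le M\}$, and $\widehat Q_{\bf m}f=\big(\min\{\widehat Q_{\bf m}f(\theta,\cdot):\theta\text{ is a locking state}\}\big)^{**}$. -/

import Mathlib

open Filter Topology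

noncomputable section

/-- `F₁(u;[0,k])`: nearest-neighbour energy plus the quadratic long-range part with kernel `m`.
A lattice function on `{0,…,k}` is represented by a function on `ℕ` whose values beyond `k`
play no role. The number `m 0` plays no role either. -/
def latticeEnergy (f : ℝ → ℝ) (m : ℕ → ℝ) (k : ℕ) (u : ℕ → ℝ) : ℝ :=
  (∑ i ∈ Finset.range k, f (u (i + 1) - u i)) +
    ∑ i ∈ Finset.range (k + 1), ∑ j ∈ Finset.range (k + 1),
      m ((i : ℤ) - (j : ℤ)).natAbs * (u i - u j) ^ 2

/-- The admissible class `𝒜(k;z)` with affine boundary data. -/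
def admissible (k : ℕ) (z : ℝ) : Set (ℕ → ℝ) :=
  {u | u 0 = 0 ∧ u k = k * z}

/-- The class `𝒱(N;θ)` with prescribed fraction `θ` of increments in `[zs, +∞)`
(in its closed form). -/
def phaseConstraint (zs : ℝ) (N : ℕ) (θ : ℝ) : Set (ℕ → ℝ) :=
  {u | (((Finset.range N).filter (fun i => zs < u (i + 1) - u i)).card : ℝ) ≤ θ * N ∧
       (((Finset.range N).filter (fun i => u (i + 1) - u i < zs)).card : ℝ) ≤ (1 - θ) * N}

/-- The normalized minimum values whose limit is the relaxation. -/
def relaxSeq (f : ℝ → ℝ) (m : ℕ → ℝ) (z : ℝ) (k : ℕ) : ℝ :=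
  (1 / (k : ℝ)) * sInf (latticeEnergy f m k '' admissible k z)

/-- The relaxation `Q̂ₘf(z)` of `f` with kernel `m`. -/
def Qhat (f : ℝ → ℝ) (m : ℕ → ℝ) (z : ℝ) : ℝ :=
  limUnder atTop (relaxSeq f m z)

/-- The phase-constrained relaxation `Q̂ₘf(θ,z)`, meaningful for rational `θ ∈ [0,1]`: lower limit
along those `N` for which `θ N` is a natural number. Infima over empty classes are `+∞`. -/
def QhatPhase (f : ℝ → ℝ) (m : ℕ → ℝ) (zs θ z : ℝ) : EReal :=
  liminf
    (fun N : ℕ => ⨅ u ∈ admissible N z ∩ phaseConstraint zs N θ,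
      (((1 / (N : ℝ)) * latticeEnergy f m N u : ℝ) : EReal))
    (atTop ⊓ 𝓟 {N : ℕ | ∃ k : ℕ, θ * (N : ℝ) = (k : ℝ)})

open Classical in
/-- `Q̂ₘf(θ,z)` for real `θ ∈ [0,1]`: extended to irrational `θ` by continuity, as the limit along
rational numbers tending to `θ`. -/
def QhatExt (f : ℝ → ℝ) (m : ℕ → ℝ) (zs θ z : ℝ) : EReal :=
  if θ ∈ Set.range ((↑) : ℚ → ℝ) then QhatPhase f m zs θ z
  else liminf (fun t : ℝ => QhatPhase f m zs t z) (𝓝[Set.range ((↑) : ℚ → ℝ)] θ)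

/-- The lower semicontinuous envelope on `[0,1]` of `θ ↦ Q̂ₘf(θ,z)`
(the filter `𝓝[Icc 0 1] θ` does not exclude the point `θ`). -/
def QhatSc (f : ℝ → ℝ) (m : ℕ → ℝ) (zs θ z : ℝ) : EReal :=
  liminf (fun t : ℝ => QhatExt f m zs t z) (𝓝[Set.Icc (0 : ℝ) 1] θ)

/-- The phase multifunction `Θ(z)`. -/
def phaseSet (f : ℝ → ℝ) (m : ℕ → ℝ) (zs z : ℝ) : Set ℝ :=
  {θ | θ ∈ Set.Icc (0 : ℝ) 1 ∧ QhatSc f m zs θ z = (Qhat f m z : EReal)}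

/-- The phase function `θ(z)`, the least element of `Θ(z)`. -/
def phaseFun (f : ℝ → ℝ) (m : ℕ → ℝ) (zs z : ℝ) : ℝ :=
  sInf (phaseSet f m zs z)

/-- `θ` is a locking state: `{z : Q̂ₘf(θ,z) = Q̂ₘf(z)}` contains an open interval. -/
def IsLockingState (f : ℝ → ℝ) (m : ℕ → ℝ) (zs θ : ℝ) : Prop :=
  θ ∈ Set.Icc (0 : ℝ) 1 ∧
    ∃ a b : ℝ, a < b ∧ ∀ z ∈ Set.Ioo a b, QhatExt f m zs θ z = (Qhat f m z : EReal)

/-- `f` is bi-convex with the two phases `(-∞, zs]` and `[zs, +∞)`. -/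
def IsBiconvex (f : ℝ → ℝ) (zs : ℝ) : Prop :=
  ConvexOn ℝ (Set.Iic zs) f ∧ ConvexOn ℝ (Set.Ici zs) f

/-- The kernel is concentrated at `M`: only `m 1` and `m M` may be nonzero. -/
def IsConcentrated (m : ℕ → ℝ) (M : ℕ) : Prop :=
  ∀ n, 1 ≤ n → n ≠ 1 → n ≠ M → m n = 0

/-- `f_{2m₁}(z) = f(z) + 2 m₁ z²`. -/
def nnEnergy (f : ℝ → ℝ) (m : ℕ → ℝ) (z : ℝ) : ℝ :=
  f z + 2 * m 1 * z ^ 2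

/-- The set of values that are minimized in the definition of `P^{M,n}(z)`, with `θₙ = n / M`. -/
def PValues (f : ℝ → ℝ) (m : ℕ → ℝ) (zs : ℝ) (M n : ℕ) (z : ℝ) : Set EReal :=
  {v | ∃ a b : ℝ, a ≤ zs ∧ zs ≤ b ∧ (1 - (n : ℝ) / M) * a + ((n : ℝ) / M) * b = z ∧
    v = (((1 - (n : ℝ) / M) * nnEnergy f m a + ((n : ℝ) / M) * nnEnergy f m b
          + 2 * m M * (M * z) ^ 2 : ℝ) : EReal)}

/-- `P^{M,n}(z)`, with value `+∞` where the constraints cannot be met. -/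
def PMn (f : ℝ → ℝ) (m : ℕ → ℝ) (zs : ℝ) (M n : ℕ) (z : ℝ) : EReal :=
  sInf (PValues f m zs M n z)

/-- The set of values that are minimized in the interpolation between `P^{M,n}` and `P^{M,n+1}`
at the phase fraction `θ`. In `EReal` one has `0 * ⊤ = 0`. -/
def interpolationValues (f : ℝ → ℝ) (m : ℕ → ℝ) (zs : ℝ) (M n : ℕ) (θ z : ℝ) : Set EReal :=
  {v | ∃ w w' : ℝ,
    M * (((n : ℝ) + 1) / M - θ) * w + M * (θ - (n : ℝ) / M) * w' = z ∧
    v = ((M * (((n : ℝ) + 1) / M - θ) : ℝ) : EReal) * PMn f m zs M n w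
        + ((M * (θ - (n : ℝ) / M) : ℝ) : EReal) * PMn f m zs M (n + 1) w'}

/-- The convex envelope `φ**`: the largest convex function below `φ`. -/
def convexEnvelope (φ : ℝ → EReal) (z : ℝ) : EReal :=
  ⨆ g ∈ {g : ℝ → ℝ | ConvexOn ℝ Set.univ g ∧ ∀ x, (g x : EReal) ≤ φ x}, ((g z : ℝ) : EReal)

end

/-! Write g for f_{2m₁} and K for 2 m_M M². The lattice energy is the sum of g over the increments
plus K/M² times the square of the sum of increments over every window of length M. The long-range
term sees only window sums, so a window with n increments in the right phase costs, per site, at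
least P^{M,n} of its mean. An M-periodic arrangement has equal window sums and attains this bound.
This is why the fractions n/M are special.

The proof works with the dual variable σ. Let v(θ,σ) be the minimum of mixture energy minus σ times
mean strain (`saddleValue`). Dualizing the square gives v(θ,σ) = max over τ of (1-θ)A(τ) + θB(τ) -
(σ-τ)²/(4K), where A and B are the infima of g(x) - τx over the two phases. Hence v is convex in θ
(`saddleValue_subgradient`) and concave in σ (`saddleValue_supergradient`). Its increments in θ are
nonincreasing in σ because B - A is nonincreasing (`saddleValue_sub_antitone`). The first two
inequalities carry a gain K times a squared difference of means, which is the source of the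
uniqueness statements.

Averaging over windows, every affine minorant of j ↦ v(j/M,σ) bounds the energy of a lattice
function with a given number of right-phase sites (`lattice_lower_bound`). By convexity the lines
through neighbouring values are such minorants (`lockLine_le_lockValue`); their supremum is
`relaxedEnergy`. Conversely, periods of an n-pattern followed by periods of an (n+1)-pattern realize
it, once a slope σ producing the required mean is found (`exists_slope`, `isLeast_interpValues`).
This is the interpolation formula.

Without phase constraint, constant minorants suffice, and the relaxation at z is the maximum over σ
of σz + min_j v(j/M,σ). As σ grows the optimal index moves from 0 to M, switching from n to n+1 at
`criticalSlope`. Between switches one P^{M,n} gives the relaxation; at a switch the mean jumps,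
which produces an affine piece. The phase set is read off from the contact of `relaxedEnergy` with
the supporting line (`contact_of_relaxedEnergy_le`, `contact_unique_of_segment`). In the strictly
convex, differentiable case a degenerate interval would yield a supporting line of g at z*, making g
convex (`lockMean_lt_succ`, `lockMean_strictMono`). Each switch then happens at one slope only
(`slope_unique`), which excludes further locking states. -/

/-! ### Existence of saddle points of the two-phase mixture energy. -/

/-- A lower semicontinuous function that is large outside a ball attains its minimum on a closed
set. -/
theorem exists_min_of_large_outside_ball {E : Type*} [NormedAddCommGroup E] [ProperSpace E]
    {S : Set E} (hS : IsClosed S) {φ : E → ℝ} (hφ : LowerSemicontinuous φ) {x₀ : E} (hx₀ : x₀ ∈ S)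
    {R : ℝ} (hR : ∀ x ∈ S, R < ‖x‖ → φ x₀ ≤ φ x) : ∃ x ∈ S, ∀ y ∈ S, φ x ≤ φ y := by
  have hcpt : IsCompact (S ∩ Metric.closedBall 0 (max R ‖x₀‖)) :=
    (isCompact_closedBall _ _).inter_left hS
  obtain ⟨x, hx, hmin⟩ := LowerSemicontinuousOn.exists_isMinOn
    (⟨x₀, hx₀, by simp⟩ : (S ∩ Metric.closedBall 0 (max R ‖x₀‖)).Nonempty) hcpt
    (hφ.lowerSemicontinuousOn _)
  refine ⟨x, hx.1, fun y hy => ?_⟩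
  by_cases hyR : ‖y‖ ≤ max R ‖x₀‖
  · exact hmin ⟨hy, by simpa using hyR⟩
  · push Not at hyR
    exact (hmin (⟨hx₀, by simp⟩ : x₀ ∈ S ∩ Metric.closedBall 0 (max R ‖x₀‖))).trans
      (hR y hy ((le_max_left _ _).trans_lt hyR))

/-- A bi-convex, coercive, lower semicontinuous nearest-neighbour energy `g` with phases
`(-∞, zs]`, `[zs, ∞)`, together with a positive stiffness `K`. -/
structure PhaseEnergy (g : ℝ → ℝ) (zs c K : ℝ) : Prop where
  conv_left : ConvexOn ℝ (Set.Iic zs) g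
  conv_right : ConvexOn ℝ (Set.Ici zs) g
  lsc : LowerSemicontinuous g
  c_pos : 0 < c
  K_pos : 0 < K
  coercive : ∀ x, x ^ 2 / c ≤ g x

/-- `a` and `b` minimize `g` in the two phases for the common slope `τ = σ - 2 K z`, where `z` is
their mean with weights `1 - θ` and `θ`. -/
structure IsSaddle (g : ℝ → ℝ) (zs K θ σ a b : ℝ) : Prop where
  left_le : a ≤ zs
  le_right : zs ≤ b
  min_left : ∀ x ≤ zs, g a - (σ - 2 * K * ((1 - θ) * a + θ * b)) * a ≤
    g x - (σ - 2 * K * ((1 - θ) * a + θ * b)) * x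
  min_right : ∀ x, zs ≤ x → g b - (σ - 2 * K * ((1 - θ) * a + θ * b)) * b ≤
    g x - (σ - 2 * K * ((1 - θ) * a + θ * b)) * x

theorem sq_div_sub_mul_ge {c : ℝ} (hc : 0 < c) (σ x : ℝ) :
    -(c * σ ^ 2 / 4) ≤ x ^ 2 / c - σ * x := by
  have : x ^ 2 / c - σ * x + c * σ ^ 2 / 4 = (x - c * σ / 2) ^ 2 / c := by
    field_simp; ring
  have h2 : 0 ≤ (x - c * σ / 2) ^ 2 / c := by positivity
  linarith

theorem sq_div_sub_mul_large {c : ℝ} (hc : 0 < c) (σ V x : ℝ)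
    (hx : c * (|σ| + |V|) + 1 < |x|) : V ≤ x ^ 2 / c - σ * x := by
  have h1 : |σ| + |V| ≤ |x| / c := by
    rw [le_div_iff₀ hc]; linarith
  have h0 : 1 ≤ |x| := by
    have : 0 ≤ c * (|σ| + |V|) := by positivity
    linarith
  have h2 : x ^ 2 / c = |x| * (|x| / c) := by
    rw [← sq_abs]; ring
  have h3 : σ * x ≤ |σ| * |x| := by rw [← abs_mul]; exact le_abs_self _
  have h4 : |x| * (|σ| + |V|) ≤ |x| * (|x| / c) := mul_le_mul_of_nonneg_left h1 (abs_nonneg x)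
  have h5 : |V| ≤ |x| * |V| := le_mul_of_one_le_left (abs_nonneg V) h0
  have h6 := le_abs_self V
  rw [h2]; linarith

/-- First-order condition without differentiability of g: along a segment issuing from the
minimizer, the square may be replaced by its tangent at the cost of a second-order term. With r the
frozen contribution of the other phase, this decouples a joint minimum into one condition per phase.
-/
theorem convex_first_order {g : ℝ → ℝ} {S : Set ℝ} (hg : ConvexOn ℝ S g) {w K σ r x₀ : ℝ}
    (hw : 0 < w) (hK : 0 ≤ K) (hx₀ : x₀ ∈ S)
    (hmin : ∀ x ∈ S, w * g x₀ + K * (w * x₀ + r) ^ 2 - σ * (w * x₀ + r) ≤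
      w * g x + K * (w * x + r) ^ 2 - σ * (w * x + r)) :
    ∀ x ∈ S, g x₀ - (σ - 2 * K * (w * x₀ + r)) * x₀ ≤ g x - (σ - 2 * K * (w * x₀ + r)) * x := by
  intro x hx
  by_contra hlt
  push Not at hlt
  set X := g x - g x₀ - (σ - 2 * K * (w * x₀ + r)) * (x - x₀) with hX
  have hX0 : X < 0 := by rw [hX]; linarith
  set D := K * w * (x - x₀) ^ 2 with hD
  have hD0 : 0 ≤ D := by positivity
  -- Comparison with the point (1-s)x₀ + s x, divided by w s.
  have key : ∀ s : ℝ, 0 < s → s ≤ 1 → 0 ≤ X + s * D := by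
    intro s hs hs1
    have hc := hg.2 hx₀ hx (by linarith : (0 : ℝ) ≤ 1 - s) hs.le (by ring)
    have hm := hmin _ (hg.1 hx₀ hx (by linarith : (0 : ℝ) ≤ 1 - s) hs.le (by ring))
    simp only [smul_eq_mul] at hc hm
    have hc' := mul_le_mul_of_nonneg_left hc hw.le
    have : 0 ≤ (w * s) * (X + s * D) := by
      rw [hX, hD]
      nlinarith
    exact nonneg_of_mul_nonneg_right this (by positivity)
  -- This s makes the second-order term s D at most -X/2, which is too small to compensate X < 0.
  have hs := key (min 1 (-X / (2 * (D + 1)))) (lt_min one_pos (by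
    apply div_pos <;> linarith)) (min_le_left _ _)
  have h2 : min 1 (-X / (2 * (D + 1))) * D ≤ -X / (2 * (D + 1)) * (D + 1) := by
    apply mul_le_mul (min_le_right _ _) (by linarith) hD0
    apply div_nonneg <;> linarith
  have h3 : -X / (2 * (D + 1)) * (D + 1) = -X / 2 := by
    field_simp
  linarith

namespace PhaseEnergy

variable {g : ℝ → ℝ} {zs c K : ℝ}

theorem nonneg (h : PhaseEnergy g zs c K) (x : ℝ) : 0 ≤ g x :=
  le_trans (by have := h.c_pos; positivity) (h.coercive x)

theorem exists_argmin (h : PhaseEnergy g zs c K) {S : Set ℝ} (hS : IsClosed S) (hne : S.Nonempty)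
    {κ : ℝ} (hκ : 0 ≤ κ) (σ : ℝ) :
    ∃ x ∈ S, ∀ y ∈ S, g x + κ * x ^ 2 - σ * x ≤ g y + κ * y ^ 2 - σ * y := by
  obtain ⟨x₀, hx₀⟩ := hne
  have hl : LowerSemicontinuous (fun x => g x + (κ * x ^ 2 - σ * x)) :=
    h.lsc.add (by fun_prop : Continuous fun x : ℝ => κ * x ^ 2 - σ * x).lowerSemicontinuous
  obtain ⟨x, hx, hm⟩ := exists_min_of_large_outside_ball hS hl hx₀
    (R := c * (|σ| + |g x₀ + (κ * x₀ ^ 2 - σ * x₀)|) + 1) (by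
      intro x _ hxR
      have h1 := sq_div_sub_mul_large h.c_pos σ _ x hxR
      have h2 := h.coercive x
      have h3 : 0 ≤ κ * x ^ 2 := by positivity
      linarith)
  exact ⟨x, hx, fun y hy => by have := hm y hy; linarith⟩

theorem exists_saddle (h : PhaseEnergy g zs c K) {θ : ℝ} (h0 : 0 ≤ θ) (h1 : θ ≤ 1) (σ : ℝ) :
    ∃ a b, IsSaddle g zs K θ σ a b := by
  rcases h0.eq_or_lt with rfl | h0'
  -- Here b has weight zero and the joint problem is not coercive in b. So a is found first, and b
  -- minimizes afterwards for the slope that a determines; the case θ = 1 is symmetric.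
  · obtain ⟨a, ha, hma⟩ := h.exists_argmin isClosed_Iic Set.nonempty_Iic (S := Set.Iic zs)
      h.K_pos.le σ
    have hfo := convex_first_order h.conv_left (w := 1) (r := 0) one_pos h.K_pos.le ha
      (σ := σ) (by simpa using hma)
    obtain ⟨b, hb, hmb⟩ := h.exists_argmin isClosed_Ici Set.nonempty_Ici (S := Set.Ici zs)
      le_rfl (σ - 2 * K * a)
    refine ⟨a, b, ha, hb, ?_, ?_⟩
    · intro x hx; simpa using hfo x hx
    · intro x hx; simpa using hmb x hx
  rcases h1.eq_or_lt with rfl | h1'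
  · obtain ⟨b, hb, hmb⟩ := h.exists_argmin isClosed_Ici Set.nonempty_Ici (S := Set.Ici zs)
      h.K_pos.le σ
    have hfo := convex_first_order h.conv_right (w := 1) (r := 0) one_pos h.K_pos.le hb
      (σ := σ) (by simpa using hmb)
    obtain ⟨a, ha, hma⟩ := h.exists_argmin isClosed_Iic Set.nonempty_Iic (S := Set.Iic zs)
      le_rfl (σ - 2 * K * b)
    refine ⟨a, b, ha, hb, ?_, ?_⟩
    · intro x hx; simpa using hma x hx
    · intro x hx; simpa using hfo x hx
  · have hlsc : LowerSemicontinuous (fun q : ℝ × ℝ => ((1 - θ) * g q.1 + θ * g q.2) +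
        (K * ((1 - θ) * q.1 + θ * q.2) ^ 2 - σ * ((1 - θ) * q.1 + θ * q.2))) := by
      have hmul : ∀ w : ℝ, 0 ≤ w → LowerSemicontinuous fun x => w * g x := fun w hw =>
        (continuous_const_mul w).comp_lowerSemicontinuous h.lsc
          (fun x y hxy => mul_le_mul_of_nonneg_left hxy hw)
      refine (LowerSemicontinuous.add ?_ ?_).add (Continuous.lowerSemicontinuous (by fun_prop))
      · exact (hmul (1 - θ) (by linarith)).comp continuous_fst
      · exact (hmul θ h0).comp continuous_snd
    set φ := fun q : ℝ × ℝ => ((1 - θ) * g q.1 + θ * g q.2) +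
        (K * ((1 - θ) * q.1 + θ * q.2) ^ 2 - σ * ((1 - θ) * q.1 + θ * q.2)) with hφ
    set C := c * σ ^ 2 / 4 with hC
    have hC0 : 0 ≤ C := by have := h.c_pos; positivity
    set μ := min (1 - θ) θ with hμ
    have hμ0 : 0 < μ := lt_min (by linarith) h0'
    -- If one coordinate is large, its term is at least V and the other at least -C, so μ V - C ≥
    -- φ(zs, zs) is the level needed.
    set V := (|φ (zs, zs)| + C) / μ with hV
    have hV0 : 0 ≤ V := by positivity
    have hμV : μ * V = |φ (zs, zs)| + C := by rw [hV]; field_simp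
    obtain ⟨⟨a, b⟩, hab, hm⟩ := exists_min_of_large_outside_ball
      (S := Set.Iic zs ×ˢ Set.Ici zs) (isClosed_Iic.prod isClosed_Ici) hlsc (x₀ := (zs, zs))
      (by simp) (R := c * (|σ| + |V|) + 1) (by
        rintro ⟨x, y⟩ _ hR
        have hx := h.coercive x
        have hy := h.coercive y
        have hx2 := sq_div_sub_mul_ge h.c_pos σ x
        have hy2 := sq_div_sub_mul_ge h.c_pos σ y
        have hK : 0 ≤ K * ((1 - θ) * x + θ * y) ^ 2 := by have := h.K_pos; positivity
        have hle := le_abs_self (φ (zs, zs))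
        have hxw : ∀ t, t ≤ g x - σ * x → (1 - θ) * t ≤ (1 - θ) * (g x - σ * x) := fun t ht =>
          mul_le_mul_of_nonneg_left ht (by linarith)
        have hyw : ∀ t, t ≤ g y - σ * y → θ * t ≤ θ * (g y - σ * y) := fun t ht =>
          mul_le_mul_of_nonneg_left ht (by linarith)
        change φ (zs, zs) ≤ ((1 - θ) * g x + θ * g y) +
          (K * ((1 - θ) * x + θ * y) ^ 2 - σ * ((1 - θ) * x + θ * y))
        rw [Prod.norm_def, lt_max_iff] at hR
        rcases hR with hR | hR
        · have h3 := hxw V (by linarith [sq_div_sub_mul_large h.c_pos σ V x hR])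
          have h4 := hyw (-C) (by linarith)
          have h5 : μ * V ≤ (1 - θ) * V := mul_le_mul_of_nonneg_right (min_le_left _ _) hV0
          nlinarith
        · have h3 := hyw V (by linarith [sq_div_sub_mul_large h.c_pos σ V y hR])
          have h4 := hxw (-C) (by linarith)
          have h5 : μ * V ≤ θ * V := mul_le_mul_of_nonneg_right (min_le_right _ _) hV0
          nlinarith)
    have ha : a ≤ zs := hab.1
    have hb : zs ≤ b := hab.2
    refine ⟨a, b, ha, hb, ?_, ?_⟩
    · refine convex_first_order h.conv_left (by linarith) h.K_pos.le ha (fun x hx => ?_)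
      have := hm (x, b) ⟨hx, hb⟩
      simp only [hφ] at this
      linarith
    · intro x hx
      have := convex_first_order h.conv_right (w := θ) (r := (1 - θ) * a) (σ := σ)
        (by linarith) h.K_pos.le hb
        (fun x hx => by
          have := hm (a, x) ⟨ha, hx⟩
          simp only [hφ] at this
          rw [add_comm (θ * b), add_comm (θ * x)]
          linarith) x hx
      rwa [add_comm (θ * b)] at this

end PhaseEnergy

/-! ### Saddle values: duality, convexity in the fraction, concavity in the slope. -/

noncomputable section

/-- A choice of saddle point for the phase fraction `θ` and the slope `σ`. -/
def saddlePair (g : ℝ → ℝ) (zs K θ σ : ℝ) : ℝ × ℝ :=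
  Classical.epsilon fun q : ℝ × ℝ => IsSaddle g zs K θ σ q.1 q.2

/-- The mean strain of the saddle point. -/
def saddleMean (g : ℝ → ℝ) (zs K θ σ : ℝ) : ℝ :=
  (1 - θ) * (saddlePair g zs K θ σ).1 + θ * (saddlePair g zs K θ σ).2

/-- The common slope of the nearest-neighbour energy at the saddle point. -/
def saddleSlope (g : ℝ → ℝ) (zs K θ σ : ℝ) : ℝ := σ - 2 * K * saddleMean g zs K θ σ

/-- The energy per site of a mixture of the strains `a`, `b` with weights `1 - θ`, `θ`. -/
def mixEnergy (g : ℝ → ℝ) (K θ a b : ℝ) : ℝ :=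
  (1 - θ) * g a + θ * g b + K * ((1 - θ) * a + θ * b) ^ 2

/-- The minimum over mixtures of energy minus `σ` times mean strain. -/
def saddleValue (g : ℝ → ℝ) (zs K θ σ : ℝ) : ℝ :=
  mixEnergy g K θ (saddlePair g zs K θ σ).1 (saddlePair g zs K θ σ).2
    - σ * saddleMean g zs K θ σ

/-- The infimum of `g x - τ x` over a phase `S`. -/
def phaseInf (g : ℝ → ℝ) (S : Set ℝ) (τ : ℝ) : ℝ := sInf ((fun x => g x - τ * x) '' S)

theorem phaseInf_eq {g : ℝ → ℝ} {S : Set ℝ} {τ x : ℝ} (hx : x ∈ S)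
    (hmin : ∀ y ∈ S, g x - τ * x ≤ g y - τ * y) : phaseInf g S τ = g x - τ * x :=
  IsLeast.csInf_eq ⟨⟨x, hx, rfl⟩, by rintro _ ⟨y, hy, rfl⟩; exact hmin y hy⟩

namespace PhaseEnergy

variable {g : ℝ → ℝ} {zs c K : ℝ}

theorem exists_phaseInf_eq (h : PhaseEnergy g zs c K) {S : Set ℝ} (hS : IsClosed S)
    (hne : S.Nonempty) (τ : ℝ) :
    ∃ x ∈ S, phaseInf g S τ = g x - τ * x ∧ ∀ y ∈ S, g x - τ * x ≤ g y - τ * y := by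
  obtain ⟨x, hx, hm⟩ := h.exists_argmin hS hne le_rfl τ
  have hm' : ∀ y ∈ S, g x - τ * x ≤ g y - τ * y := fun y hy => by simpa using hm y hy
  exact ⟨x, hx, phaseInf_eq hx hm', hm'⟩

theorem phaseInf_le (h : PhaseEnergy g zs c K) {S : Set ℝ} (hS : IsClosed S) {τ x : ℝ}
    (hx : x ∈ S) : phaseInf g S τ ≤ g x - τ * x := by
  obtain ⟨y, _, he, hm⟩ := h.exists_phaseInf_eq hS ⟨x, hx⟩ τ
  exact he ▸ hm x hx

/-- The difference of the two phase infima is nonincreasing in the slope. -/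
theorem phaseInf_sub_antitone (h : PhaseEnergy g zs c K) {τ τ' : ℝ} (hτ : τ ≤ τ') :
    phaseInf g (Set.Ici zs) τ' - phaseInf g (Set.Iic zs) τ' ≤
      phaseInf g (Set.Ici zs) τ - phaseInf g (Set.Iic zs) τ := by
  obtain ⟨a, ha, hA, _⟩ := h.exists_phaseInf_eq isClosed_Iic (Set.nonempty_Iic (a := zs)) τ'
  obtain ⟨b, hb, hB, _⟩ := h.exists_phaseInf_eq isClosed_Ici (Set.nonempty_Ici (a := zs)) τ
  have h1 := h.phaseInf_le isClosed_Iic (τ := τ) ha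
  have h2 := h.phaseInf_le isClosed_Ici (τ := τ') hb
  simp only [Set.mem_Iic, Set.mem_Ici] at ha hb
  nlinarith

theorem isSaddle (h : PhaseEnergy g zs c K) {θ : ℝ} (h0 : 0 ≤ θ) (h1 : θ ≤ 1) (σ : ℝ) :
    IsSaddle g zs K θ σ (saddlePair g zs K θ σ).1 (saddlePair g zs K θ σ).2 := by
  obtain ⟨a, b, hab⟩ := h.exists_saddle h0 h1 σ
  exact Classical.epsilon_spec (p := fun q : ℝ × ℝ => IsSaddle g zs K θ σ q.1 q.2) ⟨(a, b), hab⟩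

theorem phaseInf_left (h : PhaseEnergy g zs c K) {θ : ℝ} (h0 : 0 ≤ θ) (h1 : θ ≤ 1) (σ : ℝ) :
    phaseInf g (Set.Iic zs) (saddleSlope g zs K θ σ) =
      g (saddlePair g zs K θ σ).1 - saddleSlope g zs K θ σ * (saddlePair g zs K θ σ).1 :=
  phaseInf_eq (h.isSaddle h0 h1 σ).left_le (h.isSaddle h0 h1 σ).min_left

theorem phaseInf_right (h : PhaseEnergy g zs c K) {θ : ℝ} (h0 : 0 ≤ θ) (h1 : θ ≤ 1) (σ : ℝ) :
    phaseInf g (Set.Ici zs) (saddleSlope g zs K θ σ) =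
      g (saddlePair g zs K θ σ).2 - saddleSlope g zs K θ σ * (saddlePair g zs K θ σ).2 :=
  phaseInf_eq (h.isSaddle h0 h1 σ).le_right (h.isSaddle h0 h1 σ).min_right

/-- There is no duality gap: the dual functional, affine in θ for a fixed slope τ, is attained at
`saddleSlope`. -/
theorem saddleValue_eq (h : PhaseEnergy g zs c K) {θ : ℝ} (h0 : 0 ≤ θ) (h1 : θ ≤ 1) (σ : ℝ) :
    saddleValue g zs K θ σ = (1 - θ) * phaseInf g (Set.Iic zs) (saddleSlope g zs K θ σ) +
      θ * phaseInf g (Set.Ici zs) (saddleSlope g zs K θ σ) - K * saddleMean g zs K θ σ ^ 2 := by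
  rw [h.phaseInf_left h0 h1, h.phaseInf_right h0 h1]
  simp only [saddleValue, mixEnergy, saddleSlope, saddleMean]
  ring

theorem mixEnergy_eq (θ σ : ℝ) :
    mixEnergy g K θ (saddlePair g zs K θ σ).1 (saddlePair g zs K θ σ).2 =
      σ * saddleMean g zs K θ σ + saddleValue g zs K θ σ := by
  simp [saddleValue]

/-- The saddle point minimizes energy minus `σ` times mean strain, with a quadratic gain. -/
theorem le_mixEnergy (h : PhaseEnergy g zs c K) {θ : ℝ} (h0 : 0 ≤ θ) (h1 : θ ≤ 1) (σ : ℝ)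
    {a b : ℝ} (ha : a ≤ zs) (hb : zs ≤ b) :
    σ * ((1 - θ) * a + θ * b) + saddleValue g zs K θ σ +
      K * ((1 - θ) * a + θ * b - saddleMean g zs K θ σ) ^ 2 ≤ mixEnergy g K θ a b := by
  have hA := mul_le_mul_of_nonneg_left
    (h.phaseInf_le isClosed_Iic (τ := saddleSlope g zs K θ σ) (x := a) ha) (sub_nonneg.2 h1)
  have hB := mul_le_mul_of_nonneg_left
    (h.phaseInf_le isClosed_Ici (τ := saddleSlope g zs K θ σ) (x := b) hb) h0
  rw [h.saddleValue_eq h0 h1, mixEnergy]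
  have hs : saddleSlope g zs K θ σ = σ - 2 * K * saddleMean g zs K θ σ := rfl
  generalize phaseInf g (Set.Iic zs) (saddleSlope g zs K θ σ) = A at *
  generalize phaseInf g (Set.Ici zs) (saddleSlope g zs K θ σ) = B at *
  rw [hs] at hA hB
  linarith

/-- Lower bound of a saddle value by the dual functional, with a quadratic gain. -/
theorem dual_le_saddleValue (h : PhaseEnergy g zs c K) {θ : ℝ} (h0 : 0 ≤ θ) (h1 : θ ≤ 1)
    (σ τ y : ℝ) (hy : 2 * K * y = σ - τ) :
    (1 - θ) * phaseInf g (Set.Iic zs) τ + θ * phaseInf g (Set.Ici zs) τ - K * y ^ 2 +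
      K * (saddleMean g zs K θ σ - y) ^ 2 ≤ saddleValue g zs K θ σ := by
  have hA := mul_le_mul_of_nonneg_left
    (h.phaseInf_le isClosed_Iic (τ := τ) (h.isSaddle h0 h1 σ).left_le) (sub_nonneg.2 h1)
  have hB := mul_le_mul_of_nonneg_left
    (h.phaseInf_le isClosed_Ici (τ := τ) (h.isSaddle h0 h1 σ).le_right) h0
  have hτ : τ = σ - 2 * K * y := by linarith
  have hv : saddleValue g zs K θ σ = (1 - θ) * g (saddlePair g zs K θ σ).1 +
    θ * g (saddlePair g zs K θ σ).2 + K * saddleMean g zs K θ σ ^ 2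
      - σ * saddleMean g zs K θ σ := by
    simp only [saddleValue, mixEnergy, saddleMean]
  have hz : saddleMean g zs K θ σ = (1 - θ) * (saddlePair g zs K θ σ).1 +
    θ * (saddlePair g zs K θ σ).2 := rfl
  rw [hv]
  generalize (saddlePair g zs K θ σ).1 = a at *
  generalize (saddlePair g zs K θ σ).2 = b at *
  generalize saddleMean g zs K θ σ = z at *
  -- The gain comes from completing the square: K z² - 2Kyz = K(z-y)² - K y².
  have h3 : τ * ((1 - θ) * a + θ * b) = (σ - 2 * K * y) * z := by rw [hτ, hz]
  nlinarith

/-- The derivative of the saddle value with respect to the phase fraction. -/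
def phaseGap (g : ℝ → ℝ) (zs K θ σ : ℝ) : ℝ :=
  phaseInf g (Set.Ici zs) (saddleSlope g zs K θ σ)
    - phaseInf g (Set.Iic zs) (saddleSlope g zs K θ σ)

/-- The saddle value is convex in the phase fraction: subgradient inequality with a quadratic
gain. -/
theorem saddleValue_subgradient (h : PhaseEnergy g zs c K) {θ θ' : ℝ} (h0 : 0 ≤ θ) (h1 : θ ≤ 1)
    (h0' : 0 ≤ θ') (h1' : θ' ≤ 1) (σ : ℝ) :
    saddleValue g zs K θ σ + (θ' - θ) * phaseGap g zs K θ σ +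
      K * (saddleMean g zs K θ' σ - saddleMean g zs K θ σ) ^ 2 ≤ saddleValue g zs K θ' σ := by
  -- The dual optimum for θ is a competitor for θ'; the dual functional is affine in the fraction
  -- with slope `phaseGap`.
  have := h.dual_le_saddleValue h0' h1' σ (saddleSlope g zs K θ σ) (saddleMean g zs K θ σ)
    (by simp [saddleSlope])
  rw [h.saddleValue_eq h0 h1, phaseGap]
  linarith

/-- The mean strain of the saddle point is nondecreasing in the phase fraction. -/
theorem saddleMean_mono_fraction (h : PhaseEnergy g zs c K) {θ θ' : ℝ} (h0 : 0 ≤ θ)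
    (h1' : θ' ≤ 1) (hθ : θ ≤ θ') (σ : ℝ) : saddleMean g zs K θ σ ≤ saddleMean g zs K θ' σ := by
  rcases hθ.eq_or_lt with rfl | hθ
  · rfl
  by_contra hlt
  push Not at hlt
  have hK := h.K_pos
  -- A smaller mean at θ' means a larger slope there, hence a smaller `phaseGap`. But the two
  -- subgradient inequalities with their gains make the gap strictly larger at θ'.
  have hτ : saddleSlope g zs K θ σ ≤ saddleSlope g zs K θ' σ := by
    simp only [saddleSlope]; nlinarith
  have h3 := h.phaseInf_sub_antitone hτ
  have h4 := h.saddleValue_subgradient h0 (hθ.le.trans h1') (h0.trans hθ.le) h1' σ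
  have h5 := h.saddleValue_subgradient (h0.trans hθ.le) h1' h0 (hθ.le.trans h1') σ
  have h6 : phaseGap g zs K θ' σ ≤ phaseGap g zs K θ σ := h3
  have h7 : 0 < K * (saddleMean g zs K θ' σ - saddleMean g zs K θ σ) ^ 2 := by
    have : saddleMean g zs K θ' σ - saddleMean g zs K θ σ ≠ 0 := by linarith
    positivity
  nlinarith

/-- The saddle value is concave in the slope: supergradient inequality with a quadratic gain. -/
theorem saddleValue_supergradient (h : PhaseEnergy g zs c K) {θ : ℝ} (h0 : 0 ≤ θ) (h1 : θ ≤ 1)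
    (σ σ' : ℝ) :
    saddleValue g zs K θ σ' + (σ' - σ) * saddleMean g zs K θ σ +
      K * (saddleMean g zs K θ σ' - saddleMean g zs K θ σ) ^ 2 ≤ saddleValue g zs K θ σ := by
  -- The saddle point for σ is tested in the minimum problem for σ'.
  have h2 := h.le_mixEnergy h0 h1 σ' (h.isSaddle h0 h1 σ).left_le (h.isSaddle h0 h1 σ).le_right
  rw [mixEnergy_eq] at h2
  have hz : saddleMean g zs K θ σ = (1 - θ) * (saddlePair g zs K θ σ).1 +
    θ * (saddlePair g zs K θ σ).2 := rfl
  rw [← hz] at h2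
  linarith

/-- Sum of the supergradient inequalities at σ and at σ'. The gains make the mean strongly monotone
in the inverse sense, which yields both monotonicity and the Lipschitz bound with constant 1/(2K).
-/
theorem saddleMean_gap (h : PhaseEnergy g zs c K) {θ : ℝ} (h0 : 0 ≤ θ) (h1 : θ ≤ 1)
    (σ σ' : ℝ) : 2 * K * (saddleMean g zs K θ σ' - saddleMean g zs K θ σ) ^ 2 ≤
      (σ' - σ) * (saddleMean g zs K θ σ' - saddleMean g zs K θ σ) := by
  have h2 := h.saddleValue_supergradient h0 h1 σ σ'
  have h3 := h.saddleValue_supergradient h0 h1 σ' σ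
  nlinarith

theorem saddleMean_mono (h : PhaseEnergy g zs c K) {θ : ℝ} (h0 : 0 ≤ θ) (h1 : θ ≤ 1) :
    Monotone (saddleMean g zs K θ) := by
  intro σ σ' hσ
  by_contra hlt
  push Not at hlt
  have h2 := h.saddleMean_gap h0 h1 σ σ'
  have hK := h.K_pos
  have h7 : 0 < K * (saddleMean g zs K θ σ' - saddleMean g zs K θ σ) ^ 2 := by
    have : saddleMean g zs K θ σ' - saddleMean g zs K θ σ ≠ 0 := by linarith
    positivity
  nlinarith

theorem abs_saddleMean_sub_le (h : PhaseEnergy g zs c K) {θ : ℝ} (h0 : 0 ≤ θ) (h1 : θ ≤ 1)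
    (σ σ' : ℝ) :
    2 * K * |saddleMean g zs K θ σ' - saddleMean g zs K θ σ| ≤ |σ' - σ| := by
  have h2 := h.saddleMean_gap h0 h1 σ σ'
  rcases eq_or_ne (saddleMean g zs K θ σ' - saddleMean g zs K θ σ) 0 with h3 | h3
  · rw [h3]; simp
  · have h4 : 0 < |saddleMean g zs K θ σ' - saddleMean g zs K θ σ| := abs_pos.2 h3
    refine le_of_mul_le_mul_right ?_ h4
    rw [← abs_mul]
    refine le_trans (le_of_eq ?_) (h2.trans (le_abs_self _))
    rw [← sq_abs (saddleMean g zs K θ σ' - saddleMean g zs K θ σ)]; ring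

theorem continuous_saddleMean (h : PhaseEnergy g zs c K) {θ : ℝ} (h0 : 0 ≤ θ) (h1 : θ ≤ 1) :
    Continuous (saddleMean g zs K θ) := by
  have hK := h.K_pos
  refine LipschitzWith.continuous (K := (1 / (2 * K)).toNNReal) (LipschitzWith.of_dist_le_mul ?_)
  intro x y
  rw [Real.dist_eq, Real.dist_eq, Real.coe_toNNReal _ (by positivity)]
  have := h.abs_saddleMean_sub_le h0 h1 y x
  rw [one_div, inv_mul_eq_div, le_div_iff₀ (by positivity)]
  linarith

theorem continuous_saddleValue (h : PhaseEnergy g zs c K) {θ : ℝ} (h0 : 0 ≤ θ) (h1 : θ ≤ 1) :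
    Continuous (saddleValue g zs K θ) := by
  have hc : ConcaveOn ℝ Set.univ (saddleValue g zs K θ) := by
    refine ⟨convex_univ, fun x _ y _ s t hs ht hst => ?_⟩
    have hK := h.K_pos
    have h2 := h.saddleValue_supergradient h0 h1 (s * x + t * y) x
    have h3 := h.saddleValue_supergradient h0 h1 (s * x + t * y) y
    simp only [smul_eq_mul]
    generalize saddleMean g zs K θ (s * x + t * y) = z at *
    have q1 : 0 ≤ K * (saddleMean g zs K θ x - z) ^ 2 := by positivity
    have q2 : 0 ≤ K * (saddleMean g zs K θ y - z) ^ 2 := by positivity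
    have h4 := le_trans (le_add_of_nonneg_right q1) h2
    have h5 := le_trans (le_add_of_nonneg_right q2) h3
    have h6 := mul_le_mul_of_nonneg_left h4 hs
    have h7 := mul_le_mul_of_nonneg_left h5 ht
    have hs' : s = 1 - t := by linarith
    subst hs'
    linarith
  exact continuousOn_univ.1 (hc.continuousOn isOpen_univ)

/-- Differences of saddle values for two phase fractions are nonincreasing in the slope. -/
theorem saddleValue_sub_antitone (h : PhaseEnergy g zs c K) {θ θ' : ℝ} (h0 : 0 ≤ θ)
    (h1' : θ' ≤ 1) (hθ : θ ≤ θ') {σ σ' : ℝ} (hσ : σ ≤ σ') :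
    saddleValue g zs K θ' σ' - saddleValue g zs K θ σ' ≤
      saddleValue g zs K θ' σ - saddleValue g zs K θ σ := by
  have hK := h.K_pos
  have h1 := hθ.trans h1'
  have h0' := h0.trans hθ
  have e1 := h.saddleValue_eq h0' h1' σ'
  have e2 := h.saddleValue_eq h0 h1 σ
  have s1 : saddleSlope g zs K θ' σ' = σ' - 2 * K * saddleMean g zs K θ' σ' := rfl
  have s2 : saddleSlope g zs K θ σ = σ - 2 * K * saddleMean g zs K θ σ := rfl
  have hq : ∀ y w : ℝ, 0 ≤ K * (w - y) ^ 2 := fun y w => by positivity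
  -- Let τ₁ be the dual optimum of (θ',σ') and τ₂ that of (θ,σ); both are used as competitors for
  -- the mixed pairs. If τ₁ ≤ τ₂, each keeps its fraction: the phase terms cancel, and the terms
  -- (σ-τ)²/(4K) are favourable by rearrangement.
  rcases le_total (saddleSlope g zs K θ' σ') (saddleSlope g zs K θ σ) with hle | hle
  · have d1 := h.dual_le_saddleValue h0' h1' σ (saddleSlope g zs K θ' σ')
      (saddleMean g zs K θ' σ' - (σ' - σ) / (2 * K)) (by rw [s1]; field_simp; ring)
    have d2 := h.dual_le_saddleValue h0 h1 σ' (saddleSlope g zs K θ σ)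
      (saddleMean g zs K θ σ + (σ' - σ) / (2 * K)) (by rw [s2]; field_simp; ring)
    have h3 := hq (saddleMean g zs K θ' σ' - (σ' - σ) / (2 * K)) (saddleMean g zs K θ' σ)
    have h4 := hq (saddleMean g zs K θ σ + (σ' - σ) / (2 * K)) (saddleMean g zs K θ σ')
    have h5 : 0 ≤ (σ' - σ) * (saddleSlope g zs K θ σ - saddleSlope g zs K θ' σ') :=
      mul_nonneg (by linarith) (by linarith)
    rw [s1, s2] at h5
    have h6 : K * (saddleMean g zs K θ' σ' - (σ' - σ) / (2 * K)) ^ 2 =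
      K * saddleMean g zs K θ' σ' ^ 2 - (σ' - σ) * saddleMean g zs K θ' σ'
        + (σ' - σ) ^ 2 / (4 * K) := by field_simp; ring
    have h7 : K * (saddleMean g zs K θ σ + (σ' - σ) / (2 * K)) ^ 2 =
      K * saddleMean g zs K θ σ ^ 2 + (σ' - σ) * saddleMean g zs K θ σ
        + (σ' - σ) ^ 2 / (4 * K) := by field_simp; ring
    have h8 : (σ' - σ) * (σ - 2 * K * saddleMean g zs K θ σ -
        (σ' - 2 * K * saddleMean g zs K θ' σ')) / (2 * K) =
        (σ' - σ) * (saddleMean g zs K θ' σ' - saddleMean g zs K θ σ)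
          - (σ' - σ) ^ 2 / (4 * K) - (σ' - σ) ^ 2 / (4 * K) := by field_simp; ring
    have h9 := div_nonneg h5 (by positivity : 0 ≤ 2 * K)
    rw [h8] at h9
    nlinarith
  -- If τ₂ ≤ τ₁, each competitor keeps its σ instead: the squares cancel, and the phase terms are
  -- favourable by `phaseInf_sub_antitone`.
  · have d1 := h.dual_le_saddleValue h0 h1 σ' (saddleSlope g zs K θ' σ')
      (saddleMean g zs K θ' σ') (by rw [s1]; ring)
    have d2 := h.dual_le_saddleValue h0' h1' σ (saddleSlope g zs K θ σ)
      (saddleMean g zs K θ σ) (by rw [s2]; ring)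
    have h3 := hq (saddleMean g zs K θ' σ') (saddleMean g zs K θ σ')
    have h4 := hq (saddleMean g zs K θ σ) (saddleMean g zs K θ' σ)
    have h5 := h.phaseInf_sub_antitone hle
    have h6 := mul_le_mul_of_nonneg_left h5 (sub_nonneg.2 hθ)
    nlinarith

/-- If the differences agree at two slopes, then at the larger slope the means agree. -/
theorem saddleMean_eq_of_saddleValue_sub_eq (h : PhaseEnergy g zs c K) {θ θ' : ℝ} (h0 : 0 ≤ θ)
    (h1' : θ' ≤ 1) (hθ : θ ≤ θ') {σ σ' : ℝ} (hσ : σ < σ')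
    (heq : saddleValue g zs K θ' σ' - saddleValue g zs K θ σ' =
      saddleValue g zs K θ' σ - saddleValue g zs K θ σ) :
    saddleMean g zs K θ' σ' = saddleMean g zs K θ σ' := by
  have hm := h.saddleMean_mono_fraction h0 h1' hθ ((σ + σ') / 2)
  have hK := h.K_pos
  have h1 := hθ.trans h1'
  have h0' := h0.trans hθ
  have e1 := h.saddleValue_eq h0' h1' σ'
  have e2 := h.saddleValue_eq h0 h1 σ
  have s1 : saddleSlope g zs K θ' σ' = σ' - 2 * K * saddleMean g zs K θ' σ' := rfl
  have s2 : saddleSlope g zs K θ σ = σ - 2 * K * saddleMean g zs K θ σ := rfl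
  have hq : ∀ y w : ℝ, 0 ≤ K * (w - y) ^ 2 := fun y w => by positivity
  -- The same exchange in the equality case: the rearrangement is strict when the slopes are
  -- strictly ordered, so only the second exchange remains, and there the gain at σ' must vanish.
  rcases lt_or_ge (saddleSlope g zs K θ' σ') (saddleSlope g zs K θ σ) with hle | hle
  · exfalso
    have d1 := h.dual_le_saddleValue h0' h1' σ (saddleSlope g zs K θ' σ')
      (saddleMean g zs K θ' σ' - (σ' - σ) / (2 * K)) (by rw [s1]; field_simp; ring)
    have d2 := h.dual_le_saddleValue h0 h1 σ' (saddleSlope g zs K θ σ)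
      (saddleMean g zs K θ σ + (σ' - σ) / (2 * K)) (by rw [s2]; field_simp; ring)
    have h3 := hq (saddleMean g zs K θ' σ' - (σ' - σ) / (2 * K)) (saddleMean g zs K θ' σ)
    have h4 := hq (saddleMean g zs K θ σ + (σ' - σ) / (2 * K)) (saddleMean g zs K θ σ')
    have h5 : 0 < (σ' - σ) * (saddleSlope g zs K θ σ - saddleSlope g zs K θ' σ') :=
      mul_pos (by linarith) (by linarith)
    rw [s1, s2] at h5
    have h6 : K * (saddleMean g zs K θ' σ' - (σ' - σ) / (2 * K)) ^ 2 =
      K * saddleMean g zs K θ' σ' ^ 2 - (σ' - σ) * saddleMean g zs K θ' σ'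
        + (σ' - σ) ^ 2 / (4 * K) := by field_simp; ring
    have h7 : K * (saddleMean g zs K θ σ + (σ' - σ) / (2 * K)) ^ 2 =
      K * saddleMean g zs K θ σ ^ 2 + (σ' - σ) * saddleMean g zs K θ σ
        + (σ' - σ) ^ 2 / (4 * K) := by field_simp; ring
    have h8 : (σ' - σ) * (σ - 2 * K * saddleMean g zs K θ σ -
        (σ' - 2 * K * saddleMean g zs K θ' σ')) / (2 * K) =
        (σ' - σ) * (saddleMean g zs K θ' σ' - saddleMean g zs K θ σ)
          - (σ' - σ) ^ 2 / (4 * K) - (σ' - σ) ^ 2 / (4 * K) := by field_simp; ring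
    have h9 := div_pos h5 (by positivity : 0 < 2 * K)
    rw [h8] at h9
    nlinarith
  · have d1 := h.dual_le_saddleValue h0 h1 σ' (saddleSlope g zs K θ' σ')
      (saddleMean g zs K θ' σ') (by rw [s1]; ring)
    have d2 := h.dual_le_saddleValue h0' h1' σ (saddleSlope g zs K θ σ)
      (saddleMean g zs K θ σ) (by rw [s2]; ring)
    have h3 := hq (saddleMean g zs K θ σ) (saddleMean g zs K θ' σ)
    have h5 := h.phaseInf_sub_antitone hle
    have h6 := mul_le_mul_of_nonneg_left h5 (sub_nonneg.2 hθ)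
    by_contra hne
    have h4 : 0 < K * (saddleMean g zs K θ σ' - saddleMean g zs K θ' σ') ^ 2 := by
      have : saddleMean g zs K θ σ' - saddleMean g zs K θ' σ' ≠ 0 := sub_ne_zero.2 (Ne.symm hne)
      positivity
    nlinarith

/-- If three saddle values coincide at increasing fractions, so do the means. -/
theorem saddleMean_eq_of_three (h : PhaseEnergy g zs c K) {θ₁ θ₂ θ₃ σ : ℝ} (h0 : 0 ≤ θ₁)
    (h12 : θ₁ < θ₂) (h23 : θ₂ < θ₃) (h1 : θ₃ ≤ 1)
    (e1 : saddleValue g zs K θ₁ σ = saddleValue g zs K θ₂ σ)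
    (e3 : saddleValue g zs K θ₃ σ = saddleValue g zs K θ₂ σ) :
    saddleMean g zs K θ₁ σ = saddleMean g zs K θ₂ σ ∧
      saddleMean g zs K θ₃ σ = saddleMean g zs K θ₂ σ := by
  have hK := h.K_pos
  have a1 := h.saddleValue_subgradient (θ := θ₂) (θ' := θ₁) (by linarith) (by linarith) h0
    (by linarith) σ
  have a3 := h.saddleValue_subgradient (θ := θ₂) (θ' := θ₃) (by linarith) (by linarith)
    (by linarith) h1 σ
  have q1 : 0 ≤ K * (saddleMean g zs K θ₁ σ - saddleMean g zs K θ₂ σ) ^ 2 := by positivity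
  have q3 : 0 ≤ K * (saddleMean g zs K θ₃ σ - saddleMean g zs K θ₂ σ) ^ 2 := by positivity
  -- A convex function with equal values at three points has subgradient zero at the middle one,
  -- from both sides; then both gains vanish.
  have hS1 : 0 ≤ phaseGap g zs K θ₂ σ := by
    by_contra hn
    push Not at hn
    nlinarith
  have hS3 : phaseGap g zs K θ₂ σ ≤ 0 := by
    by_contra hn
    push Not at hn
    nlinarith
  have hS : phaseGap g zs K θ₂ σ = 0 := le_antisymm hS3 hS1
  rw [hS] at a1 a3
  have z1 : (saddleMean g zs K θ₁ σ - saddleMean g zs K θ₂ σ) ^ 2 = 0 := by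
    have : K * (saddleMean g zs K θ₁ σ - saddleMean g zs K θ₂ σ) ^ 2 = 0 := by linarith
    exact (mul_eq_zero.1 this).resolve_left hK.ne'
  have z3 : (saddleMean g zs K θ₃ σ - saddleMean g zs K θ₂ σ) ^ 2 = 0 := by
    have : K * (saddleMean g zs K θ₃ σ - saddleMean g zs K θ₂ σ) ^ 2 = 0 := by linarith
    exact (mul_eq_zero.1 this).resolve_left hK.ne'
  exact ⟨sub_eq_zero.1 (pow_eq_zero_iff (by norm_num) |>.1 z1),
    sub_eq_zero.1 (pow_eq_zero_iff (by norm_num) |>.1 z3)⟩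

/-! ### Optimal phases for extreme slopes. -/

/-- For large slopes the pure right phase is strictly optimal. -/
theorem exists_right_optimal (h : PhaseEnergy g zs c K) :
    ∃ σ₀, ∀ σ, σ₀ < σ → ∀ θ, 0 ≤ θ → θ < 1 →
      saddleValue g zs K 1 σ < saddleValue g zs K θ σ := by
  set T := g (zs + 1) with hT
  have hT0 : 0 ≤ T := h.nonneg _
  have hc := h.c_pos
  have hK := h.K_pos
  refine ⟨T + 2 * K * (1 + c * (g zs + T * |zs| + T)), fun σ hσ θ h0 h1 => ?_⟩
  set b := (saddlePair g zs K 1 σ).2 with hb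
  set τ := saddleSlope g zs K 1 σ with hτ
  have hτb : τ = σ - 2 * K * b := by
    rw [hτ, hb]; simp [saddleSlope, saddleMean]
  have hbz : zs ≤ b := (h.isSaddle zero_le_one le_rfl σ).le_right
  have hmb : g b - τ * b ≤ g zs - τ * zs := by
    rw [hb, hτ, ← h.phaseInf_right zero_le_one le_rfl σ]
    exact h.phaseInf_le isClosed_Ici (Set.mem_Ici.2 le_rfl)
  -- Were τ ≤ T, the quadratic coercivity would bound the minimizer b, and σ = τ + 2Kb would not
  -- exceed the threshold.
  have hτT : T < τ := by
    by_contra hle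
    push Not at hle
    have h3 : b ≤ 1 + c * (g zs + T * |zs| + T) := by
      rcases le_or_gt b 1 with hb1 | hb1
      · have : 0 ≤ c * (g zs + T * |zs| + T) := by
          have := h.nonneg zs
          positivity
        linarith
      · have h4 : b ^ 2 ≤ c * g b := by
          have := h.coercive b
          rwa [div_le_iff₀ hc, mul_comm] at this
        have h5 : g b ≤ g zs + T * (b - zs) := by nlinarith
        have h6 : g b ≤ g zs + T * b + T * |zs| := by
          nlinarith [neg_abs_le zs]
        have h7 : g b ≤ (g zs + T * |zs| + T) * b := by
          have : 0 ≤ g zs + T * |zs| := by have := h.nonneg zs; positivity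
          nlinarith
        have h8 : b * b ≤ (c * (g zs + T * |zs| + T)) * b := by nlinarith
        have := le_of_mul_le_mul_right h8 (by linarith)
        linarith
    nlinarith
  -- With τ > T = g(zs+1) the right infimum is below -τ zs, by testing zs + 1, while the left one is
  -- at least -τ zs because g ≥ 0 and a ≤ zs.
  have hgap : phaseGap g zs K 1 σ < 0 := by
    obtain ⟨a, ha, hA, _⟩ := h.exists_phaseInf_eq isClosed_Iic (Set.nonempty_Iic (a := zs)) τ
    have hB := h.phaseInf_le (S := Set.Ici zs) isClosed_Ici (τ := τ) (x := zs + 1) (Set.mem_Ici.2 (by linarith))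
    rw [Set.mem_Iic] at ha
    have hga := h.nonneg a
    rw [phaseGap, ← hτ, hA]
    nlinarith
  have h5 := h.saddleValue_subgradient zero_le_one le_rfl h0 h1.le σ
  have h6 : 0 ≤ K * (saddleMean g zs K θ σ - saddleMean g zs K 1 σ) ^ 2 := by positivity
  nlinarith

/-- For very negative slopes the pure left phase is strictly optimal. -/
theorem exists_left_optimal (h : PhaseEnergy g zs c K) :
    ∃ σ₀, ∀ σ, σ < σ₀ → ∀ θ, 0 < θ → θ ≤ 1 →
      saddleValue g zs K 0 σ < saddleValue g zs K θ σ := by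
  set T := g (zs - 1) with hT
  have hT0 : 0 ≤ T := h.nonneg _
  have hc := h.c_pos
  have hK := h.K_pos
  refine ⟨-(T + 2 * K * (1 + c * (g zs + T * |zs| + T))), fun σ hσ θ h0 h1 => ?_⟩
  set a := (saddlePair g zs K 0 σ).1 with ha
  set τ := saddleSlope g zs K 0 σ with hτ
  have hτa : τ = σ - 2 * K * a := by
    rw [hτ, ha]; simp [saddleSlope, saddleMean]
  have haz : a ≤ zs := (h.isSaddle le_rfl zero_le_one σ).left_le
  have hma : g a - τ * a ≤ g zs - τ * zs := by
    rw [ha, hτ, ← h.phaseInf_left le_rfl zero_le_one σ]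
    exact h.phaseInf_le isClosed_Iic (Set.mem_Iic.2 le_rfl)
  have hτT : τ < -T := by
    by_contra hle
    push Not at hle
    have h3 : -a ≤ 1 + c * (g zs + T * |zs| + T) := by
      rcases le_or_gt (-a) 1 with hb1 | hb1
      · have : 0 ≤ c * (g zs + T * |zs| + T) := by
          have := h.nonneg zs
          positivity
        linarith
      · have h4 : a ^ 2 ≤ c * g a := by
          have := h.coercive a
          rwa [div_le_iff₀ hc, mul_comm] at this
        have h5 : g a ≤ g zs + T * (zs - a) := by nlinarith
        have h6 : g a ≤ g zs + T * (-a) + T * |zs| := by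
          nlinarith [le_abs_self zs]
        have h7 : g a ≤ (g zs + T * |zs| + T) * (-a) := by
          have : 0 ≤ g zs + T * |zs| := by have := h.nonneg zs; positivity
          nlinarith
        have h8 : (-a) * (-a) ≤ (c * (g zs + T * |zs| + T)) * (-a) := by nlinarith
        have := le_of_mul_le_mul_right h8 (by linarith)
        linarith
    nlinarith
  have hgap : 0 < phaseGap g zs K 0 σ := by
    obtain ⟨b, hb, hB, _⟩ := h.exists_phaseInf_eq isClosed_Ici (Set.nonempty_Ici (a := zs)) τ
    have hA := h.phaseInf_le (S := Set.Iic zs) isClosed_Iic (τ := τ) (x := zs - 1) (Set.mem_Iic.2 (by linarith))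
    rw [Set.mem_Ici] at hb
    have hgb := h.nonneg b
    rw [phaseGap, ← hτ, hB]
    nlinarith
  have h5 := h.saddleValue_subgradient le_rfl zero_le_one h0.le h1 σ
  have h6 : 0 ≤ K * (saddleMean g zs K θ σ - saddleMean g zs K 0 σ) ^ 2 := by positivity
  nlinarith

end PhaseEnergy

end

/-! ### The lattice energy as nearest-neighbour and M-neighbour sums. -/

/-- The sum of a kernel concentrated at `M` against a new lattice point. -/
theorem sum_kernel_last {m : ℕ → ℝ} {M : ℕ} (hM : 2 ≤ M) (hconc : IsConcentrated m M) (n : ℕ)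
    (q : ℕ → ℝ) : ∑ j ∈ Finset.range (n + 1), m (n + 1 - j) * q j =
      m 1 * q n + if M ≤ n + 1 then m M * q (n + 1 - M) else 0 := by
  have hterm : ∀ j ∈ Finset.range (n + 1), m (n + 1 - j) * q j =
      (if j = n then m 1 * q j else 0) +
        (if j = n + 1 - M then (if M ≤ n + 1 then m M * q j else 0) else 0) := by
    intro j hj
    rw [Finset.mem_range] at hj
    by_cases h1 : j = n
    · subst h1
      have h3 : (if j = j + 1 - M then (if M ≤ j + 1 then m M * q j else 0) else 0) = 0 := by
        split_ifs with h4 h5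
        · omega
        · rfl
        · rfl
      rw [if_pos rfl, h3]
      simp
    · rw [if_neg h1]
      by_cases h2 : j = n + 1 - M
      · rw [if_pos h2]
        by_cases h3 : M ≤ n + 1
        · rw [if_pos h3]
          have : n + 1 - j = M := by omega
          rw [this, zero_add]
        · rw [if_neg h3, hconc _ (by omega) (by omega) (by omega)]
          simp
      · rw [if_neg h2, hconc _ (by omega) (by omega) (by omega)]
        simp
  rw [Finset.sum_congr rfl hterm, Finset.sum_add_distrib]
  congr 1
  · rw [Finset.sum_ite_eq' (Finset.range (n + 1)) n (fun j => m 1 * q j)]; simp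
  · rw [Finset.sum_ite_eq' (Finset.range (n + 1)) (n + 1 - M)
      (fun j => if M ≤ n + 1 then m M * q j else 0), if_pos (by rw [Finset.mem_range]; omega)]

/-- The long-range energy of a concentrated kernel. -/
theorem sum_sum_kernel {m : ℕ → ℝ} {M : ℕ} (hM : 2 ≤ M) (hconc : IsConcentrated m M) (u : ℕ → ℝ)
    (n : ℕ) : ∑ i ∈ Finset.range (n + 1), ∑ j ∈ Finset.range (n + 1),
      m ((i : ℤ) - (j : ℤ)).natAbs * (u i - u j) ^ 2 =
    2 * m 1 * ∑ i ∈ Finset.range n, (u (i + 1) - u i) ^ 2 +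
      2 * m M * ∑ i ∈ Finset.range (n + 1 - M), (u (i + M) - u i) ^ 2 := by
  induction n with
  | zero =>
    have : 0 + 1 - M = 0 := by omega
    simp [this]
  | succ n ih =>
    rw [Finset.sum_range_succ]
    simp_rw [Finset.sum_range_succ _ (n + 1)]
    rw [Finset.sum_add_distrib]
    have e1 : ∀ i ∈ Finset.range (n + 1),
        m ((i : ℤ) - ((n + 1 : ℕ) : ℤ)).natAbs * (u i - u (n + 1)) ^ 2 =
          m (n + 1 - i) * (u (n + 1) - u i) ^ 2 := by
      intro i hi
      rw [Finset.mem_range] at hi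
      have : ((i : ℤ) - ((n + 1 : ℕ) : ℤ)).natAbs = n + 1 - i := by omega
      rw [this]; ring
    have e2 : ∀ i ∈ Finset.range (n + 1),
        m (((n + 1 : ℕ) : ℤ) - (i : ℤ)).natAbs * (u (n + 1) - u i) ^ 2 =
          m (n + 1 - i) * (u (n + 1) - u i) ^ 2 := by
      intro i hi
      rw [Finset.mem_range] at hi
      have : (((n + 1 : ℕ) : ℤ) - (i : ℤ)).natAbs = n + 1 - i := by omega
      rw [this]
    rw [Finset.sum_congr rfl e1, Finset.sum_congr rfl e2, ih,
      sum_kernel_last hM hconc n (fun i => (u (n + 1) - u i) ^ 2), Finset.sum_range_succ _ n]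
    by_cases h : M ≤ n + 1
    · have e3 : n + 1 + 1 - M = (n + 1 - M) + 1 := by omega
      rw [if_pos h, e3, Finset.sum_range_succ _ (n + 1 - M)]
      have e4 : n + 1 - M + M = n + 1 := by omega
      rw [e4]; ring
    · have e3 : n + 1 + 1 - M = n + 1 - M := by omega
      rw [if_neg h, e3]; ring

/-- The lattice energy in terms of the effective nearest-neighbour energy and the `M`-neighbour
interactions. -/
theorem latticeEnergy_eq {f : ℝ → ℝ} {m : ℕ → ℝ} {M : ℕ} (hM : 2 ≤ M) (hconc : IsConcentrated m M)
    (u : ℕ → ℝ) (N : ℕ) : latticeEnergy f m N u =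
      (∑ i ∈ Finset.range N, nnEnergy f m (u (i + 1) - u i)) +
        2 * m M * ∑ i ∈ Finset.range (N + 1 - M), (u (i + M) - u i) ^ 2 := by
  rw [latticeEnergy, sum_sum_kernel hM hconc]
  simp only [nnEnergy, Finset.sum_add_distrib, ← Finset.mul_sum]
  ring

/-! ### Window averages and the lower bound for the lattice energy. -/

theorem sum_range_increments (u : ℕ → ℝ) (i M : ℕ) :
    ∑ r ∈ Finset.range M, (u (i + r + 1) - u (i + r)) = u (i + M) - u i :=
  Finset.sum_range_sub (fun r => u (i + r)) M

/-- Averages over windows of a nonnegative sequence are dominated by the total sum. -/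
theorem sum_windows_le {y : ℕ → ℝ} (hy : ∀ i, 0 ≤ y i) {M N : ℕ} :
    ∑ j ∈ Finset.range (N + 1 - M), ∑ r ∈ Finset.range M, y (j + r) ≤
      M * ∑ i ∈ Finset.range N, y i := by
  rw [Finset.sum_comm]
  have : ∀ r ∈ Finset.range M, ∑ j ∈ Finset.range (N + 1 - M), y (j + r) ≤
      ∑ i ∈ Finset.range N, y i := by
    intro r hr
    rw [Finset.mem_range] at hr
    rw [← Finset.sum_image (s := Finset.range (N + 1 - M)) (g := fun j => j + r) (f := y)
      (fun a _ b _ hab => by simpa using hab)]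
    refine Finset.sum_le_sum_of_subset_of_nonneg ?_ (fun i _ _ => hy i)
    intro i hi
    simp only [Finset.mem_image, Finset.mem_range] at hi ⊢
    omega
  calc _ ≤ ∑ r ∈ Finset.range M, ∑ i ∈ Finset.range N, y i := Finset.sum_le_sum this
    _ = _ := by simp

/-- Window counts of a set of sites: each site is counted `M` times, up to boundary terms. -/
theorem sum_window_counts (χ : ℕ → ℝ) (h0 : ∀ i, 0 ≤ χ i) (h1 : ∀ i, χ i ≤ 1) {M N : ℕ}
    (hMN : M ≤ N) :
    |∑ j ∈ Finset.range (N + 1 - M), ∑ r ∈ Finset.range M, χ (j + r) -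
      M * ∑ i ∈ Finset.range N, χ i| ≤ (M : ℝ) * M := by
  have hle := sum_windows_le h0 (M := M) (N := N)
  -- The opposite inequality is the same bound for the complement.
  have hle' := sum_windows_le (y := fun i => 1 - χ i) (fun i => by linarith [h1 i])
    (M := M) (N := N)
  simp only [Finset.sum_sub_distrib, Finset.sum_const, Finset.card_range, nsmul_eq_mul,
    mul_one] at hle'
  have hc : ((N + 1 - M : ℕ) : ℝ) = N + 1 - M := by
    rw [Nat.cast_sub (by omega)]; push_cast; ring
  rw [hc] at hle'
  have hM0 : (0 : ℝ) ≤ M := Nat.cast_nonneg M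
  rw [abs_le]
  constructor <;> nlinarith

namespace PhaseEnergy

variable {g : ℝ → ℝ} {zs c K : ℝ}

/-- Lower bound for the energy of one window of `M` increments. -/
theorem window_lower_bound (h : PhaseEnergy g zs c K) {M : ℕ} (hM : 0 < M) (d χ : ℕ → ℝ)
    (hχ : ∀ i, (χ i = 1 ∧ zs ≤ d i) ∨ (χ i = 0 ∧ d i ≤ zs)) (σ θ : ℝ)
    (hθ : θ = (∑ r ∈ Finset.range M, χ r) / M) :
    M * saddleValue g zs K θ σ + σ * ∑ r ∈ Finset.range M, d r ≤
      ∑ r ∈ Finset.range M, g (d r) + K / M * (∑ r ∈ Finset.range M, d r) ^ 2 := by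
  have hM' : (0 : ℝ) < M := by exact_mod_cast hM
  have hχ0 : ∀ i, 0 ≤ χ i := fun i => by rcases hχ i with h | h <;> simp [h.1]
  have hχ1 : ∀ i, χ i ≤ 1 := fun i => by rcases hχ i with h | h <;> simp [h.1]
  have hsum : ∑ r ∈ Finset.range M, χ r = M * θ := by rw [hθ]; field_simp
  have h0 : 0 ≤ θ := by
    rw [hθ]; exact div_nonneg (Finset.sum_nonneg fun i _ => hχ0 i) hM'.le
  have h1 : θ ≤ 1 := by
    rw [hθ, div_le_one hM']
    calc _ ≤ ∑ r ∈ Finset.range M, (1 : ℝ) := Finset.sum_le_sum fun i _ => hχ1 i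
      _ = M := by simp
  rw [h.saddleValue_eq h0 h1]
  have hs : saddleSlope g zs K θ σ = σ - 2 * K * saddleMean g zs K θ σ := rfl
  set A := phaseInf g (Set.Iic zs) (saddleSlope g zs K θ σ) with hA
  set B := phaseInf g (Set.Ici zs) (saddleSlope g zs K θ σ) with hB
  set z := saddleMean g zs K θ σ
  set D := ∑ r ∈ Finset.range M, d r with hD
  -- Each increment is bounded by the infimum over its own phase, at the dual slope. Only the number
  -- of right-phase increments enters, not their order.
  have hterm : ∀ r ∈ Finset.range M, A + χ r * (B - A) ≤
      g (d r) - saddleSlope g zs K θ σ * d r := by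
    intro r _
    rcases hχ r with ⟨h3, h4⟩ | ⟨h3, h4⟩
    · rw [h3, one_mul, add_sub_cancel]
      exact h.phaseInf_le isClosed_Ici h4
    · rw [h3, zero_mul, add_zero]
      exact h.phaseInf_le isClosed_Iic h4
  have htot := Finset.sum_le_sum hterm
  rw [Finset.sum_add_distrib, Finset.sum_sub_distrib, ← Finset.sum_mul, ← Finset.mul_sum, hsum,
    ← hD, hs] at htot
  simp only [Finset.sum_const, Finset.card_range, nsmul_eq_mul] at htot
  have hsq : 0 ≤ K / M * (D - M * z) ^ 2 := by have := h.K_pos; positivity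
  have e : K / M * (D - M * z) ^ 2 = K / M * D ^ 2 - 2 * K * D * z + M * (K * z ^ 2) := by
    field_simp
    ring
  rw [e] at hsq
  linarith

/-- Lower bound for the lattice energy from an affine minorant of the saddle values. -/
theorem lattice_lower_bound (h : PhaseEnergy g zs c K) {M : ℕ} (hM : 0 < M) {σ α β : ℝ}
    (hαβ : ∀ j ≤ M, α + β * j ≤ saddleValue g zs K (j / M) σ) :
    ∃ C : ℝ, ∀ N : ℕ, M ≤ N → ∀ u : ℕ → ℝ, ∀ T : Finset ℕ,
      (∀ i < N, zs < u (i + 1) - u i → i ∈ T) → (∀ i ∈ T, i < N ∧ zs ≤ u (i + 1) - u i) →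
      σ * (u N - u 0) + N * α + β * M * T.card - C ≤
        (∑ i ∈ Finset.range N, g (u (i + 1) - u i)) +
          K / M ^ 2 * ∑ i ∈ Finset.range (N + 1 - M), (u (i + M) - u i) ^ 2 := by
  classical
  have hM' : (0 : ℝ) < M := by exact_mod_cast hM
  -- Shifting by C₀ makes the summands nonnegative; boundary sites lie in fewer than M windows, and
  -- the count is then still an inequality in the right direction.
  set C₀ := c * σ ^ 2 / 4 with hC₀
  have hC₀0 : 0 ≤ C₀ := by have := h.c_pos; positivity
  refine ⟨C₀ * M + M * |α| + |β| * (M * M), fun N hN u T hT1 hT2 => ?_⟩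
  set d : ℕ → ℝ := fun i => u (i + 1) - u i with hd
  set χ : ℕ → ℝ := fun i => if i ∈ T then 1 else 0 with hχ
  have hχ0 : ∀ i, 0 ≤ χ i := fun i => by simp only [hχ]; split_ifs <;> norm_num
  have hχ1 : ∀ i, χ i ≤ 1 := fun i => by simp only [hχ]; split_ifs <;> norm_num
  have hTsub : T ⊆ Finset.range N := fun i hi => Finset.mem_range.2 (hT2 i hi).1
  have hχsum : ∑ i ∈ Finset.range N, χ i = T.card := by
    simp only [hχ, Finset.sum_ite_mem, Finset.sum_const, nsmul_eq_mul, mul_one]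
    rw [Finset.inter_eq_right.2 hTsub]
  set x : ℕ → ℝ := fun i => g (d i) - σ * d i with hx
  have hx0 : ∀ i, 0 ≤ x i + C₀ := fun i => by
    have h1 := sq_div_sub_mul_ge h.c_pos σ (d i)
    have h2 := h.coercive (d i)
    simp only [hx]; linarith
  have hwin := sum_windows_le hx0 (M := M) (N := N)
  simp only [Finset.sum_add_distrib, Finset.sum_const, Finset.card_range, nsmul_eq_mul] at hwin
  have hc : ((N + 1 - M : ℕ) : ℝ) = N + 1 - M := by
    rw [Nat.cast_sub (by omega)]; push_cast; ring
  have hwindow : ∀ j ∈ Finset.range (N + 1 - M),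
      M * (α + β * ∑ r ∈ Finset.range M, χ (j + r)) ≤
        ∑ r ∈ Finset.range M, x (j + r) + K / M * (u (j + M) - u j) ^ 2 := by
    intro j hj
    rw [Finset.mem_range] at hj
    -- the number of sites of the window in the right phase
    set n := ((Finset.range M).filter fun r => j + r ∈ T).card with hn
    have hnM : n ≤ M := (Finset.card_filter_le _ _).trans (by simp)
    have hns : ∑ r ∈ Finset.range M, χ (j + r) = n := by
      simp [hχ, hn, Finset.sum_boole]
    -- Beyond the window the increments are replaced by zs with indicator zero, since the phase
    -- alternative is required at every index. Increments equal to zs may count for either phase.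
    have hb := h.window_lower_bound hM
      (fun r => if r < M then d (j + r) else zs)
      (fun r => if r < M then χ (j + r) else 0) (by
        intro i
        by_cases hi : i < M
        · simp only [hi, if_true, hχ]
          by_cases hiT : j + i ∈ T
          · left
            exact ⟨if_pos hiT, (hT2 _ hiT).2⟩
          · right
            refine ⟨if_neg hiT, ?_⟩
            by_contra hlt
            push Not at hlt
            exact hiT (hT1 _ (by omega) hlt)
        · right; simp [hi]) σ (n / M) (by
          congr 1
          rw [← hns]
          exact Finset.sum_congr rfl fun r hr => (if_pos (Finset.mem_range.1 hr)).symm)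
    have e1 : ∑ r ∈ Finset.range M, (if r < M then d (j + r) else zs) = u (j + M) - u j := by
      rw [← sum_range_increments u j M]
      exact Finset.sum_congr rfl fun r hr => if_pos (Finset.mem_range.1 hr)
    have e2 : ∑ r ∈ Finset.range M, g (if r < M then d (j + r) else zs) =
        ∑ r ∈ Finset.range M, g (d (j + r)) :=
      Finset.sum_congr rfl fun r hr => by rw [if_pos (Finset.mem_range.1 hr)]
    have e3 : ∑ r ∈ Finset.range M, x (j + r) =
        ∑ r ∈ Finset.range M, g (d (j + r)) - σ * (u (j + M) - u j) := by
      simp only [hx, Finset.sum_sub_distrib, ← Finset.mul_sum]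
      rw [← sum_range_increments u j M]
    rw [e1, e2] at hb
    have h4 := mul_le_mul_of_nonneg_left (hαβ n hnM) hM'.le
    rw [hns, e3]
    linarith
  have htot := Finset.sum_le_sum hwindow
  rw [← Finset.mul_sum, Finset.sum_add_distrib, Finset.sum_add_distrib, ← Finset.mul_sum,
    ← Finset.mul_sum] at htot
  simp only [Finset.sum_const, Finset.card_range, nsmul_eq_mul] at htot
  have hcount := sum_window_counts χ hχ0 hχ1 hN
  rw [hχsum] at hcount
  have hu : ∑ i ∈ Finset.range N, d i = u N - u 0 := Finset.sum_range_sub u N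
  have hxs : ∑ i ∈ Finset.range N, x i =
      ∑ i ∈ Finset.range N, g (d i) - σ * (u N - u 0) := by
    simp only [hx, Finset.sum_sub_distrib, ← Finset.mul_sum, hu]
  rw [hc] at hwin htot
  change _ ≤ (∑ i ∈ Finset.range N, g (d i)) + _
  rw [hxs] at hwin
  set W := ∑ j ∈ Finset.range (N + 1 - M), ∑ r ∈ Finset.range M, χ (j + r)
  set X := ∑ j ∈ Finset.range (N + 1 - M), ∑ r ∈ Finset.range M, x (j + r)
  set G := ∑ i ∈ Finset.range N, g (d i)
  set Q := ∑ i ∈ Finset.range (N + 1 - M), (u (i + M) - u i) ^ 2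
  have h1 : β * (M * T.card) - |β| * (M * M) ≤ β * W := by
    have h2 : |β * (W - M * T.card)| ≤ |β| * (M * M) := by
      rw [abs_mul]; exact mul_le_mul_of_nonneg_left hcount (abs_nonneg β)
    have h3 := neg_abs_le (β * (W - M * T.card))
    nlinarith
  have h4 : (M : ℝ) * ((N + 1 - M) * α + β * W) ≤
      M * (G - σ * (u N - u 0) + (M - 1) * C₀ + K / M ^ 2 * Q) := by
    have e : (M : ℝ) * (K / M ^ 2 * Q) = K / M * Q := by field_simp
    nlinarith
  have h5 := le_of_mul_le_mul_left h4 hM'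
  have h6 : (M - 1 : ℝ) * α ≤ M * |α| := by
    have h7 : (1 : ℝ) ≤ M := by exact_mod_cast hM
    have h8 := mul_le_mul_of_nonneg_left (le_abs_self α) (by linarith : (0 : ℝ) ≤ M - 1)
    have h9 := abs_nonneg α
    linarith
  linarith

end PhaseEnergy

/-! ### Periodic patterns and their energy. -/

/-- The sum over full periods of a function of the position in the period. -/
theorem sum_range_mul_mod {M : ℕ} (φ : ℕ → ℝ) (p : ℕ) :
    ∑ i ∈ Finset.range (M * p), φ (i % M) = p * ∑ i ∈ Finset.range M, φ i := by
  induction p with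
  | zero => simp
  | succ p ih =>
    rw [Nat.mul_succ, Finset.sum_range_add, ih]
    have : ∑ x ∈ Finset.range M, φ ((M * p + x) % M) = ∑ x ∈ Finset.range M, φ x :=
      Finset.sum_congr rfl fun i hi => by
        rw [Nat.mul_add_mod, Nat.mod_eq_of_lt (Finset.mem_range.1 hi)]
    rw [this]; push_cast; ring

/-- The sum over any window of one period. -/
theorem sum_window_mod {M : ℕ} (φ : ℕ → ℝ) (i : ℕ) :
    ∑ r ∈ Finset.range M, φ ((i + r) % M) = ∑ r ∈ Finset.range M, φ r := by
  induction i with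
  | zero =>
    exact Finset.sum_congr rfl fun r hr => by
      rw [zero_add, Nat.mod_eq_of_lt (Finset.mem_range.1 hr)]
  | succ i ih =>
    rw [← ih]
    have h1 := Finset.sum_range_succ (fun r => φ ((i + r) % M)) M
    rw [Finset.sum_range_succ'] at h1
    simp only [Nat.add_mod_right, add_zero] at h1
    have h2 : ∑ r ∈ Finset.range M, φ ((i + 1 + r) % M) =
        ∑ r ∈ Finset.range M, φ ((i + (r + 1)) % M) :=
      Finset.sum_congr rfl fun r _ => by rw [add_assoc, add_comm 1 r]
    linarith

theorem sum_range_ite_lt {M n : ℕ} (hn : n ≤ M) (x y : ℝ) :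
    ∑ r ∈ Finset.range M, (if r < n then x else y) = n * x + (M - n) * y := by
  obtain ⟨k, rfl⟩ := Nat.exists_eq_add_of_le hn
  rw [Finset.sum_range_add]
  have h1 : ∑ r ∈ Finset.range n, (if r < n then x else y) = n * x := by
    rw [Finset.sum_congr rfl fun r hr => if_pos (Finset.mem_range.1 hr)]; simp
  have h2 : ∑ r ∈ Finset.range k, (if n + r < n then x else y) = k * y := by
    rw [Finset.sum_congr rfl fun r _ => if_neg (by omega)]; simp
  rw [h1, h2]; push_cast; ring

/-- The increments of a lattice function with `p` periods of a pattern with `n` strains `b` and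
`M - n` strains `a`, then `p'` periods of a pattern with `n'` strains `b'` and `M - n'` strains
`a'`, and strain `e` afterwards. -/
def patternStrain (M n n' p p' : ℕ) (a b a' b' e : ℝ) (i : ℕ) : ℝ :=
  if i < M * p then (if i % M < n then b else a)
  else if i < M * (p + p') then (if i % M < n' then b' else a') else e

theorem sum_patternStrain {M n n' : ℕ} (hn : n ≤ M) (hn' : n' ≤ M) (p p' r : ℕ)
    (a b a' b' e : ℝ) (φ : ℝ → ℝ) :
    ∑ i ∈ Finset.range (M * (p + p') + r), φ (patternStrain M n n' p p' a b a' b' e i) =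
      p * (n * φ b + (M - n) * φ a) + p' * (n' * φ b' + (M - n') * φ a') + r * φ e := by
  rw [Finset.sum_range_add, Nat.mul_add, Finset.sum_range_add]
  have h1 : ∑ i ∈ Finset.range (M * p), φ (patternStrain M n n' p p' a b a' b' e i) =
      p * (n * φ b + (M - n) * φ a) := by
    rw [← sum_range_ite_lt hn, ← sum_range_mul_mod]
    refine Finset.sum_congr rfl fun i hi => ?_
    rw [patternStrain, if_pos (Finset.mem_range.1 hi)]
    split_ifs <;> rfl
  have h2 : ∑ i ∈ Finset.range (M * p'),
      φ (patternStrain M n n' p p' a b a' b' e (M * p + i)) =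
      p' * (n' * φ b' + (M - n') * φ a') := by
    rw [← sum_range_ite_lt hn', ← sum_range_mul_mod]
    refine Finset.sum_congr rfl fun i hi => ?_
    rw [Finset.mem_range] at hi
    rw [patternStrain, if_neg (by omega), if_pos (by rw [Nat.mul_add]; omega), Nat.mul_add_mod]
    split_ifs <;> rfl
  have h3 : ∑ i ∈ Finset.range r,
      φ (patternStrain M n n' p p' a b a' b' e (M * p + M * p' + i)) = r * φ e := by
    rw [Finset.sum_congr rfl fun i _ => by
      rw [patternStrain, if_neg (by omega), if_neg (by rw [Nat.mul_add]; omega)]]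
    simp
  rw [h1, h2, h3]

theorem abs_patternStrain_le {M n n' p p' : ℕ} {a b a' b' e B : ℝ} (ha : |a| ≤ B) (hb : |b| ≤ B)
    (ha' : |a'| ≤ B) (hb' : |b'| ≤ B) (he : |e| ≤ B) (i : ℕ) :
    |patternStrain M n n' p p' a b a' b' e i| ≤ B := by
  rw [patternStrain]; split_ifs <;> assumption

/-- Windows of a two-piece pattern: all but a bounded number are full periods. -/
theorem sum_windows_patternStrain {M n n' : ℕ} (hM : 0 < M) (hn : n ≤ M) (hn' : n' ≤ M)
    (p p' r : ℕ) {a b a' b' e B : ℝ} (ha : |a| ≤ B) (hb : |b| ≤ B)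
    (ha' : |a'| ≤ B) (hb' : |b'| ≤ B) (he : |e| ≤ B) :
    ∑ i ∈ Finset.range (M * (p + p') + r + 1 - M),
      (∑ s ∈ Finset.range M, patternStrain M n n' p p' a b a' b' e (i + s)) ^ 2 ≤
    M * p * (n * b + (M - n) * a) ^ 2 + M * p' * (n' * b' + (M - n') * a') ^ 2 +
      (2 * M + r) * (M * B) ^ 2 := by
  have hB : 0 ≤ B := (abs_nonneg a).trans ha
  set W := fun i => (∑ s ∈ Finset.range M, patternStrain M n n' p p' a b a' b' e (i + s)) ^ 2
    with hW
  have hW0 : ∀ i, 0 ≤ W i := fun i => sq_nonneg _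
  have hWB : ∀ i, W i ≤ (M * B) ^ 2 := by
    intro i
    refine sq_le_sq' ?_ ?_ |>.trans_eq rfl
    · refine neg_le_of_abs_le ((Finset.abs_sum_le_sum_abs _ _).trans ?_)
      calc _ ≤ ∑ s ∈ Finset.range M, B :=
            Finset.sum_le_sum fun s _ => abs_patternStrain_le ha hb ha' hb' he _
        _ = M * B := by simp
    · refine le_of_abs_le ((Finset.abs_sum_le_sum_abs _ _).trans ?_)
      calc _ ≤ ∑ s ∈ Finset.range M, B :=
            Finset.sum_le_sum fun s _ => abs_patternStrain_le ha hb ha' hb' he _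
        _ = M * B := by simp
  -- A window inside a periodic piece is a cyclic shift of one period, so its sum does not depend on
  -- its position.
  have hW1 : ∀ i, i + M ≤ M * p → W i = (n * b + (M - n) * a) ^ 2 := by
    intro i hi
    refine congrArg (fun x : ℝ => x ^ 2) ?_
    rw [← sum_range_ite_lt hn, ← sum_window_mod (fun r => if r < n then b else a) i]
    refine Finset.sum_congr rfl fun s hs => ?_
    rw [Finset.mem_range] at hs
    rw [patternStrain, if_pos (by omega)]
  have hW2 : ∀ i, M * p ≤ i → i + M ≤ M * p + M * p' → W i = (n' * b' + (M - n') * a') ^ 2 := by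
    intro i hi hi'
    refine congrArg (fun x : ℝ => x ^ 2) ?_
    rw [← sum_range_ite_lt hn', ← sum_window_mod (fun r => if r < n' then b' else a') i]
    refine Finset.sum_congr rfl fun s hs => ?_
    rw [Finset.mem_range] at hs
    rw [patternStrain, if_neg (by omega), if_pos (by rw [Nat.mul_add]; omega)]
  have hsub : ∑ i ∈ Finset.range (M * (p + p') + r + 1 - M), W i ≤
      ∑ i ∈ Finset.range (M * p + M * p' + r), W i := by
    refine Finset.sum_le_sum_of_subset_of_nonneg ?_ fun i _ _ => hW0 i
    intro i hi
    have hM1 := hM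
    rw [Finset.mem_range, Nat.mul_add] at hi
    rw [Finset.mem_range]
    omega
  -- At most M windows starting in a piece stick out of it; those get the crude bound.
  have piece : ∀ (L : ℕ) (V : ℝ) (w : ℕ → ℝ), 0 ≤ V → (∀ i, i + M ≤ L → w i = V) →
      (∀ i, w i ≤ (M * B) ^ 2) →
      ∑ i ∈ Finset.range L, w i ≤ L * V + M * (M * B) ^ 2 := by
    intro L V w hV h1 h2
    rcases le_total M L with hL | hL
    · obtain ⟨k, rfl⟩ := Nat.exists_eq_add_of_le' hL
      rw [Finset.sum_range_add,
        Finset.sum_congr rfl fun i hi => h1 i (by rw [Finset.mem_range] at hi; omega)]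
      have h3 : ∑ x ∈ Finset.range M, w (k + x) ≤ ∑ x ∈ Finset.range M, ((M : ℝ) * B) ^ 2 :=
        Finset.sum_le_sum fun i _ => h2 _
      have h4 : 0 ≤ (M : ℝ) * V := by positivity
      simp only [Finset.sum_const, Finset.card_range, nsmul_eq_mul] at h3 ⊢
      push_cast
      linarith
    · have h3 : ∑ x ∈ Finset.range L, w x ≤ ∑ x ∈ Finset.range L, ((M : ℝ) * B) ^ 2 :=
        Finset.sum_le_sum fun i _ => h2 _
      simp only [Finset.sum_const, Finset.card_range, nsmul_eq_mul] at h3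
      have h4 : (L : ℝ) * (M * B) ^ 2 ≤ M * (M * B) ^ 2 :=
        mul_le_mul_of_nonneg_right (by exact_mod_cast hL) (sq_nonneg _)
      have h5 : 0 ≤ (L : ℝ) * V := by positivity
      linarith
  refine hsub.trans ?_
  rw [Finset.sum_range_add, Finset.sum_range_add]
  have p1 := piece (M * p) _ W (sq_nonneg _) hW1 hWB
  have p2 := piece (M * p') _ (fun i => W (M * p + i)) (sq_nonneg (n' * b' + (M - n') * a'))
    (fun i hi => hW2 _ (by omega) (by omega)) (fun i => hWB _)
  have p3 : ∑ i ∈ Finset.range r, W (M * p + M * p' + i) ≤ r * (M * B) ^ 2 := by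
    calc _ ≤ ∑ i ∈ Finset.range r, ((M : ℝ) * B) ^ 2 := Finset.sum_le_sum fun i _ => hWB _
      _ = _ := by simp
  push_cast at p1 p2
  linarith

/-- The lattice function with pattern increments. -/
def patternFun (M n n' p p' : ℕ) (a b a' b' e : ℝ) (k : ℕ) : ℝ :=
  ∑ i ∈ Finset.range k, patternStrain M n n' p p' a b a' b' e i

theorem patternFun_succ_sub (M n n' p p' : ℕ) (a b a' b' e : ℝ) (k : ℕ) :
    patternFun M n n' p p' a b a' b' e (k + 1) - patternFun M n n' p p' a b a' b' e k =
      patternStrain M n n' p p' a b a' b' e k := by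
  rw [patternFun, patternFun, Finset.sum_range_succ]; ring

theorem patternFun_window (M n n' p p' : ℕ) (a b a' b' e : ℝ) (i : ℕ) :
    patternFun M n n' p p' a b a' b' e (i + M) - patternFun M n n' p p' a b a' b' e i =
      ∑ s ∈ Finset.range M, patternStrain M n n' p p' a b a' b' e (i + s) := by
  rw [patternFun, patternFun, Finset.sum_range_add]; ring

/-- Energy of a two-piece pattern. -/
theorem latticeEnergy_pattern_le {f : ℝ → ℝ} {m : ℕ → ℝ} {M n n' : ℕ} (hM : 2 ≤ M)
    (hmM : 0 ≤ m M) (hconc : IsConcentrated m M) (hn : n ≤ M) (hn' : n' ≤ M)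
    (p p' r : ℕ) {a b a' b' e B : ℝ} (ha : |a| ≤ B) (hb : |b| ≤ B)
    (ha' : |a'| ≤ B) (hb' : |b'| ≤ B) (he : |e| ≤ B) :
    latticeEnergy f m (M * (p + p') + r) (patternFun M n n' p p' a b a' b' e) ≤
      M * p * mixEnergy (nnEnergy f m) (2 * m M * M ^ 2) (n / M) a b +
      M * p' * mixEnergy (nnEnergy f m) (2 * m M * M ^ 2) (n' / M) a' b' +
      (r * nnEnergy f m e + 2 * m M * ((2 * M + r) * (M * B) ^ 2)) := by
  have hM' : (M : ℝ) ≠ 0 := by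
    have : M ≠ 0 := by omega
    exact_mod_cast this
  rw [latticeEnergy_eq hM hconc]
  simp only [patternFun_succ_sub, patternFun_window]
  rw [sum_patternStrain hn hn']
  have h := mul_le_mul_of_nonneg_left (sum_windows_patternStrain (by omega) hn hn' p p' r ha hb ha' hb' he)
    (by positivity : 0 ≤ 2 * m M)
  have e1 : ∀ (k : ℕ) (x y : ℝ), (M : ℝ) * mixEnergy (nnEnergy f m) (2 * m M * M ^ 2) (k / M) x y =
      (k * nnEnergy f m y + (M - k) * nnEnergy f m x) +
        2 * m M * (M * (k * y + (M - k) * x) ^ 2) := by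
    intro k x y
    rw [mixEnergy]
    field_simp
    ring
  have e2 : (M : ℝ) * p * mixEnergy (nnEnergy f m) (2 * m M * M ^ 2) (n / M) a b =
    p * (M * mixEnergy (nnEnergy f m) (2 * m M * M ^ 2) (n / M) a b) := by ring
  have e3 : (M : ℝ) * p' * mixEnergy (nnEnergy f m) (2 * m M * M ^ 2) (n' / M) a' b' =
    p' * (M * mixEnergy (nnEnergy f m) (2 * m M * M ^ 2) (n' / M) a' b') := by ring
  rw [e2, e3, e1, e1]
  linarith

/-! ### The relaxed energy: supremum of affine functions and minimum over mixtures. -/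

noncomputable section

/-- The saddle value at the phase fraction `n / M`. -/
def lockValue (g : ℝ → ℝ) (zs K : ℝ) (M n : ℕ) (σ : ℝ) : ℝ := saddleValue g zs K (n / M) σ

/-- The mean strain of the saddle point at the phase fraction `n / M`. -/
def lockMean (g : ℝ → ℝ) (zs K : ℝ) (M n : ℕ) (σ : ℝ) : ℝ := saddleMean g zs K (n / M) σ

/-- The line through the saddle values at `k / M` and `(k + 1) / M`. -/
def lockLine (g : ℝ → ℝ) (zs K : ℝ) (M k : ℕ) (θ σ : ℝ) : ℝ :=
  lockValue g zs K M k σ + (M * θ - k) * (lockValue g zs K M (k + 1) σ - lockValue g zs K M k σ)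

/-- The phase-constrained relaxed energy, as a supremum of affine functions. -/
def relaxedEnergy (g : ℝ → ℝ) (zs K : ℝ) (M : ℕ) (θ z : ℝ) : EReal :=
  ⨆ σ : ℝ, ⨆ k : Fin M, ((σ * z + lockLine g zs K M k θ σ : ℝ) : EReal)

/-- The energies of mixtures with weights `1 - θ`, `θ` and mean `z`. -/
def mixValues (g : ℝ → ℝ) (zs K θ z : ℝ) : Set EReal :=
  {v | ∃ a b : ℝ, a ≤ zs ∧ zs ≤ b ∧ (1 - θ) * a + θ * b = z ∧ v = (mixEnergy g K θ a b : ℝ)}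

/-- The least energy of mixtures with weights `1 - θ`, `θ` and mean `z`. -/
def mixMin (g : ℝ → ℝ) (zs K θ z : ℝ) : EReal := sInf (mixValues g zs K θ z)

/-- Energies of mixtures of the states `n / M` and `(n + 1) / M` with weights `1 - t`, `t`. -/
def interpValues (g : ℝ → ℝ) (zs K : ℝ) (M n : ℕ) (t z : ℝ) : Set EReal :=
  {v | ∃ w w' : ℝ, (1 - t) * w + t * w' = z ∧
    v = ((1 - t : ℝ) : EReal) * mixMin g zs K (n / M) w +
      ((t : ℝ) : EReal) * mixMin g zs K ((n + 1 : ℕ) / M) w'}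

theorem natCast_div_mem_unit {n M : ℕ} (hM : 0 < M) (hn : n ≤ M) :
    0 ≤ (n : ℝ) / M ∧ (n : ℝ) / M ≤ 1 := by
  have : (0 : ℝ) < M := by exact_mod_cast hM
  refine ⟨by positivity, ?_⟩
  rw [div_le_one this]; exact_mod_cast hn

theorem lowerSemicontinuous_relaxedEnergy (g : ℝ → ℝ) (zs K : ℝ) (M : ℕ) (z : ℝ) :
    LowerSemicontinuous fun θ => relaxedEnergy g zs K M θ z := by
  refine lowerSemicontinuous_iSup fun σ => lowerSemicontinuous_iSup fun k => ?_
  refine Continuous.lowerSemicontinuous (continuous_coe_real_ereal.comp ?_)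
  simp only [lockLine]
  fun_prop

theorem le_relaxedEnergy {g : ℝ → ℝ} {zs K : ℝ} {M k : ℕ} (hk : k < M) (θ z σ : ℝ) :
    ((σ * z + lockLine g zs K M k θ σ : ℝ) : EReal) ≤ relaxedEnergy g zs K M θ z :=
  le_iSup_of_le σ (le_iSup_of_le (⟨k, hk⟩ : Fin M) le_rfl)

namespace PhaseEnergy

variable {g : ℝ → ℝ} {zs c K : ℝ}

theorem isLeast_mixValues_saddleMean (h : PhaseEnergy g zs c K) {θ : ℝ} (h0 : 0 ≤ θ) (h1 : θ ≤ 1)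
    (σ : ℝ) : IsLeast (mixValues g zs K θ (saddleMean g zs K θ σ))
      ((σ * saddleMean g zs K θ σ + saddleValue g zs K θ σ : ℝ) : EReal) := by
  constructor
  · exact ⟨_, _, (h.isSaddle h0 h1 σ).left_le, (h.isSaddle h0 h1 σ).le_right, rfl, by
      rw [mixEnergy_eq]⟩
  · rintro v ⟨a, b, ha, hb, hab, rfl⟩
    have := h.le_mixEnergy h0 h1 σ ha hb
    rw [hab, sub_self] at this
    exact EReal.coe_le_coe_iff.2 (by linarith)

theorem mixMin_saddleMean (h : PhaseEnergy g zs c K) {θ : ℝ} (h0 : 0 ≤ θ) (h1 : θ ≤ 1)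
    (σ : ℝ) : mixMin g zs K θ (saddleMean g zs K θ σ) =
      ((σ * saddleMean g zs K θ σ + saddleValue g zs K θ σ : ℝ) : EReal) :=
  (h.isLeast_mixValues_saddleMean h0 h1 σ).csInf_eq

/-- The quadratic term is kept because it forces contact with a supporting line to occur only at the
saddle mean. -/
theorem le_mixMin_add_sq (h : PhaseEnergy g zs c K) {θ : ℝ} (h0 : 0 ≤ θ) (h1 : θ ≤ 1)
    (σ z : ℝ) : ((σ * z + saddleValue g zs K θ σ + K * (z - saddleMean g zs K θ σ) ^ 2 : ℝ) : EReal)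
      ≤ mixMin g zs K θ z := by
  refine le_sInf ?_
  rintro v ⟨a, b, ha, hb, hab, rfl⟩
  have := h.le_mixEnergy h0 h1 σ ha hb
  rw [hab] at this
  exact EReal.coe_le_coe_iff.2 this

theorem le_mixMin (h : PhaseEnergy g zs c K) {θ : ℝ} (h0 : 0 ≤ θ) (h1 : θ ≤ 1)
    (σ z : ℝ) : ((σ * z + saddleValue g zs K θ σ : ℝ) : EReal) ≤ mixMin g zs K θ z := by
  refine le_trans (EReal.coe_le_coe_iff.2 ?_) (h.le_mixMin_add_sq h0 h1 σ z)
  have := h.K_pos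
  have : 0 ≤ K * (z - saddleMean g zs K θ σ) ^ 2 := by positivity
  linarith

/-- Lines through neighbouring saddle values lie below all saddle values. -/
theorem lockLine_le_lockValue (h : PhaseEnergy g zs c K) {M k j : ℕ} (hk : k < M) (hj : j ≤ M)
    (σ : ℝ) : lockValue g zs K M k σ + ((j : ℝ) - k) * (lockValue g zs K M (k + 1) σ
      - lockValue g zs K M k σ) ≤ lockValue g zs K M j σ := by
  have hM : 0 < M := by omega
  have hM' : (0 : ℝ) < M := by exact_mod_cast hM
  obtain ⟨a0, a1⟩ := natCast_div_mem_unit hM hk.le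
  obtain ⟨b0, b1⟩ := natCast_div_mem_unit (n := k + 1) hM hk
  obtain ⟨c0, c1⟩ := natCast_div_mem_unit hM hj
  have hq : ∀ x y : ℝ, 0 ≤ K * (x - y) ^ 2 := fun x y => by have := h.K_pos; positivity
  have hd : ((k + 1 : ℕ) : ℝ) / M - k / M = 1 / M := by push_cast; ring
  have hd' : (k : ℝ) / M - ((k + 1 : ℕ) : ℝ) / M = -(1 / M) := by push_cast; ring
  simp only [lockValue]
  -- Convexity in the fraction: the subgradient is taken at the endpoint of the segment on the side
  -- of j.
  rcases le_or_gt j k with hjk | hjk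
  · have s1 := h.saddleValue_subgradient a0 a1 b0 b1 σ
    have s2 := h.saddleValue_subgradient a0 a1 c0 c1 σ
    have q1 := hq (saddleMean g zs K (((k + 1 : ℕ) : ℝ) / M) σ) (saddleMean g zs K ((k : ℝ) / M) σ)
    have q2 := hq (saddleMean g zs K ((j : ℝ) / M) σ) (saddleMean g zs K ((k : ℝ) / M) σ)
    have e : (j : ℝ) / M - k / M = (j - k) * (1 / M) := by ring
    rw [hd] at s1
    rw [e] at s2
    have hle : (j : ℝ) - k ≤ 0 := by
      have : (j : ℝ) ≤ k := by exact_mod_cast hjk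
      linarith
    nlinarith
  · have s1 := h.saddleValue_subgradient b0 b1 a0 a1 σ
    have s2 := h.saddleValue_subgradient b0 b1 c0 c1 σ
    have q1 := hq (saddleMean g zs K ((k : ℝ) / M) σ) (saddleMean g zs K (((k + 1 : ℕ) : ℝ) / M) σ)
    have q2 := hq (saddleMean g zs K ((j : ℝ) / M) σ) (saddleMean g zs K (((k + 1 : ℕ) : ℝ) / M) σ)
    have e : (j : ℝ) / M - ((k + 1 : ℕ) : ℝ) / M = (j - k - 1) * (1 / M) := by push_cast; ring
    rw [hd'] at s1
    rw [e] at s2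
    have hle : 0 ≤ (j : ℝ) - k - 1 := by
      have : ((k + 1 : ℕ) : ℝ) ≤ j := by exact_mod_cast hjk
      push_cast at this
      linarith
    nlinarith

/-- Every admissible mean strain of a mixture of neighbouring states is attained by saddle
points with a common slope. -/
theorem exists_slope (h : PhaseEnergy g zs c K) {M n : ℕ} (hn : n < M) {t z : ℝ}
    (ht0 : 0 ≤ t) (ht1 : t ≤ 1) (hz1 : 0 < n + t ∨ z < zs) (hz2 : n + t < M ∨ zs < z) :
    ∃ σ, (1 - t) * lockMean g zs K M n σ + t * lockMean g zs K M (n + 1) σ = z := by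
  have hM : 0 < M := by omega
  have hM' : (0 : ℝ) < M := by exact_mod_cast hM
  obtain ⟨a0, a1⟩ := natCast_div_mem_unit hM hn.le
  obtain ⟨b0, b1⟩ := natCast_div_mem_unit (n := n + 1) hM hn
  set Z := fun σ => (1 - t) * lockMean g zs K M n σ + t * lockMean g zs K M (n + 1) σ with hZ
  have hcont : Continuous Z := by
    have e1 : Continuous (lockMean g zs K M n) := h.continuous_saddleMean a0 a1
    have e2 : Continuous (lockMean g zs K M (n + 1)) := h.continuous_saddleMean b0 b1
    fun_prop
  set θ := ((n : ℝ) + t) / M with hθ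
  -- For σ → ±∞ the mean Z passes, up to an error of order 1/|σ|, every mean of an admissible
  -- mixture. It therefore reaches both sides of z, and continuity gives the value z.
  have key : ∀ a b : ℝ, a ≤ zs → zs ≤ b → ∃ V, ∀ σ, σ * ((1 - θ) * a + θ * b - Z σ) ≤ V := by
    intro a b ha hb
    refine ⟨(1 - t) * mixEnergy g K (n / M) a b + t * mixEnergy g K ((n + 1 : ℕ) / M) a b,
      fun σ => ?_⟩
    have l1 := h.le_mixEnergy a0 a1 σ ha hb
    have l2 := h.le_mixEnergy b0 b1 σ ha hb
    have v1 := mixEnergy_eq (g := g) (zs := zs) (K := K) ((n : ℝ) / M) σ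
    have v2 := mixEnergy_eq (g := g) (zs := zs) (K := K) (((n + 1 : ℕ) : ℝ) / M) σ
    have pos : ∀ θ' a b : ℝ, 0 ≤ θ' → θ' ≤ 1 → 0 ≤ mixEnergy g K θ' a b := by
      intro θ' a b h0 h1
      have p1 := mul_nonneg (sub_nonneg.2 h1) (h.nonneg a)
      have p2 := mul_nonneg h0 (h.nonneg b)
      have p3 : 0 ≤ K * ((1 - θ') * a + θ' * b) ^ 2 := by have := h.K_pos; positivity
      rw [mixEnergy]; linarith
    have w1 := pos _ (saddlePair g zs K ((n : ℝ) / M) σ).1 (saddlePair g zs K ((n : ℝ) / M) σ).2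
      a0 a1
    have w2 := pos _ (saddlePair g zs K (((n + 1 : ℕ) : ℝ) / M) σ).1
      (saddlePair g zs K (((n + 1 : ℕ) : ℝ) / M) σ).2 b0 b1
    rw [v1] at w1
    rw [v2] at w2
    have q1 : 0 ≤ K * ((1 - (n : ℝ) / M) * a + n / M * b - saddleMean g zs K (n / M) σ) ^ 2 := by
      have := h.K_pos; positivity
    have q2 : 0 ≤ K * ((1 - ((n + 1 : ℕ) : ℝ) / M) * a + ((n + 1 : ℕ) : ℝ) / M * b -
        saddleMean g zs K (((n + 1 : ℕ) : ℝ) / M) σ) ^ 2 := by have := h.K_pos; positivity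
    have r1 : σ * ((1 - (n : ℝ) / M) * a + n / M * b) - σ * saddleMean g zs K (n / M) σ ≤
      mixEnergy g K (n / M) a b := by linarith
    have r2 : σ * ((1 - ((n + 1 : ℕ) : ℝ) / M) * a + ((n + 1 : ℕ) : ℝ) / M * b) -
        σ * saddleMean g zs K (((n + 1 : ℕ) : ℝ) / M) σ ≤
      mixEnergy g K ((n + 1 : ℕ) / M) a b := by linarith
    have t1 := mul_le_mul_of_nonneg_left r1 (sub_nonneg.2 ht1)
    have t2 := mul_le_mul_of_nonneg_left r2 ht0
    have e : σ * ((1 - θ) * a + θ * b - Z σ) =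
        (1 - t) * (σ * ((1 - (n : ℝ) / M) * a + n / M * b) - σ * saddleMean g zs K (n / M) σ) +
        t * (σ * ((1 - ((n + 1 : ℕ) : ℝ) / M) * a + ((n + 1 : ℕ) : ℝ) / M * b) -
        σ * saddleMean g zs K (((n + 1 : ℕ) : ℝ) / M) σ) := by
      simp only [hZ, hθ, lockMean]; push_cast; field_simp; ring
    rw [e]; linarith
  have hup : ∃ σ, z ≤ Z σ := by
    obtain ⟨a, b, ha, hb, hab⟩ : ∃ a b : ℝ, a ≤ zs ∧ zs ≤ b ∧ z < (1 - θ) * a + θ * b := by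
      rcases hz1 with hz1 | hz1
      · have hθ0 : 0 < θ := div_pos hz1 hM'
        refine ⟨zs, zs + (|z - zs| + 1) / θ, le_rfl, ?_, ?_⟩
        · have : 0 ≤ (|z - zs| + 1) / θ := by positivity
          linarith
        · have e : (1 - θ) * zs + θ * (zs + (|z - zs| + 1) / θ) = zs + |z - zs| + 1 := by
            field_simp; ring
          rw [e]; linarith [le_abs_self (z - zs)]
      · exact ⟨zs, zs, le_rfl, le_rfl, by linarith⟩
    obtain ⟨V, hV⟩ := key a b ha hb
    by_contra hne
    push Not at hne
    set δ := (1 - θ) * a + θ * b - z with hδ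
    have hδ0 : 0 < δ := by rw [hδ]; linarith
    have h1 := hV ((|V| + 1) / δ)
    have h2 := hne ((|V| + 1) / δ)
    have h3 : (|V| + 1) / δ * δ = |V| + 1 := by field_simp
    have h4 : 0 < (|V| + 1) / δ := by positivity
    have h5 : (|V| + 1) / δ * δ ≤ (|V| + 1) / δ * ((1 - θ) * a + θ * b - Z ((|V| + 1) / δ)) :=
      mul_le_mul_of_nonneg_left (by linarith) h4.le
    linarith [le_abs_self V]
  have hdown : ∃ σ, Z σ ≤ z := by
    obtain ⟨a, b, ha, hb, hab⟩ : ∃ a b : ℝ, a ≤ zs ∧ zs ≤ b ∧ (1 - θ) * a + θ * b < z := by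
      rcases hz2 with hz2 | hz2
      · have hθ0 : 0 < 1 - θ := by
          rw [hθ, sub_pos, div_lt_one hM']; exact hz2
        refine ⟨zs - (|z - zs| + 1) / (1 - θ), zs, ?_, le_rfl, ?_⟩
        · have : 0 ≤ (|z - zs| + 1) / (1 - θ) := by positivity
          linarith
        · have e : (1 - θ) * (zs - (|z - zs| + 1) / (1 - θ)) + θ * zs = zs - |z - zs| - 1 := by
            field_simp; ring
          rw [e]; linarith [neg_abs_le (z - zs)]
      · exact ⟨zs, zs, le_rfl, le_rfl, by linarith⟩
    obtain ⟨V, hV⟩ := key a b ha hb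
    by_contra hne
    push Not at hne
    set δ := z - ((1 - θ) * a + θ * b) with hδ
    have hδ0 : 0 < δ := by rw [hδ]; linarith
    have h1 := hV (-((|V| + 1) / δ))
    have h2 := hne (-((|V| + 1) / δ))
    have h3 : (|V| + 1) / δ * δ = |V| + 1 := by field_simp
    have h4 : 0 < (|V| + 1) / δ := by positivity
    have h5 : (|V| + 1) / δ * δ ≤ (|V| + 1) / δ * (Z (-((|V| + 1) / δ)) - ((1 - θ) * a + θ * b)) :=
      mul_le_mul_of_nonneg_left (by linarith) h4.le
    linarith [le_abs_self V]
  obtain ⟨σ, hσ⟩ := mem_range_of_exists_le_of_exists_ge hcont hdown hup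
  exact ⟨σ, hσ⟩

/-- The minimum over mixtures is attained whenever there are mixtures. -/
theorem isLeast_mixValues (h : PhaseEnergy g zs c K) {M n : ℕ} (hM : 2 ≤ M) (hn : n ≤ M) {z : ℝ}
    (hne : (mixValues g zs K (n / M) z).Nonempty) :
    IsLeast (mixValues g zs K (n / M) z) (mixMin g zs K (n / M) z) := by
  have hM' : (M : ℝ) ≠ 0 := by have : M ≠ 0 := by omega
                               exact_mod_cast this
  suffices hs : ∃ v, IsLeast (mixValues g zs K (n / M) z) v by
    obtain ⟨v, hv⟩ := hs
    rwa [mixMin, hv.csInf_eq]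
  have single : ∀ v, (mixValues g zs K (n / M) z) ⊆ {v} →
      ∃ v, IsLeast (mixValues g zs K (n / M) z) v := by
    intro v hv
    obtain ⟨w, hw⟩ := hne
    exact ⟨w, hw, fun x hx => by rw [hv hx, hv hw]⟩
  -- In a pure phase the mean fixes the only strain with weight, so there is a single value; a slope
  -- may fail to exist at the corner zs.
  rcases Nat.eq_zero_or_pos n with rfl | hn0
  · refine single ((g z + K * z ^ 2 : ℝ) : EReal) ?_
    rintro v ⟨a, b, ha, hb, hab, rfl⟩
    have : a = z := by simpa using hab
    subst this
    simp [mixEnergy]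
  rcases hn.eq_or_lt with rfl | hnM
  · refine single ((g z + K * z ^ 2 : ℝ) : EReal) ?_
    rintro v ⟨a, b, ha, hb, hab, rfl⟩
    rw [div_self hM'] at hab ⊢
    have : b = z := by simpa using hab
    subst this
    simp [mixEnergy]
  · obtain ⟨σ, hσ⟩ := h.exists_slope hnM (t := 0) (z := z) le_rfl zero_le_one
      (Or.inl (by simpa using hn0)) (Or.inl (by simpa using hnM))
    obtain ⟨a0, a1⟩ := natCast_div_mem_unit (by omega : 0 < M) hn
    have hz : saddleMean g zs K (n / M) σ = z := by simpa [lockMean] using hσ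
    rw [← hz]
    exact ⟨_, h.isLeast_mixValues_saddleMean a0 a1 σ⟩

/-- The left energy is the supremum of its affine minorants, also at the endpoint. -/
theorem mixMin_zero_le (h : PhaseEnergy g zs c K) {M : ℕ} (hM : 0 < M) {z : ℝ} (hz : zs ≤ z) :
    mixMin g zs K 0 z ≤ relaxedEnergy g zs K M 0 z := by
  have hK := h.K_pos
  -- The dual bound with y = z is exact for the square at z, so only the affine minorants of g on
  -- the left phase remain.
  have hlow : ∀ τ : ℝ, ((τ * z + phaseInf g (Set.Iic zs) τ + K * z ^ 2 : ℝ) : EReal) ≤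
      relaxedEnergy g zs K M 0 z := by
    intro τ
    refine le_trans (EReal.coe_le_coe_iff.2 ?_) (le_relaxedEnergy hM 0 z (τ + 2 * K * z))
    have h1 := h.dual_le_saddleValue le_rfl zero_le_one (τ + 2 * K * z) τ z (by ring)
    have h2 : 0 ≤ K * (saddleMean g zs K 0 (τ + 2 * K * z) - z) ^ 2 := by positivity
    simp only [lockLine, lockValue, Nat.cast_zero, zero_div, mul_zero, sub_self, zero_mul, add_zero]
    linarith
  rcases hz.eq_or_lt with rfl | hz
  · have hle : mixMin g zs K 0 zs ≤ ((g zs + K * zs ^ 2 : ℝ) : EReal) :=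
      sInf_le ⟨zs, zs, le_rfl, le_rfl, by ring, by simp [mixEnergy]⟩
    refine hle.trans (EReal.ge_of_forall_gt_iff_ge.1 fun r hr => ?_)
    have hr' : r - K * zs ^ 2 < g zs := by
      have := EReal.coe_lt_coe_iff.1 hr
      linarith
    obtain ⟨ε, hε, hball⟩ := Metric.eventually_nhds_iff.1 (h.lsc zs _ hr')
    -- This slope is steep enough to force the minimizer within ε of zs, where lower semicontinuity
    -- keeps g above the prescribed level.
    set τ := (g zs + 1) / ε with hτ
    have hg := h.nonneg zs
    have hτ0 : 0 < τ := by positivity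
    obtain ⟨a, ha, hA, hm⟩ := h.exists_phaseInf_eq isClosed_Iic (Set.nonempty_Iic (a := zs)) τ
    rw [Set.mem_Iic] at ha
    have h1 := hm zs (Set.mem_Iic.2 le_rfl)
    have hga := h.nonneg a
    have h2 : τ * (zs - a) < τ * ε := by
      have : τ * ε = g zs + 1 := by rw [hτ]; field_simp
      linarith
    have h3 := lt_of_mul_lt_mul_left h2 hτ0.le
    have h4 := hball (y := a) (by rw [Real.dist_eq, abs_sub_lt_iff]; constructor <;> linarith)
    refine le_trans (EReal.coe_le_coe_iff.2 ?_) (hlow τ)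
    rw [hA]
    nlinarith
  -- To the right of zs there is no left-phase mixture, and the bounds diverge as τ → ∞.
  · have : relaxedEnergy g zs K M 0 z = ⊤ := by
      rw [EReal.eq_top_iff_forall_lt]
      intro y
      refine lt_of_lt_of_le (EReal.coe_lt_coe_iff.2 ?_) (hlow ((|y| + 1) / (z - zs)))
      have hd : 0 < z - zs := by linarith
      set τ := (|y| + 1) / (z - zs) with hτ
      have hτ0 : 0 < τ := by positivity
      obtain ⟨a, ha, hA, _⟩ := h.exists_phaseInf_eq isClosed_Iic (Set.nonempty_Iic (a := zs)) τ
      rw [Set.mem_Iic] at ha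
      have e : τ * (z - zs) = |y| + 1 := by rw [hτ]; field_simp
      have hga := h.nonneg a
      have hKz : 0 ≤ K * z ^ 2 := by positivity
      have := le_abs_self y
      rw [hA]
      nlinarith
    rw [this]; exact le_top

/-- The right energy is the supremum of its affine minorants, also at the endpoint. -/
theorem mixMin_one_le (h : PhaseEnergy g zs c K) {M : ℕ} (hM : 0 < M) {z : ℝ} (hz : z ≤ zs) :
    mixMin g zs K 1 z ≤ relaxedEnergy g zs K M 1 z := by
  have hK := h.K_pos
  have hlow : ∀ τ : ℝ, ((τ * z + phaseInf g (Set.Ici zs) τ + K * z ^ 2 : ℝ) : EReal) ≤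
      relaxedEnergy g zs K M 1 z := by
    intro τ
    refine le_trans (EReal.coe_le_coe_iff.2 ?_)
      (le_relaxedEnergy (k := M - 1) (by omega) 1 z (τ + 2 * K * z))
    have h1 := h.dual_le_saddleValue zero_le_one le_rfl (τ + 2 * K * z) τ z (by ring)
    have h2 : 0 ≤ K * (saddleMean g zs K 1 (τ + 2 * K * z) - z) ^ 2 := by positivity
    have e1 : M - 1 + 1 = M := by omega
    have e2 : (M : ℝ) * 1 - ((M - 1 : ℕ) : ℝ) = 1 := by
      rw [Nat.cast_sub (by omega)]; push_cast; ring
    have e3 : (M : ℝ) / M = 1 := div_self (by exact_mod_cast hM.ne')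
    simp only [lockLine, lockValue, e1, e2, e3]
    linarith
  rcases hz.eq_or_lt with rfl | hz
  · have hle : mixMin g z K 1 z ≤ ((g z + K * z ^ 2 : ℝ) : EReal) :=
      sInf_le ⟨z, z, le_rfl, le_rfl, by ring, by simp [mixEnergy]⟩
    refine hle.trans (EReal.ge_of_forall_gt_iff_ge.1 fun r hr => ?_)
    have hr' : r - K * z ^ 2 < g z := by
      have := EReal.coe_lt_coe_iff.1 hr
      linarith
    obtain ⟨ε, hε, hball⟩ := Metric.eventually_nhds_iff.1 (h.lsc z _ hr')
    set τ := -((g z + 1) / ε) with hτ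
    have hg := h.nonneg z
    have hτ0 : 0 < -τ := by rw [hτ, neg_neg]; positivity
    obtain ⟨b, hb, hB, hm⟩ := h.exists_phaseInf_eq isClosed_Ici (Set.nonempty_Ici (a := z)) τ
    rw [Set.mem_Ici] at hb
    have h1 := hm z (Set.mem_Ici.2 le_rfl)
    have hgb := h.nonneg b
    have h2 : (-τ) * (b - z) < (-τ) * ε := by
      have : (-τ) * ε = g z + 1 := by rw [hτ]; field_simp
      linarith
    have h3 := lt_of_mul_lt_mul_left h2 hτ0.le
    have h4 := hball (y := b) (by rw [Real.dist_eq, abs_sub_lt_iff]; constructor <;> linarith)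
    refine le_trans (EReal.coe_le_coe_iff.2 ?_) (hlow τ)
    rw [hB]
    nlinarith
  · have : relaxedEnergy g zs K M 1 z = ⊤ := by
      rw [EReal.eq_top_iff_forall_lt]
      intro y
      refine lt_of_lt_of_le (EReal.coe_lt_coe_iff.2 ?_) (hlow (-((|y| + 1) / (zs - z))))
      have hd : 0 < zs - z := by linarith
      set τ := (|y| + 1) / (zs - z) with hτ
      have hτ0 : 0 < τ := by positivity
      obtain ⟨b, hb, hB, _⟩ := h.exists_phaseInf_eq isClosed_Ici (Set.nonempty_Ici (a := zs)) (-τ)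
      rw [Set.mem_Ici] at hb
      have e : τ * (zs - z) = |y| + 1 := by rw [hτ]; field_simp
      have hgb := h.nonneg b
      have hKz : 0 ≤ K * z ^ 2 := by positivity
      have := le_abs_self y
      rw [hB]
      nlinarith
    rw [this]; exact le_top

/-- Each affine function in the supremum lies below both mixture energies at its own σ, and is
affine in the fraction, so it survives the convex combination. -/
theorem relaxedEnergy_le_interp (h : PhaseEnergy g zs c K) {M n : ℕ} (hn : n < M) {t w w' : ℝ}
    (ht0 : 0 ≤ t) (ht1 : t ≤ 1) :
    relaxedEnergy g zs K M ((n + t) / M) ((1 - t) * w + t * w') ≤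
      ((1 - t : ℝ) : EReal) * mixMin g zs K (n / M) w +
      ((t : ℝ) : EReal) * mixMin g zs K ((n + 1 : ℕ) / M) w' := by
  have hM : 0 < M := by omega
  have hM' : (M : ℝ) ≠ 0 := by exact_mod_cast hM.ne'
  obtain ⟨a0, a1⟩ := natCast_div_mem_unit hM hn.le
  obtain ⟨b0, b1⟩ := natCast_div_mem_unit (n := n + 1) hM hn
  refine iSup_le fun σ => iSup_le fun k => ?_
  have l1 := mul_le_mul_of_nonneg_left (h.le_mixMin a0 a1 σ w)
    (EReal.coe_nonneg.2 (sub_nonneg.2 ht1))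
  have l2 := mul_le_mul_of_nonneg_left (h.le_mixMin b0 b1 σ w') (EReal.coe_nonneg.2 ht0)
  refine le_trans ?_ (add_le_add l1 l2)
  rw [← EReal.coe_mul, ← EReal.coe_mul, ← EReal.coe_add, EReal.coe_le_coe_iff]
  have k1 := mul_le_mul_of_nonneg_left (h.lockLine_le_lockValue k.2 hn.le σ) (sub_nonneg.2 ht1)
  have k2 := mul_le_mul_of_nonneg_left
    (h.lockLine_le_lockValue (j := n + 1) k.2 hn σ) ht0
  have e : (M : ℝ) * ((n + t) / M) = n + t := by field_simp
  rw [lockLine, e]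
  simp only [lockValue] at k1 k2 ⊢
  push_cast at k1 k2 ⊢
  nlinarith

theorem interp_lockMean (h : PhaseEnergy g zs c K) {M n : ℕ} (hn : n < M) (t σ : ℝ) :
    ((1 - t : ℝ) : EReal) * mixMin g zs K (n / M) (lockMean g zs K M n σ) +
      ((t : ℝ) : EReal) * mixMin g zs K ((n + 1 : ℕ) / M) (lockMean g zs K M (n + 1) σ) =
    ((σ * ((1 - t) * lockMean g zs K M n σ + t * lockMean g zs K M (n + 1) σ) +
      ((1 - t) * lockValue g zs K M n σ + t * lockValue g zs K M (n + 1) σ) : ℝ) : EReal) := by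
  have hM : 0 < M := by omega
  obtain ⟨a0, a1⟩ := natCast_div_mem_unit hM hn.le
  obtain ⟨b0, b1⟩ := natCast_div_mem_unit (n := n + 1) hM hn
  rw [lockMean, h.mixMin_saddleMean a0 a1, lockMean, h.mixMin_saddleMean b0 b1,
    ← EReal.coe_mul, ← EReal.coe_mul, ← EReal.coe_add]
  congr 1
  simp only [lockValue]
  ring

/-- Value of the relaxed energy at mixtures of saddle points. -/
theorem relaxedEnergy_lockMean (h : PhaseEnergy g zs c K) {M n : ℕ} (hn : n < M) {t : ℝ}
    (ht0 : 0 ≤ t) (ht1 : t ≤ 1) (σ : ℝ) :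
    relaxedEnergy g zs K M ((n + t) / M)
      ((1 - t) * lockMean g zs K M n σ + t * lockMean g zs K M (n + 1) σ) =
    ((σ * ((1 - t) * lockMean g zs K M n σ + t * lockMean g zs K M (n + 1) σ) +
      ((1 - t) * lockValue g zs K M n σ + t * lockValue g zs K M (n + 1) σ) : ℝ) : EReal) := by
  refine le_antisymm ((h.relaxedEnergy_le_interp hn ht0 ht1).trans_eq (h.interp_lockMean hn t σ)) ?_
  refine le_trans (le_of_eq ?_) (le_relaxedEnergy hn _ _ σ)
  congr 1
  have hM' : (M : ℝ) ≠ 0 := by have : M ≠ 0 := by omega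
                               exact_mod_cast this
  have e : (M : ℝ) * ((n + t) / M) = n + t := by field_simp
  rw [lockLine, e]
  ring

/-- The relaxed energy is the least energy of mixtures of neighbouring states. -/
theorem isLeast_interpValues (h : PhaseEnergy g zs c K) {M n : ℕ} (hn : n < M) {t : ℝ}
    (ht0 : 0 ≤ t) (ht1 : t ≤ 1) (z : ℝ) :
    IsLeast (interpValues g zs K M n t z) (relaxedEnergy g zs K M ((n + t) / M) z) := by
  have hM : 0 < M := by omega
  have hM' : (M : ℝ) ≠ 0 := by exact_mod_cast hM.ne'
  have hn' : (n : ℝ) + 1 ≤ M := by exact_mod_cast hn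
  have lower : relaxedEnergy g zs K M ((n + t) / M) z ∈ lowerBounds (interpValues g zs K M n t z) := by
    rintro v ⟨w, w', rfl, rfl⟩
    exact h.relaxedEnergy_le_interp hn ht0 ht1
  refine ⟨?_, lower⟩
  have hn0 : (0 : ℝ) ≤ n := Nat.cast_nonneg n
  by_cases hz1 : 0 < n + t ∨ z < zs
  · by_cases hz2 : n + t < M ∨ zs < z
    · obtain ⟨σ, rfl⟩ := h.exists_slope hn ht0 ht1 hz1 hz2
      rw [h.relaxedEnergy_lockMean hn ht0 ht1]
      exact ⟨_, _, rfl, (h.interp_lockMean hn t σ).symm⟩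
    -- Only the fraction 1 with z ≤ zs is left; no slope need give this mean, and the endpoint lemma
    -- takes over. The fraction 0 with z ≥ zs is handled the same way below.
    · push Not at hz2
      have ht : t = 1 := by linarith [hz2.1]
      subst ht
      have hnM : n + 1 = M := by
        have : (M : ℝ) ≤ n + 1 := by linarith [hz2.1]
        have h2 : M ≤ n + 1 := by exact_mod_cast this
        omega
      have e1 : ((n : ℝ) + 1) / M = 1 := by
        rw [← hnM]; push_cast; field_simp
      have hmem : mixMin g zs K 1 z ∈ interpValues g zs K M n 1 z :=
        ⟨0, z, by ring, by rw [sub_self]; push_cast; rw [e1]; simp⟩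
      rw [e1] at lower ⊢
      rwa [le_antisymm (lower hmem) (h.mixMin_one_le hM hz2.2)]
  · push Not at hz1
    have ht : t = 0 := by linarith [hz1.1]
    have hn00 : (n : ℝ) = 0 := by linarith [hz1.1]
    subst ht
    have hmem : mixMin g zs K 0 z ∈ interpValues g zs K M n 0 z :=
      ⟨z, 0, by ring, by rw [hn00]; simp⟩
    have e1 : ((n : ℝ) + 0) / M = 0 := by rw [hn00]; simp
    rw [e1] at lower ⊢
    rwa [le_antisymm (lower hmem) (h.mixMin_zero_le hM hz1.2)]

end PhaseEnergy

/-- Every phase fraction lies between neighbouring multiples of `1 / M`. -/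
theorem exists_eq_add_div {M : ℕ} (hM : 0 < M) {θ : ℝ} (h0 : 0 ≤ θ) (h1 : θ ≤ 1) :
    ∃ n < M, ∃ t : ℝ, 0 ≤ t ∧ t ≤ 1 ∧ θ = (n + t) / M := by
  have hM' : (0 : ℝ) < M := by exact_mod_cast hM
  rcases h1.eq_or_lt with rfl | h1
  · refine ⟨M - 1, by omega, 1, zero_le_one, le_rfl, ?_⟩
    rw [Nat.cast_sub (by omega)]; push_cast; field_simp; ring
  · have hp : 0 ≤ M * θ := by positivity
    refine ⟨⌊M * θ⌋₊, ?_, M * θ - ⌊M * θ⌋₊, ?_, ?_, ?_⟩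
    · rw [Nat.floor_lt hp]; nlinarith
    · linarith [Nat.floor_le hp]
    · linarith [Nat.lt_floor_add_one (M * θ)]
    · field_simp; ring

namespace PhaseEnergy

variable {g : ℝ → ℝ} {zs c K : ℝ}

/-- In the open interval of phase fractions the relaxed energy is finite and has a supporting
line. -/
theorem exists_relaxedEnergy_eq (h : PhaseEnergy g zs c K) {M : ℕ} (hM : 0 < M) {θ : ℝ}
    (h0 : 0 < θ) (h1 : θ < 1) (z : ℝ) : ∃ σ, ∃ n < M, relaxedEnergy g zs K M θ z =
      ((σ * z + lockLine g zs K M n θ σ : ℝ) : EReal) := by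
  have hM' : (0 : ℝ) < M := by exact_mod_cast hM
  obtain ⟨n, hn, t, ht0, ht1, rfl⟩ := exists_eq_add_div hM h0.le h1.le
  obtain ⟨σ, rfl⟩ := h.exists_slope (z := z) hn ht0 ht1
    (Or.inl (by have := mul_pos h0 hM'; rwa [div_mul_cancel₀ _ hM'.ne'] at this))
    (Or.inl (by rwa [div_lt_one hM'] at h1))
  refine ⟨σ, n, hn, ?_⟩
  rw [h.relaxedEnergy_lockMean hn ht0 ht1, lockLine, mul_div_cancel₀ _ hM'.ne']
  congr 1
  ring

/-- As a finite supremum of functions affine in θ, the relaxed energy is convex on (0,1), hence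
continuous there. -/
theorem continuousAt_relaxedEnergy (h : PhaseEnergy g zs c K) {M : ℕ} (hM : 0 < M) {θ : ℝ}
    (h0 : 0 < θ) (h1 : θ < 1) (z : ℝ) :
    ContinuousAt (fun t => relaxedEnergy g zs K M t z) θ := by
  have hreal : ∀ t ∈ Set.Ioo (0 : ℝ) 1, relaxedEnergy g zs K M t z =
      ((relaxedEnergy g zs K M t z).toReal : EReal) := by
    intro t ht
    obtain ⟨σ, n, _, he⟩ := h.exists_relaxedEnergy_eq hM ht.1 ht.2 z
    rw [he]; rfl
  have hconv : ConvexOn ℝ (Set.Ioo (0 : ℝ) 1) fun t => (relaxedEnergy g zs K M t z).toReal := by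
    refine ⟨convex_Ioo 0 1, fun x hx y hy s t hs ht hst => ?_⟩
    have hm := convex_Ioo (0 : ℝ) 1 hx hy hs ht hst
    simp only [smul_eq_mul] at hm ⊢
    obtain ⟨σ, n, hn, he⟩ := h.exists_relaxedEnergy_eq hM hm.1 hm.2 z
    have l : ∀ w ∈ Set.Ioo (0 : ℝ) 1, σ * z + lockLine g zs K M n w σ ≤
        (relaxedEnergy g zs K M w z).toReal := by
      intro w hw
      rw [← EReal.coe_le_coe_iff, ← hreal w hw]
      exact le_relaxedEnergy hn w z σ
    have lx := mul_le_mul_of_nonneg_left (l x hx) hs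
    have ly := mul_le_mul_of_nonneg_left (l y hy) ht
    rw [he, EReal.toReal_coe]
    simp only [lockLine] at lx ly ⊢
    have hs' : s = 1 - t := by linarith
    subst hs'
    nlinarith
  have hc := (hconv.continuousOn isOpen_Ioo).continuousAt (isOpen_Ioo.mem_nhds ⟨h0, h1⟩)
  have hc' : ContinuousAt (fun t => ((relaxedEnergy g zs K M t z).toReal : EReal)) θ :=
    continuous_coe_real_ereal.continuousAt.comp hc
  refine hc'.congr ?_
  filter_upwards [isOpen_Ioo.mem_nhds (⟨h0, h1⟩ : θ ∈ Set.Ioo (0 : ℝ) 1)] with t ht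
  exact (hreal t ht).symm

end PhaseEnergy

end

/-! ### From the phase-constrained lattice problems to the relaxed energy. -/

noncomputable section

theorem phaseEnergy_nnEnergy {f : ℝ → ℝ} {m : ℕ → ℝ} {M : ℕ} {zs c : ℝ} (hM : 2 ≤ M)
    (hm : ∀ n, 0 ≤ m n) (hmM : 0 < m M) (hbi : IsBiconvex f zs) (hlsc : LowerSemicontinuous f)
    (hc : 0 < c) (hlow : ∀ z, (1 / c) * z ^ 2 ≤ f z + m 1 * z ^ 2) :
    PhaseEnergy (nnEnergy f m) zs c (2 * m M * (M : ℝ) ^ 2) := by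
  have hsq : ConvexOn ℝ Set.univ fun z : ℝ => 2 * m 1 * z ^ 2 := by
    have h2 : ConvexOn ℝ Set.univ fun z : ℝ => z ^ 2 := even_two.convexOn_pow
    exact h2.smul (by have := hm 1; positivity : 0 ≤ 2 * m 1)
  have hM' : (0 : ℝ) < M := by
    have : 0 < M := by omega
    exact_mod_cast this
  refine ⟨hbi.1.add (hsq.subset (Set.subset_univ _) (convex_Iic zs)),
    hbi.2.add (hsq.subset (Set.subset_univ _) (convex_Ici zs)), ?_, hc, by positivity, ?_⟩
  · exact hlsc.add (by fun_prop : Continuous fun z : ℝ => 2 * m 1 * z ^ 2).lowerSemicontinuous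
  · intro x
    have h1 := hlow x
    have h2 : 0 ≤ m 1 * x ^ 2 := mul_nonneg (hm 1) (sq_nonneg x)
    rw [nnEnergy, div_eq_inv_mul, ← one_div]
    linarith

section

variable {f : ℝ → ℝ} {m : ℕ → ℝ} {M : ℕ} {zs c : ℝ}

/-- The factor s stays in the mean equation because a state of weight zero contributes `0 * ⊤ = 0`
even if it has no admissible mixture of mean w. -/
theorem exists_mixValues_of_mul {g : ℝ → ℝ} {K : ℝ} (h : PhaseEnergy g zs c K) (hM : 2 ≤ M)
    {n : ℕ} (hn : n ≤ M) {s : ℝ} (hs : 0 ≤ s) (w : ℝ) :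
    (s : EReal) * mixMin g zs K (n / M) w = ⊤ ∨ ∃ a b : ℝ, a ≤ zs ∧ zs ≤ b ∧
      s * ((1 - (n : ℝ) / M) * a + n / M * b) = s * w ∧
      (s : EReal) * mixMin g zs K (n / M) w = ((s * mixEnergy g K (n / M) a b : ℝ) : EReal) := by
  rcases hs.eq_or_lt with rfl | hs
  · right
    exact ⟨zs, zs, le_rfl, le_rfl, by ring, by simp⟩
  · rcases (mixValues g zs K (n / M) w).eq_empty_or_nonempty with he | hne
    · left
      rw [mixMin, he, sInf_empty, EReal.coe_mul_top_of_pos hs]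
    · right
      obtain ⟨a, b, ha, hb, hab, hv⟩ := (h.isLeast_mixValues hM hn hne).1
      exact ⟨a, b, ha, hb, by rw [hab], by rw [hv, EReal.coe_mul]⟩

/-- The relaxed energy, if finite, is the energy of an explicit mixture. -/
theorem exists_mixture {g : ℝ → ℝ} {K : ℝ} (h : PhaseEnergy g zs c K) (hM : 2 ≤ M)
    {n : ℕ} (hn : n < M) {t : ℝ} (ht0 : 0 ≤ t) (ht1 : t ≤ 1) (z : ℝ) :
    relaxedEnergy g zs K M ((n + t) / M) z = ⊤ ∨ ∃ a b a' b' : ℝ, a ≤ zs ∧ zs ≤ b ∧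
      a' ≤ zs ∧ zs ≤ b' ∧ (1 - t) * ((1 - (n : ℝ) / M) * a + n / M * b) +
        t * ((1 - ((n + 1 : ℕ) : ℝ) / M) * a' + ((n + 1 : ℕ) : ℝ) / M * b') = z ∧
      relaxedEnergy g zs K M ((n + t) / M) z = (((1 - t) * mixEnergy g K (n / M) a b +
        t * mixEnergy g K ((n + 1 : ℕ) / M) a' b' : ℝ) : EReal) := by
  obtain ⟨w, w', hw, he⟩ := (h.isLeast_interpValues hn ht0 ht1 z).1
  rcases exists_mixValues_of_mul h hM hn.le (sub_nonneg.2 ht1) w with h1 | ⟨a, b, ha, hb, hab, h1⟩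
  · rcases exists_mixValues_of_mul h hM (n := n + 1) hn ht0 w' with h2 | ⟨a', b', _, _, _, h2⟩
    · left; rw [he, h1, h2]; rfl
    · left; rw [he, h1, h2]; exact EReal.top_add_coe _
  · rcases exists_mixValues_of_mul h hM (n := n + 1) hn ht0 w' with
      h2 | ⟨a', b', ha', hb', hab', h2⟩
    · left; rw [he, h1, h2]; exact EReal.coe_add_top _
    · right
      exact ⟨a, b, a', b', ha, hb, ha', hb', by rw [hab, hab', hw], by
        rw [he, h1, h2, ← EReal.coe_add]⟩

theorem card_filter_range_eq_sum (N : ℕ) (P : ℕ → Prop) [DecidablePred P] :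
    (((Finset.range N).filter P).card : ℝ) = ∑ i ∈ Finset.range N, if P i then (1 : ℝ) else 0 := by
  simp [Finset.sum_boole]

theorem relaxedEnergy_le_QhatPhase (hM : 2 ≤ M) (hconc : IsConcentrated m M)
    (h : PhaseEnergy (nnEnergy f m) zs c (2 * m M * (M : ℝ) ^ 2)) (θ z : ℝ) :
    relaxedEnergy (nnEnergy f m) zs (2 * m M * (M : ℝ) ^ 2) M θ z ≤ QhatPhase f m zs θ z := by
  classical
  have hM0 : 0 < M := by omega
  have hM' : (0 : ℝ) < M := by exact_mod_cast hM0
  refine iSup_le fun σ => iSup_le fun k => ?_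
  set p := lockValue (nnEnergy f m) zs (2 * m M * (M : ℝ) ^ 2) M k σ with hp
  set S := lockValue (nnEnergy f m) zs (2 * m M * (M : ℝ) ^ 2) M (k + 1) σ - p with hS
  -- The minorant is the line through the values k and k + 1; evaluated at M θ it becomes
  -- `lockLine`.
  obtain ⟨C, hC⟩ := h.lattice_lower_bound hM0 (σ := σ) (α := p - k * S) (β := S) (by
    intro j hj
    have := h.lockLine_le_lockValue k.2 hj σ
    simp only [← hp, ← hS] at this
    rw [lockValue] at this
    linarith)
  refine EReal.ge_of_forall_gt_iff_ge.1 fun r hr => ?_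
  have hr' : r < σ * z + lockLine (nnEnergy f m) zs (2 * m M * (M : ℝ) ^ 2) M k θ σ :=
    EReal.coe_lt_coe_iff.1 hr
  set v := σ * z + lockLine (nnEnergy f m) zs (2 * m M * (M : ℝ) ^ 2) M k θ σ with hv
  refine le_liminf_of_le (by isBoundedDefault) ?_
  rw [eventually_inf_principal]
  filter_upwards [eventually_ge_atTop M, eventually_ge_atTop ⌈|C| / (v - r)⌉₊] with N hN hN2
  rintro ⟨q, hq⟩
  have hN0 : 0 < N := by omega
  have hN' : (0 : ℝ) < N := by exact_mod_cast hN0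
  refine le_iInf₂ fun u hu => EReal.coe_le_coe_iff.2 ?_
  obtain ⟨⟨hu0, huN⟩, hc1, hc2⟩ := hu
  have hsub : (Finset.range N).filter (fun i => zs < u (i + 1) - u i) ⊆
      (Finset.range N).filter (fun i => zs ≤ u (i + 1) - u i) := by
    intro i hi
    rw [Finset.mem_filter] at hi ⊢
    exact ⟨hi.1, hi.2.le⟩
  have hcard1 : ((Finset.range N).filter (fun i => zs < u (i + 1) - u i)).card ≤ q := by
    rw [hq] at hc1; exact_mod_cast hc1
  have hcard2 : q ≤ ((Finset.range N).filter (fun i => zs ≤ u (i + 1) - u i)).card := by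
    have e := Finset.card_filter_add_card_filter_not (s := Finset.range N)
      (fun i => zs ≤ u (i + 1) - u i)
    simp only [not_le, Finset.card_range] at e
    have e' : (((Finset.range N).filter (fun i => zs ≤ u (i + 1) - u i)).card : ℝ) +
      ((Finset.range N).filter (fun i => u (i + 1) - u i < zs)).card = N := by exact_mod_cast e
    have : (q : ℝ) ≤ ((Finset.range N).filter (fun i => zs ≤ u (i + 1) - u i)).card := by
      rw [← hq]; linarith
    exact_mod_cast this
  -- The closed constraint only brackets θN between the counts of increments > zs and ≥ zs.
  -- Assigning increments equal to zs suitably gives exactly θN right-phase sites.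
  obtain ⟨T, hT1, hT2, hTq⟩ := Finset.exists_subsuperset_card_eq hsub hcard1 hcard2
  have hlow := hC N hN u T
    (fun i hi hz => hT1 (Finset.mem_filter.2 ⟨Finset.mem_range.2 hi, hz⟩))
    (fun i hi => by
      have := Finset.mem_filter.1 (hT2 hi)
      exact ⟨Finset.mem_range.1 this.1, this.2⟩)
  have eK : 2 * m M * (M : ℝ) ^ 2 / M ^ 2 = 2 * m M := by field_simp
  rw [eK, ← latticeEnergy_eq hM hconc, huN, hu0, hTq, ← hq] at hlow
  have e : σ * (N * z - 0) + N * (p - k * S) + S * M * (θ * N) - C = N * v - C := by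
    rw [hv, lockLine, ← hp, ← hS]; ring
  rw [e] at hlow
  have hCN : C ≤ N * (v - r) := by
    have h1 := Nat.ceil_le.1 hN2
    rw [div_le_iff₀ (by linarith)] at h1
    exact (le_abs_self C).trans h1
  rw [one_div, inv_mul_eq_div, le_div_iff₀ hN']
  linarith

theorem QhatPhase_le_relaxedEnergy (hM : 2 ≤ M) (hmM : 0 ≤ m M) (hconc : IsConcentrated m M)
    (h : PhaseEnergy (nnEnergy f m) zs c (2 * m M * (M : ℝ) ^ 2)) {n p q : ℕ} (hn : n < M)
    (hpq : p ≤ q) (hq : 0 < q) (z : ℝ) :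
    QhatPhase f m zs ((n + (p / q : ℝ)) / M) z ≤
      relaxedEnergy (nnEnergy f m) zs (2 * m M * (M : ℝ) ^ 2) M ((n + (p / q : ℝ)) / M) z := by
  classical
  have hM0 : 0 < M := by omega
  have hM' : (0 : ℝ) < M := by exact_mod_cast hM0
  have hq' : (0 : ℝ) < q := by exact_mod_cast hq
  set t : ℝ := p / q with ht
  have ht0 : 0 ≤ t := by positivity
  have ht1 : t ≤ 1 := by rw [ht, div_le_one hq']; exact_mod_cast hpq
  have hqt : (q : ℝ) * t = p := by rw [ht]; field_simp
  clear_value t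
  rcases exists_mixture h hM hn ht0 ht1 z with htop | ⟨a, b, a', b', ha, hb, ha', hb', hz, he⟩
  · rw [htop]; exact le_top
  rw [he]
  set E := mixEnergy (nnEnergy f m) (2 * m M * (M : ℝ) ^ 2) (n / M) a b with hE
  set E' := mixEnergy (nnEnergy f m) (2 * m M * (M : ℝ) ^ 2) ((n + 1 : ℕ) / M) a' b' with hE'
  refine EReal.le_of_forall_lt_iff_le.1 fun r hr => ?_
  have hr' := EReal.coe_lt_coe_iff.1 hr
  set v := (1 - t) * E + t * E' with hv
  set B := |a| + |b| + |a'| + |b'| with hB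
  set C := 2 * m M * ((2 * M + (0 : ℕ)) * (M * B) ^ 2) with hC
  refine liminf_le_of_frequently_le' ?_
  rw [frequently_inf_principal, frequently_atTop]
  intro A
  set s := A + ⌈C / (r - v)⌉₊ + 1 with hs
  have hs0 : 0 < s := by omega
  have hqp : ((q - p : ℕ) : ℝ) = q - p := by rw [Nat.cast_sub hpq]
  -- N = M q s: of the q s periods, p s carry n + 1 right strains, so the fraction is exact and the
  -- remainder of the pattern is empty. Since s is arbitrarily large, such N occur frequently.
  set N := M * ((q - p) * s + p * s) + 0 with hN
  have hNe : N = M * q * s := by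
    rw [hN, ← Nat.add_mul, Nat.sub_add_cancel hpq]; ring
  have hNr : (N : ℝ) = M * q * s := by rw [hNe]; push_cast; ring
  have hsN : s ≤ N := by
    rw [hNe]; exact Nat.le_mul_of_pos_left s (Nat.mul_pos hM0 hq)
  have hN0 : (0 : ℝ) < N := by
    have : 0 < N := by omega
    exact_mod_cast this
  have hθN : ((n : ℝ) + t) / M * N = (q * n + p) * s := by
    have e : ((n : ℝ) + t) / M * (M * q * s) = (n + t) * q * s := by field_simp
    rw [hNr, e]
    linear_combination (s : ℝ) * hqt
  have hsum := fun φ => sum_patternStrain (M := M) hn.le (n' := n + 1) hn ((q - p) * s) (p * s) 0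
    a b a' b' 0 φ
  rw [← hN] at hsum
  simp only [Nat.cast_zero, zero_mul, add_zero] at hsum
  have hθN' : (1 - ((n : ℝ) + t) / M) * N = N - (q * n + p) * s := by
    rw [sub_mul, one_mul, hθN]
  refine ⟨N, by omega, ⟨(q * n + p) * s, by rw [hθN]; push_cast; ring⟩, ?_⟩
  refine le_trans (iInf₂_le (patternFun M n (n + 1) ((q - p) * s) (p * s) a b a' b' 0) ⟨⟨?_, ?_⟩,
    ?_, ?_⟩) (EReal.coe_le_coe_iff.2 ?_)
  · have hB1 : |a| ≤ B := by rw [hB]; linarith [abs_nonneg b, abs_nonneg a', abs_nonneg b']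
    have hB2 : |b| ≤ B := by rw [hB]; linarith [abs_nonneg a, abs_nonneg a', abs_nonneg b']
    have hB3 : |a'| ≤ B := by rw [hB]; linarith [abs_nonneg b, abs_nonneg a, abs_nonneg b']
    have hB4 : |b'| ≤ B := by rw [hB]; linarith [abs_nonneg b, abs_nonneg a', abs_nonneg a]
    have hle := latticeEnergy_pattern_le (f := f) hM hmM hconc hn.le (n' := n + 1) hn
      ((q - p) * s) (p * s) 0 hB1 hB2 hB3 hB4 (e := 0) (by rw [abs_zero, hB]; positivity)
    rw [← hN, ← hC, ← hE, ← hE'] at hle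
    have e1 : (M : ℝ) * ((q - p) * s : ℕ) * E + M * (p * s : ℕ) * E' = N * v := by
      rw [hNr, hv]
      push_cast
      rw [hqp]
      linear_combination (M * s * (E - E')) * hqt
    rw [e1] at hle
    have hCN : C ≤ N * (r - v) := by
      have h1 : ⌈C / (r - v)⌉₊ ≤ N := by omega
      have h1 := Nat.ceil_le.1 h1
      rwa [div_le_iff₀ (by linarith)] at h1
    rw [one_div, inv_mul_eq_div, div_le_iff₀ hN0]
    simp only [Nat.cast_zero, zero_mul] at hle
    linarith
  · simp [patternFun]
  · rw [patternFun]
    have := hsum id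
    simp only [id] at this
    have e1 : (n : ℝ) * b + (M - n) * a = M * ((1 - (n : ℝ) / M) * a + n / M * b) := by
      field_simp; ring
    have e2 : ((n + 1 : ℕ) : ℝ) * b' + (M - (n + 1 : ℕ)) * a' =
        M * ((1 - ((n + 1 : ℕ) : ℝ) / M) * a' + ((n + 1 : ℕ) : ℝ) / M * b') := by
      field_simp; ring
    rw [this, ← hz, hNr, e1, e2]
    generalize (1 - (n : ℝ) / M) * a + n / M * b = w
    generalize (1 - ((n + 1 : ℕ) : ℝ) / M) * a' + ((n + 1 : ℕ) : ℝ) / M * b' = w'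
    push_cast
    rw [hqp]
    linear_combination (M * s * (w - w')) * hqt
  · simp only [patternFun_succ_sub]
    rw [card_filter_range_eq_sum, hsum fun x => if zs < x then (1 : ℝ) else 0, hθN,
      if_neg ha.not_gt, if_neg ha'.not_gt]
    have i1 : (if zs < b then (1 : ℝ) else 0) ≤ 1 := by split_ifs <;> norm_num
    have i2 : (if zs < b' then (1 : ℝ) else 0) ≤ 1 := by split_ifs <;> norm_num
    have j1 := mul_le_mul_of_nonneg_left i1
      (by positivity : 0 ≤ (((q - p) * s : ℕ) : ℝ) * n)
    have j2 := mul_le_mul_of_nonneg_left i2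
      (by positivity : 0 ≤ ((p * s : ℕ) : ℝ) * ((n + 1 : ℕ) : ℝ))
    refine le_trans (b := (((q - p) * s : ℕ) : ℝ) * n * 1 +
      ((p * s : ℕ) : ℝ) * ((n + 1 : ℕ) : ℝ) * 1) (by linarith) (le_of_eq ?_)
    push_cast
    rw [hqp]
    ring
  · simp only [patternFun_succ_sub]
    rw [card_filter_range_eq_sum, hsum fun x => if x < zs then (1 : ℝ) else 0, hθN',
      if_neg hb.not_gt, if_neg hb'.not_gt]
    have i1 : (if a < zs then (1 : ℝ) else 0) ≤ 1 := by split_ifs <;> norm_num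
    have i2 : (if a' < zs then (1 : ℝ) else 0) ≤ 1 := by split_ifs <;> norm_num
    have k1 : (0 : ℝ) ≤ M - n := by
      have : (n : ℝ) ≤ M := by exact_mod_cast hn.le
      linarith
    have k2 : (0 : ℝ) ≤ M - (n + 1 : ℕ) := by
      have : ((n + 1 : ℕ) : ℝ) ≤ M := by exact_mod_cast hn
      linarith
    have j1 := mul_le_mul_of_nonneg_left i1
      (by positivity : 0 ≤ (((q - p) * s : ℕ) : ℝ) * (M - n))
    have j2 := mul_le_mul_of_nonneg_left i2
      (by positivity : 0 ≤ ((p * s : ℕ) : ℝ) * (M - ((n + 1 : ℕ) : ℝ)))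
    refine le_trans (b := (((q - p) * s : ℕ) : ℝ) * (M - n) * 1 +
      ((p * s : ℕ) : ℝ) * (M - ((n + 1 : ℕ) : ℝ)) * 1) (by linarith) (le_of_eq ?_)
    rw [hNr]
    push_cast
    rw [hqp]
    ring

theorem exists_nat_div_eq {t : ℚ} (h0 : 0 ≤ t) (h1 : t ≤ 1) :
    ∃ p q : ℕ, p ≤ q ∧ 0 < q ∧ (t : ℝ) = p / q := by
  have hd : (0 : ℚ) < t.den := by exact_mod_cast t.den_pos
  have e : t = (t.num.toNat : ℚ) / t.den := by
    conv_lhs => rw [← Rat.num_div_den t]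
    congr 1
    exact_mod_cast (Int.toNat_of_nonneg (Rat.num_nonneg.2 h0)).symm
  refine ⟨t.num.toNat, t.den, ?_, t.den_pos, ?_⟩
  · have : (t.num.toNat : ℚ) ≤ t.den := by
      rw [e, div_le_one hd] at h1
      exact h1
    exact_mod_cast this
  · conv_lhs => rw [e]
    push_cast; rfl

/-- For rational phase fractions the lattice relaxation is the relaxed energy. -/
theorem QhatPhase_eq (hM : 2 ≤ M) (hmM : 0 ≤ m M) (hconc : IsConcentrated m M)
    (h : PhaseEnergy (nnEnergy f m) zs c (2 * m M * (M : ℝ) ^ 2)) {θ : ℚ} (h0 : (0 : ℝ) ≤ θ)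
    (h1 : (θ : ℝ) ≤ 1) (z : ℝ) : QhatPhase f m zs θ z =
      relaxedEnergy (nnEnergy f m) zs (2 * m M * (M : ℝ) ^ 2) M θ z := by
  refine le_antisymm ?_ (relaxedEnergy_le_QhatPhase hM hconc h θ z)
  have hM0 : 0 < M := by omega
  have hM' : (M : ℝ) ≠ 0 := by exact_mod_cast hM0.ne'
  obtain ⟨n, hn, t, ht0, ht1, ht⟩ := exists_eq_add_div hM0 h0 h1
  have htq : t = ((M * θ - n : ℚ) : ℝ) := by
    push_cast; rw [ht]; field_simp; ring
  obtain ⟨p, q, hpq, hq, he⟩ := exists_nat_div_eq (t := M * θ - n)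
    (by rw [htq] at ht0; exact_mod_cast ht0) (by rw [htq] at ht1; exact_mod_cast ht1)
  rw [ht, htq, he]
  exact QhatPhase_le_relaxedEnergy hM hmM hconc h hn hpq hq z

/-! ### The limit without phase constraint. -/

theorem latticeEnergy_nonneg (hf0 : ∀ z, 0 ≤ f z) (hm : ∀ n, 0 ≤ m n) (k : ℕ) (u : ℕ → ℝ) :
    0 ≤ latticeEnergy f m k u :=
  add_nonneg (Finset.sum_nonneg fun _ _ => hf0 _) (Finset.sum_nonneg fun _ _ =>
    Finset.sum_nonneg fun _ _ => mul_nonneg (hm _) (sq_nonneg _))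

/-- A constant minorant makes the window bound independent of the number of right-phase sites. -/
theorem relaxSeq_lower (hM : 2 ≤ M) (hconc : IsConcentrated m M)
    (h : PhaseEnergy (nnEnergy f m) zs c (2 * m M * (M : ℝ) ^ 2)) {σ p : ℝ}
    (hp : ∀ j ≤ M, p ≤ lockValue (nnEnergy f m) zs (2 * m M * (M : ℝ) ^ 2) M j σ) (z : ℝ) :
    ∃ C, ∀ k : ℕ, M ≤ k → σ * z + p - C / k ≤ relaxSeq f m z k := by
  classical
  have hM0 : 0 < M := by omega
  have hM' : (0 : ℝ) < M := by exact_mod_cast hM0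
  obtain ⟨C, hC⟩ := h.lattice_lower_bound hM0 (σ := σ) (α := p) (β := 0) (by
    intro j hj; simpa [lockValue] using hp j hj)
  refine ⟨C, fun k hk => ?_⟩
  have hk' : (0 : ℝ) < k := by
    have : 0 < k := by omega
    exact_mod_cast this
  have hne : (latticeEnergy f m k '' admissible k z).Nonempty :=
    ⟨_, fun i => i * z, by simp [admissible], rfl⟩
  have hinf : k * (σ * z + p) - C ≤ sInf (latticeEnergy f m k '' admissible k z) := by
    refine le_csInf hne ?_
    rintro _ ⟨u, ⟨hu0, huk⟩, rfl⟩
    have hlow := hC k hk u ((Finset.range k).filter fun i => zs < u (i + 1) - u i)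
      (fun i hi hz => Finset.mem_filter.2 ⟨Finset.mem_range.2 hi, hz⟩)
      (fun i hi => by
        have := Finset.mem_filter.1 hi
        exact ⟨Finset.mem_range.1 this.1, this.2.le⟩)
    have eK : 2 * m M * (M : ℝ) ^ 2 / M ^ 2 = 2 * m M := by field_simp
    rw [eK, ← latticeEnergy_eq hM hconc, huk, hu0] at hlow
    linarith
  rw [relaxSeq, one_div, inv_mul_eq_div, le_div_iff₀ hk', sub_mul, div_mul_cancel₀ _ hk'.ne']
  linarith

theorem floor_mul_bounds {M : ℕ} (hM : 0 < M) {x : ℝ} (hx : 0 ≤ x) :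
    (M : ℝ) * ⌊x / M⌋₊ ≤ x ∧ x ≤ M * ⌊x / M⌋₊ + M := by
  have hM' : (0 : ℝ) < M := by exact_mod_cast hM
  have h1 := Nat.floor_le (div_nonneg hx hM'.le)
  have h2 := (Nat.lt_floor_add_one (x / M)).le
  rw [le_div_iff₀ hM'] at h1
  rw [div_le_iff₀ hM'] at h2
  constructor <;> linarith

/-- Every k must be reached, so the patterns are completed by a bounded number of equal increments
correcting the boundary value. The growth bound on f makes their cost bounded uniformly in k. -/
theorem relaxSeq_upper (hM : 2 ≤ M) (hm : ∀ n, 0 ≤ m n) (hconc : IsConcentrated m M)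
    (hc : 0 < c) (hf0 : ∀ z, 0 ≤ f z) (hup : ∀ z, f z ≤ c * (z ^ 2 + 1)) {n : ℕ} (hn : n < M)
    {t : ℝ} (ht0 : 0 ≤ t) (ht1 : t ≤ 1) (a b a' b' : ℝ) :
    ∃ C, ∀ k : ℕ, 1 ≤ k →
      relaxSeq f m ((1 - t) * ((1 - (n : ℝ) / M) * a + n / M * b) +
        t * ((1 - ((n + 1 : ℕ) : ℝ) / M) * a' + ((n + 1 : ℕ) : ℝ) / M * b')) k ≤
      (1 - t) * mixEnergy (nnEnergy f m) (2 * m M * (M : ℝ) ^ 2) (n / M) a b +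
      t * mixEnergy (nnEnergy f m) (2 * m M * (M : ℝ) ^ 2) ((n + 1 : ℕ) / M) a' b' + C / k := by
  have hM0 : 0 < M := by omega
  have hM' : (0 : ℝ) < M := by exact_mod_cast hM0
  set w := (1 - (n : ℝ) / M) * a + n / M * b with hw
  set w' := (1 - ((n + 1 : ℕ) : ℝ) / M) * a' + ((n + 1 : ℕ) : ℝ) / M * b' with hw'
  set z := (1 - t) * w + t * w' with hz
  set E := mixEnergy (nnEnergy f m) (2 * m M * (M : ℝ) ^ 2) (n / M) a b with hE
  set E' := mixEnergy (nnEnergy f m) (2 * m M * (M : ℝ) ^ 2) ((n + 1 : ℕ) / M) a' b' with hE'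
  have hnn0 : ∀ x, 0 ≤ nnEnergy f m x := fun x =>
    add_nonneg (hf0 x) (mul_nonneg (by have := hm 1; positivity) (sq_nonneg x))
  have hEpos : ∀ j ≤ M, ∀ x y,
      0 ≤ mixEnergy (nnEnergy f m) (2 * m M * (M : ℝ) ^ 2) (j / M) x y := by
    intro j hj x y
    obtain ⟨h0, h1⟩ := natCast_div_mem_unit hM0 hj
    have := hm M
    exact add_nonneg (add_nonneg (mul_nonneg (sub_nonneg.2 h1) (hnn0 _))
      (mul_nonneg h0 (hnn0 _))) (by positivity)
  have hE0 : 0 ≤ E := hEpos n hn.le a b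
  have hE0' : 0 ≤ E' := hEpos (n + 1) hn a' b'
  set B := |a| + |b| + |a'| + |b'| + (M + 1) * (|w| + |w'|) with hB
  have hB0 : 0 ≤ B := by positivity
  set G := c * (B ^ 2 + 1) + 2 * m 1 * B ^ 2 with hG
  have hG0 : 0 ≤ G := by have := hm 1; positivity
  have hwpos : 0 ≤ (M + 1 : ℝ) * (|w| + |w'|) := by positivity
  refine ⟨(2 * M + 1) * G + 2 * m M * ((2 * M + (2 * M + 1)) * (M * B) ^ 2), fun k hk => ?_⟩
  have hk1 : (1 : ℝ) ≤ k := by exact_mod_cast hk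
  have hk' : (0 : ℝ) < k := by linarith
  -- Using k - 1 instead of k leaves a remainder 1 ≤ r ≤ 2M + 1, so there is always an increment
  -- available for the correction.
  set p := ⌊(1 - t) * (k - 1) / M⌋₊ with hp
  set p' := ⌊t * (k - 1) / M⌋₊ with hp'
  obtain ⟨b1, b2⟩ := floor_mul_bounds hM0
    (mul_nonneg (sub_nonneg.2 ht1) (sub_nonneg.2 hk1) : 0 ≤ (1 - t) * ((k : ℝ) - 1))
  obtain ⟨b3, b4⟩ := floor_mul_bounds hM0
    (mul_nonneg ht0 (sub_nonneg.2 hk1) : 0 ≤ t * ((k : ℝ) - 1))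
  rw [← hp] at b1 b2
  rw [← hp'] at b3 b4
  clear_value p p'
  have hle : M * (p + p') + 1 ≤ k := by
    have : ((M * (p + p') + 1 : ℕ) : ℝ) ≤ k := by push_cast; linarith
    exact_mod_cast this
  obtain ⟨r, hr⟩ := Nat.exists_eq_add_of_le (by omega : M * (p + p') ≤ k)
  have hr1 : 1 ≤ r := by omega
  have hr1' : (1 : ℝ) ≤ r := by exact_mod_cast hr1
  have hkr : (k : ℝ) = M * p + M * p' + r := by rw [hr]; push_cast; ring
  have hr2 : (r : ℝ) ≤ 2 * M + 1 := by linarith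
  -- The strain distributing the missing displacement over r sites; both deviations are at most M +
  -- 1 in absolute value.
  set e := (w * ((1 - t) * k - M * p) + w' * (t * k - M * p')) / r with he
  have her : r * e = w * ((1 - t) * k - M * p) + w' * (t * k - M * p') := by
    rw [he]; field_simp
  have heB : |e| ≤ (M + 1) * (|w| + |w'|) := by
    have d1 : |(1 - t) * k - M * p| ≤ M + 1 := by rw [abs_le]; constructor <;> linarith
    have d2 : |t * k - M * p'| ≤ M + 1 := by rw [abs_le]; constructor <;> linarith
    have d3 : |w * ((1 - t) * k - M * p) + w' * (t * k - M * p')| ≤ (M + 1) * (|w| + |w'|) := by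
      refine (abs_add_le _ _).trans ?_
      rw [abs_mul, abs_mul]
      have := mul_le_mul_of_nonneg_left d1 (abs_nonneg w)
      have := mul_le_mul_of_nonneg_left d2 (abs_nonneg w')
      linarith
    rw [he, abs_div, div_le_iff₀ (abs_pos.2 (by linarith))]
    rw [abs_of_nonneg (by linarith : (0 : ℝ) ≤ r)]
    exact d3.trans (le_mul_of_one_le_right hwpos hr1')
  have hB1 : |a| ≤ B := by rw [hB]; linarith [abs_nonneg b, abs_nonneg a', abs_nonneg b']
  have hB2 : |b| ≤ B := by rw [hB]; linarith [abs_nonneg a, abs_nonneg a', abs_nonneg b']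
  have hB3 : |a'| ≤ B := by rw [hB]; linarith [abs_nonneg b, abs_nonneg a, abs_nonneg b']
  have hB4 : |b'| ≤ B := by rw [hB]; linarith [abs_nonneg b, abs_nonneg a', abs_nonneg a]
  have hB5 : |e| ≤ B := by
    rw [hB]; linarith [abs_nonneg b, abs_nonneg a', abs_nonneg a, abs_nonneg b']
  have hGe : nnEnergy f m e ≤ G := by
    have h1 : e ^ 2 ≤ B ^ 2 := sq_le_sq' (by linarith [neg_abs_le e]) (by linarith [le_abs_self e])
    have h2 := hup e
    have h3 : c * (e ^ 2 + 1) ≤ c * (B ^ 2 + 1) := by gcongr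
    have h4 : 2 * m 1 * e ^ 2 ≤ 2 * m 1 * B ^ 2 :=
      mul_le_mul_of_nonneg_left h1 (by have := hm 1; positivity)
    rw [nnEnergy, hG]; linarith
  have hadm : patternFun M n (n + 1) p p' a b a' b' e ∈ admissible k z := by
    constructor
    · simp [patternFun]
    · have hsum := sum_patternStrain (M := M) hn.le (n' := n + 1) hn p p' r a b a' b' e id
      rw [← hr] at hsum
      simp only [id] at hsum
      rw [patternFun, hsum, her]
      have e1 : n * b + (M - n) * a = M * w := by rw [hw]; field_simp; ring
      have e2 : ((n + 1 : ℕ) : ℝ) * b' + (M - (n + 1 : ℕ)) * a' = M * w' := by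
        rw [hw']; field_simp; ring
      rw [e1, e2, hz]; ring
  have hF := latticeEnergy_pattern_le (f := f) hM (hm M) hconc hn.le (n' := n + 1) hn
      p p' r hB1 hB2 hB3 hB4 hB5
  rw [← hr, ← hE, ← hE'] at hF
  have hinf : sInf (latticeEnergy f m k '' admissible k z) ≤
      latticeEnergy f m k (patternFun M n (n + 1) p p' a b a' b' e) :=
    csInf_le ⟨0, by rintro _ ⟨u, _, rfl⟩; exact latticeEnergy_nonneg hf0 hm k u⟩ ⟨_, hadm, rfl⟩
  have t1 : (M : ℝ) * p * E ≤ (1 - t) * k * E := by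
    refine mul_le_mul_of_nonneg_right ?_ hE0
    linarith
  have t2 : (M : ℝ) * p' * E' ≤ t * k * E' := by
    refine mul_le_mul_of_nonneg_right ?_ hE0'
    linarith
  have t3 : r * nnEnergy f m e ≤ (2 * M + 1) * G :=
    mul_le_mul hr2 hGe (hnn0 e) (by positivity)
  have t4 : 2 * m M * ((2 * M + r) * (M * B) ^ 2) ≤
      2 * m M * ((2 * M + (2 * M + 1)) * (M * B) ^ 2) := by
    have := hm M
    gcongr
  rw [relaxSeq, one_div, inv_mul_eq_div, div_le_iff₀ hk', add_mul _ _ (k : ℝ),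
    div_mul_cancel₀ _ hk'.ne']
  linarith

/-- Convergence of the minimum problems at a mean strain with a supporting slope. -/
theorem tendsto_relaxSeq (hM : 2 ≤ M) (hm : ∀ n, 0 ≤ m n) (hconc : IsConcentrated m M)
    (hc : 0 < c) (hf0 : ∀ z, 0 ≤ f z) (hup : ∀ z, f z ≤ c * (z ^ 2 + 1))
    (h : PhaseEnergy (nnEnergy f m) zs c (2 * m M * (M : ℝ) ^ 2)) {n : ℕ} (hn : n < M)
    {t σ z : ℝ} (ht0 : 0 ≤ t) (ht1 : t ≤ 1)
    (hz : (1 - t) * lockMean (nnEnergy f m) zs (2 * m M * (M : ℝ) ^ 2) M n σ +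
      t * lockMean (nnEnergy f m) zs (2 * m M * (M : ℝ) ^ 2) M (n + 1) σ = z)
    (hp : ∀ j ≤ M, (1 - t) * lockValue (nnEnergy f m) zs (2 * m M * (M : ℝ) ^ 2) M n σ +
      t * lockValue (nnEnergy f m) zs (2 * m M * (M : ℝ) ^ 2) M (n + 1) σ ≤
      lockValue (nnEnergy f m) zs (2 * m M * (M : ℝ) ^ 2) M j σ) :
    Tendsto (relaxSeq f m z) atTop
      (𝓝 (σ * z + ((1 - t) * lockValue (nnEnergy f m) zs (2 * m M * (M : ℝ) ^ 2) M n σ +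
      t * lockValue (nnEnergy f m) zs (2 * m M * (M : ℝ) ^ 2) M (n + 1) σ))) := by
  set K := 2 * m M * (M : ℝ) ^ 2 with hK
  obtain ⟨C, hC⟩ := relaxSeq_lower hM hconc h hp z
  obtain ⟨C', hC'⟩ := relaxSeq_upper (f := f) hM hm hconc hc hf0 hup hn ht0 ht1
    (saddlePair (nnEnergy f m) zs K ((n : ℝ) / M) σ).1
    (saddlePair (nnEnergy f m) zs K ((n : ℝ) / M) σ).2
    (saddlePair (nnEnergy f m) zs K (((n + 1 : ℕ) : ℝ) / M) σ).1
    (saddlePair (nnEnergy f m) zs K (((n + 1 : ℕ) : ℝ) / M) σ).2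
  rw [PhaseEnergy.mixEnergy_eq, PhaseEnergy.mixEnergy_eq] at hC'
  change ∀ k : ℕ, 1 ≤ k → relaxSeq f m ((1 - t) * lockMean (nnEnergy f m) zs K M n σ +
    t * lockMean (nnEnergy f m) zs K M (n + 1) σ) k ≤
    (1 - t) * (σ * lockMean (nnEnergy f m) zs K M n σ + lockValue (nnEnergy f m) zs K M n σ) +
    t * (σ * lockMean (nnEnergy f m) zs K M (n + 1) σ + lockValue (nnEnergy f m) zs K M (n + 1) σ)
     + C' / k at hC'
  rw [hz] at hC'
  set v := σ * z + ((1 - t) * lockValue (nnEnergy f m) zs K M n σ +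
      t * lockValue (nnEnergy f m) zs K M (n + 1) σ) with hv
  have l1 : Tendsto (fun k : ℕ => v - C / k) atTop (𝓝 v) := by
    simpa using tendsto_const_nhds.sub (tendsto_const_div_atTop_nhds_zero_nat C)
  have l2 : Tendsto (fun k : ℕ => v + C' / k) atTop (𝓝 v) := by
    simpa using tendsto_const_nhds.add (tendsto_const_div_atTop_nhds_zero_nat C')
  refine tendsto_of_tendsto_of_tendsto_of_le_of_le' l1 l2 ?_ ?_
  · filter_upwards [eventually_ge_atTop M] with k hk
    exact hC k hk
  · filter_upwards [eventually_ge_atTop 1] with k hk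
    refine (hC' k hk).trans (le_of_eq ?_)
    rw [hv, ← hz]; ring

end

end

/-! ### Critical slopes and supporting slopes. -/

noncomputable section

/-- The largest slope at which the state `n / M` is not worse than the state `(n + 1) / M`. -/
def criticalSlope (g : ℝ → ℝ) (zs K : ℝ) (M n : ℕ) : ℝ :=
  sSup {σ | lockValue g zs K M n σ ≤ lockValue g zs K M (n + 1) σ}

/-- `σ` is a supporting slope of the relaxation at `z`, which is a mixture, with weights `1 - t`
and `t`, of the optimal states for the fractions `n / M` and `(n + 1) / M`. -/
structure IsSupport (g : ℝ → ℝ) (zs K : ℝ) (M n : ℕ) (t σ z : ℝ) : Prop where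
  lt : n < M
  nonneg : 0 ≤ t
  le_one : t ≤ 1
  mean_eq : (1 - t) * lockMean g zs K M n σ + t * lockMean g zs K M (n + 1) σ = z
  le_value : ∀ j ≤ M, (1 - t) * lockValue g zs K M n σ + t * lockValue g zs K M (n + 1) σ ≤
    lockValue g zs K M j σ

/-- A function that is convex on both sides of `x₀` and supported at `x₀` is convex. -/
theorem convexOn_univ_of_support {g : ℝ → ℝ} {x₀ τ : ℝ} (hl : ConvexOn ℝ (Set.Iic x₀) g)
    (hr : ConvexOn ℝ (Set.Ici x₀) g) (hτ : ∀ x, g x₀ - τ * x₀ ≤ g x - τ * x) :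
    ConvexOn ℝ Set.univ g := by
  have key : ∀ x y : ℝ, x < x₀ → x₀ < y → ∀ a b : ℝ, 0 < a → 0 < b → a + b = 1 →
      g (a * x + b * y) ≤ a * g x + b * g y := by
    intro x y hx hy a b ha hb hab
    have hyx : 0 < y - x := by linarith
    have hx0 := hτ x
    have hy0 := hτ y
    have ha' : a = 1 - b := by linarith
    -- the chord lies above the value at the corner
    have hch : (y - x) * g x₀ ≤ (y - x₀) * g x + (x₀ - x) * g y := by
      have h1 := mul_le_mul_of_nonneg_left hx0 (by linarith : 0 ≤ y - x₀)
      have h2 := mul_le_mul_of_nonneg_left hy0 (by linarith : 0 ≤ x₀ - x)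
      linarith
    rcases le_total (a * x + b * y) x₀ with hw | hw
    · have hd : 0 < x₀ - x := by linarith
      set s := b * (y - x) / (x₀ - x) with hs
      have hsd : s * (x₀ - x) = b * (y - x) := by rw [hs]; field_simp
      have hs0 : 0 ≤ s := by positivity
      have hs1 : s ≤ 1 := by rw [hs, div_le_one hd, ]; rw [ha'] at hw; linarith
      have hc := hl.2 (Set.mem_Iic.2 hx.le) (Set.mem_Iic.2 le_rfl) (sub_nonneg.2 hs1) hs0 (by ring)
      simp only [smul_eq_mul] at hc
      have e : (1 - s) * x + s * x₀ = a * x + b * y := by rw [ha']; linarith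
      rw [e] at hc
      have h3 := mul_le_mul_of_nonneg_left hch hs0
      have h4 : (y - x) * (s * g x₀) ≤ (y - x) * (s * g x + b * (g y - g x)) := by
        have e2 : s * ((y - x₀) * g x + (x₀ - x) * g y) =
            (y - x) * (s * g x) + (s * (x₀ - x)) * (g y - g x) := by ring
        rw [e2, hsd] at h3
        linarith
      have h5 := le_of_mul_le_mul_left h4 hyx
      have e3 : a * g x = g x - b * g x := by rw [ha']; ring
      linarith
    · have hd : 0 < y - x₀ := by linarith
      set s := a * (y - x) / (y - x₀) with hs
      have hsd : s * (y - x₀) = a * (y - x) := by rw [hs]; field_simp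
      have hs0 : 0 ≤ s := by positivity
      have hb' : b = 1 - a := by linarith
      have hs1 : s ≤ 1 := by rw [hs, div_le_one hd]; rw [hb'] at hw; linarith
      have hc := hr.2 (Set.mem_Ici.2 le_rfl) (Set.mem_Ici.2 hy.le) hs0 (sub_nonneg.2 hs1) (by ring)
      simp only [smul_eq_mul] at hc
      have e : s * x₀ + (1 - s) * y = a * x + b * y := by rw [hb']; linarith
      rw [e] at hc
      have h3 := mul_le_mul_of_nonneg_left hch hs0
      have h4 : (y - x) * (s * g x₀) ≤ (y - x) * (s * g y + a * (g x - g y)) := by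
        have e2 : s * ((y - x₀) * g x + (x₀ - x) * g y) =
            (y - x) * (s * g y) + (s * (y - x₀)) * (g x - g y) := by ring
        rw [e2, hsd] at h3
        linarith
      have h5 := le_of_mul_le_mul_left h4 hyx
      have e3 : b * g y = g y - a * g y := by rw [hb']; ring
      linarith
  refine convexOn_iff_forall_pos.2 ⟨convex_univ, fun x _ y _ a b ha hb hab => ?_⟩
  simp only [smul_eq_mul]
  rcases le_or_gt x x₀ with hx | hx
  · rcases le_or_gt y x₀ with hy | hy
    · exact hl.2 hx hy ha.le hb.le hab
    · rcases hx.eq_or_lt with rfl | hx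
      · exact hr.2 (Set.mem_Ici.2 le_rfl) hy.le ha.le hb.le hab
      · exact key x y hx hy a b ha hb hab
  · rcases le_or_gt x₀ y with hy | hy
    · exact hr.2 hx.le hy ha.le hb.le hab
    · have := key y x hy hx b a hb ha (by linarith)
      rw [add_comm (a * x), add_comm (a * g x)]
      exact this

theorem argmin_unique {g : ℝ → ℝ} {S : Set ℝ} (hg : StrictConvexOn ℝ S g) {τ x y : ℝ}
    (hx : x ∈ S) (hy : y ∈ S) (hmx : ∀ w ∈ S, g x - τ * x ≤ g w - τ * w)
    (hmy : ∀ w ∈ S, g y - τ * y ≤ g w - τ * w) : x = y := by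
  by_contra hne
  have h1 := hg.2 hx hy hne (by norm_num : (0 : ℝ) < 1 / 2) (by norm_num : (0 : ℝ) < 1 / 2)
    (by norm_num)
  have h2 := hg.1 hx hy (by norm_num : (0 : ℝ) ≤ 1 / 2) (by norm_num : (0 : ℝ) ≤ 1 / 2)
    (by norm_num)
  simp only [smul_eq_mul] at h1 h2
  have h3 := hmx _ h2
  have h4 := hmy _ h2
  linarith

theorem slope_eq_deriv_of_isMin {g : ℝ → ℝ} {S : Set ℝ} {τ x : ℝ} (hS : S ∈ 𝓝 x)
    (hd : DifferentiableAt ℝ g x) (hm : ∀ w ∈ S, g x - τ * x ≤ g w - τ * w) : τ = deriv g x := by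
  have hmin : IsLocalMin (fun w => g w - τ * w) x := by
    filter_upwards [hS] with w hw using hm w hw
  have hder : HasDerivAt (fun w => g w - τ * w) (deriv g x - τ * 1) x :=
    hd.hasDerivAt.sub ((hasDerivAt_id x).const_mul τ)
  have := hmin.hasDerivAt_eq_zero hder
  linarith

namespace PhaseEnergy

variable {g : ℝ → ℝ} {zs c K : ℝ} {M : ℕ}

theorem lockMean_mono (h : PhaseEnergy g zs c K) {n : ℕ} (hM : 0 < M) (hn : n ≤ M) :
    Monotone (lockMean g zs K M n) :=
  h.saddleMean_mono (natCast_div_mem_unit hM hn).1 (natCast_div_mem_unit hM hn).2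

theorem natCast_div_le_succ (hM : 0 < M) (n : ℕ) : (n : ℝ) / M ≤ ((n + 1 : ℕ) : ℝ) / M := by
  have : (0 : ℝ) < M := by exact_mod_cast hM
  gcongr
  exact Nat.le_succ n

theorem lockMean_le_succ (h : PhaseEnergy g zs c K) {n : ℕ} (hn : n < M) (σ : ℝ) :
    lockMean g zs K M n σ ≤ lockMean g zs K M (n + 1) σ :=
  h.saddleMean_mono_fraction (natCast_div_mem_unit (by omega) hn.le).1
    (natCast_div_mem_unit (n := n + 1) (by omega) hn).2 (natCast_div_le_succ (by omega) n) σ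

theorem lockValue_sub_antitone (h : PhaseEnergy g zs c K) {n : ℕ} (hn : n < M) {σ σ' : ℝ}
    (hσ : σ ≤ σ') : lockValue g zs K M (n + 1) σ' - lockValue g zs K M n σ' ≤
      lockValue g zs K M (n + 1) σ - lockValue g zs K M n σ :=
  h.saddleValue_sub_antitone (natCast_div_mem_unit (by omega) hn.le).1
    (natCast_div_mem_unit (n := n + 1) (by omega) hn).2 (natCast_div_le_succ (by omega) n) hσ

/-- A convex sequence that does not decrease at one step does not decrease afterwards; the next
lemma is the mirror image. Comparing neighbours thus decides optimality among all indices. -/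
theorem lockValue_le_of_le (h : PhaseEnergy g zs c K) {n j : ℕ} {σ : ℝ} (hn : n < M)
    (hle : lockValue g zs K M n σ ≤ lockValue g zs K M (n + 1) σ) (hnj : n ≤ j) (hj : j ≤ M) :
    lockValue g zs K M n σ ≤ lockValue g zs K M j σ := by
  have h1 := h.lockLine_le_lockValue hn hj σ
  have h2 : (n : ℝ) ≤ j := by exact_mod_cast hnj
  have h3 := mul_nonneg (sub_nonneg.2 h2) (sub_nonneg.2 hle)
  linarith

theorem lockValue_succ_le_of_le (h : PhaseEnergy g zs c K) {n j : ℕ} {σ : ℝ} (hn : n < M)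
    (hle : lockValue g zs K M (n + 1) σ ≤ lockValue g zs K M n σ) (hj : j ≤ n) :
    lockValue g zs K M n σ ≤ lockValue g zs K M j σ := by
  have h1 := h.lockLine_le_lockValue hn (hj.trans hn.le) σ
  have h2 : (j : ℝ) ≤ n := by exact_mod_cast hj
  have h3 := mul_nonneg (sub_nonneg.2 h2) (sub_nonneg.2 hle)
  linarith

/-- The value difference between n + 1 and n is continuous and nonincreasing in σ. The extreme
slopes show that it changes sign, so the preference switches at one end of a closed half-line. -/
theorem criticalSlope_spec (h : PhaseEnergy g zs c K) {n : ℕ} (hn : n < M) :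
    lockValue g zs K M n (criticalSlope g zs K M n) =
      lockValue g zs K M (n + 1) (criticalSlope g zs K M n) ∧
    (∀ σ ≤ criticalSlope g zs K M n, lockValue g zs K M n σ ≤ lockValue g zs K M (n + 1) σ) ∧
    (∀ σ, criticalSlope g zs K M n < σ → lockValue g zs K M (n + 1) σ < lockValue g zs K M n σ) := by
  have hM : 0 < M := by omega
  have hM' : (0 : ℝ) < M := by exact_mod_cast hM
  set U := {σ | lockValue g zs K M n σ ≤ lockValue g zs K M (n + 1) σ} with hU
  have hc1 : Continuous (lockValue g zs K M n) :=
    h.continuous_saddleValue (natCast_div_mem_unit hM hn.le).1 (natCast_div_mem_unit hM hn.le).2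
  have hc2 : Continuous (lockValue g zs K M (n + 1)) :=
    h.continuous_saddleValue (natCast_div_mem_unit (n := n + 1) hM hn).1
      (natCast_div_mem_unit (n := n + 1) hM hn).2
  have hclosed : IsClosed U := isClosed_le hc1 hc2
  have hdown : ∀ σ σ', σ ≤ σ' → σ' ∈ U → σ ∈ U := by
    intro σ σ' hσ hU'
    have := h.lockValue_sub_antitone hn hσ
    simp only [hU, Set.mem_ofPred_eq] at hU' ⊢
    linarith
  have hne : U.Nonempty := by
    obtain ⟨σ₀, hσ₀⟩ := h.exists_left_optimal
    refine ⟨σ₀ - 1, ?_⟩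
    rw [hU, Set.mem_ofPred_eq]
    by_contra hlt
    push Not at hlt
    have h1 := h.lockValue_succ_le_of_le hn hlt.le (Nat.zero_le n)
    have h2 := hσ₀ (σ₀ - 1) (by linarith) (((n + 1 : ℕ) : ℝ) / M) (by positivity)
      (natCast_div_mem_unit (n := n + 1) hM hn).2
    simp only [lockValue, Nat.cast_zero, zero_div] at h1 hlt
    linarith
  have hbdd : BddAbove U := by
    obtain ⟨σ₀, hσ₀⟩ := h.exists_right_optimal
    refine ⟨σ₀ + 1, fun σ hσ => ?_⟩
    by_contra hlt
    push Not at hlt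
    have h1 := h.lockValue_le_of_le hn hσ hn.le le_rfl
    have h2 := hσ₀ σ (by linarith) ((n : ℝ) / M) (by positivity) (by
      rw [div_lt_one hM']; exact_mod_cast hn)
    simp only [lockValue] at h1
    rw [div_self hM'.ne'] at h1
    linarith
  have hmem : criticalSlope g zs K M n ∈ U := hclosed.csSup_mem hne hbdd
  have hgt : ∀ σ, criticalSlope g zs K M n < σ →
      lockValue g zs K M (n + 1) σ < lockValue g zs K M n σ := by
    intro σ hσ
    by_contra hle
    push Not at hle
    exact absurd (le_csSup hbdd hle) (not_le.2 hσ)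
  refine ⟨le_antisymm hmem ?_, fun σ hσ => hdown σ _ hσ hmem, hgt⟩
  -- Equality at the critical slope: the strict inequality to its right passes to the limit.
  have hcl : criticalSlope g zs K M n ∈
      closure (Set.Ioi (criticalSlope g zs K M n)) := by
    rw [closure_Ioi]; exact Set.mem_Ici.2 le_rfl
  exact closure_minimal (fun σ hσ => (hgt σ hσ).le) (isClosed_le hc2 hc1) hcl

theorem criticalSlope_mono (h : PhaseEnergy g zs c K) {n : ℕ} (hn : n + 1 < M) :
    criticalSlope g zs K M n ≤ criticalSlope g zs K M (n + 1) := by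
  by_contra hlt
  push Not at hlt
  have h1 := (h.criticalSlope_spec (by omega : n < M)).1
  have h2 := (h.criticalSlope_spec hn).2.2 _ hlt
  have h3 := h.lockValue_le_of_le (j := n + 2) (by omega : n < M) h1.le (by omega) (by omega)
  linarith

/-- At the critical slope both states are optimal. -/
theorem criticalSlope_optimal (h : PhaseEnergy g zs c K) {n j : ℕ} (hn : n < M) (hj : j ≤ M) :
    lockValue g zs K M n (criticalSlope g zs K M n) ≤
      lockValue g zs K M j (criticalSlope g zs K M n) := by
  have h1 := (h.criticalSlope_spec hn).1
  rcases le_total n j with hnj | hnj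
  · exact h.lockValue_le_of_le hn h1.le hnj hj
  · exact h.lockValue_succ_le_of_le hn h1.ge hnj

theorem isSupport_of_segment (h : PhaseEnergy g zs c K) {n : ℕ} (hn : n < M) {t : ℝ}
    (ht0 : 0 ≤ t) (ht1 : t ≤ 1) :
    IsSupport g zs K M n t (criticalSlope g zs K M n)
      ((1 - t) * lockMean g zs K M n (criticalSlope g zs K M n) +
        t * lockMean g zs K M (n + 1) (criticalSlope g zs K M n)) := by
  refine ⟨hn, ht0, ht1, rfl, fun j hj => ?_⟩
  have h1 := (h.criticalSlope_spec hn).1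
  have h2 := h.criticalSlope_optimal hn hj
  rw [← h1]
  linarith

/-- In the interior of a locking interval the state `n / M` is optimal, and smaller fractions are
not. -/
theorem exists_slope_of_interval (h : PhaseEnergy g zs c K) {n : ℕ} (hM : 2 ≤ M) (hn : n ≤ M)
    {z : ℝ} (hl : ∀ k, n = k + 1 → lockMean g zs K M n (criticalSlope g zs K M k) < z)
    (hr : n < M → z < lockMean g zs K M n (criticalSlope g zs K M n)) :
    ∃ σ, lockMean g zs K M n σ = z ∧ (∀ j ≤ M, lockValue g zs K M n σ ≤ lockValue g zs K M j σ) ∧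
      ∀ j < n, lockValue g zs K M n σ < lockValue g zs K M j σ := by
  have hM0 : 0 < M := by omega
  have hM' : (M : ℝ) ≠ 0 := by exact_mod_cast hM0.ne'
  have hσ : ∃ σ, lockMean g zs K M n σ = z := by
    rcases hn.eq_or_lt with rfl | hnM
    · obtain ⟨k, rfl⟩ : ∃ k, n = k + 1 := ⟨n - 1, by omega⟩
      have hk := hl k rfl
      have hzs : zs ≤ lockMean g zs K (k + 1) (k + 1) (criticalSlope g zs K (k + 1) k) := by
        have := (h.isSaddle zero_le_one le_rfl (criticalSlope g zs K (k + 1) k)).le_right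
        rw [lockMean, div_self hM', saddleMean]
        linarith
      obtain ⟨σ, hσ⟩ := h.exists_slope (n := k) (M := k + 1) (t := 1) (z := z) (by omega)
        zero_le_one le_rfl (Or.inl (by positivity)) (Or.inr (by linarith))
      exact ⟨σ, by simpa using hσ⟩
    -- For a pure phase the endpoint bound on z keeps it strictly inside that phase, where a slope
    -- exists; here this is needed for n = 0, above for n = M.
    · obtain ⟨σ, hσ⟩ := h.exists_slope (n := n) (M := M) (t := 0) (z := z) hnM
        le_rfl zero_le_one (by
          rcases Nat.eq_zero_or_pos n with rfl | hn0
          · right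
            have hzs : lockMean g zs K M 0 (criticalSlope g zs K M 0) ≤ zs := by
              have := (h.isSaddle le_rfl zero_le_one (criticalSlope g zs K M 0)).left_le
              rw [lockMean, Nat.cast_zero, zero_div, saddleMean]
              linarith
            exact (hr hnM).trans_le hzs
          · left; simpa using hn0) (Or.inl (by simpa using hnM))
      exact ⟨σ, by simpa using hσ⟩
  obtain ⟨σ, hσ⟩ := hσ
  have hlow : ∀ j < n, lockValue g zs K M n σ < lockValue g zs K M j σ := by
    intro j hj
    obtain ⟨k, rfl⟩ : ∃ k, n = k + 1 := ⟨n - 1, by omega⟩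
    have hlt : criticalSlope g zs K M k < σ := by
      by_contra hle
      push Not at hle
      have h1 := h.lockMean_mono hM0 hn hle
      have h2 := hl k rfl
      linarith
    have h3 := (h.criticalSlope_spec (by omega : k < M)).2.2 σ hlt
    exact h3.trans_le (h.lockValue_succ_le_of_le (by omega) h3.le (by omega))
  refine ⟨σ, hσ, fun j hj => ?_, hlow⟩
  rcases lt_or_ge j n with hjn | hjn
  · exact (hlow j hjn).le
  · rcases hn.eq_or_lt with rfl | hnM
    · rw [le_antisymm hj hjn]
    · have hlt : σ ≤ criticalSlope g zs K M n := by
        by_contra hlt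
        push Not at hlt
        have h1 := h.lockMean_mono hM0 hn hlt.le
        have h2 := hr hnM
        linarith
      exact h.lockValue_le_of_le hnM ((h.criticalSlope_spec hnM).2.1 σ hlt) hjn hj

/-- A pure optimal state is a support. -/
theorem exists_isSupport_pure {n : ℕ} (hM : 0 < M) (hn : n ≤ M) {σ z : ℝ}
    (hz : lockMean g zs K M n σ = z)
    (hm : ∀ j ≤ M, lockValue g zs K M n σ ≤ lockValue g zs K M j σ) :
    ∃ k t, IsSupport g zs K M k t σ z ∧ ((k : ℝ) + t) / M = n / M ∧
      (1 - t) * lockValue g zs K M k σ + t * lockValue g zs K M (k + 1) σ =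
        lockValue g zs K M n σ := by
  rcases hn.eq_or_lt with rfl | hnM
  · obtain ⟨k, rfl⟩ : ∃ k, n = k + 1 := ⟨n - 1, by omega⟩
    exact ⟨k, 1, ⟨by omega, zero_le_one, le_rfl, by rw [← hz]; ring, fun j hj => by
      have := hm j hj; linarith⟩, by push_cast; rfl, by ring⟩
  · exact ⟨n, 0, ⟨hnM, le_rfl, zero_le_one, by rw [← hz]; ring, fun j hj => by
      have := hm j hj; linarith⟩, by simp, by ring⟩

theorem exists_interval_or_segment (g : ℝ → ℝ) (zs K : ℝ) (M : ℕ) (z : ℝ) :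
    (∃ n ≤ M, (∀ k, n = k + 1 → lockMean g zs K M n (criticalSlope g zs K M k) < z) ∧
      (n < M → z < lockMean g zs K M n (criticalSlope g zs K M n))) ∨
    ∃ n < M, lockMean g zs K M n (criticalSlope g zs K M n) ≤ z ∧
      z ≤ lockMean g zs K M (n + 1) (criticalSlope g zs K M n) := by
  classical
  -- The least n for which z does not lie beyond the left end of the next locking interval: z is
  -- then either inside the n-th interval or on the segment after it.
  have hex : ∃ n, n = M ∨ z ≤ lockMean g zs K M (n + 1) (criticalSlope g zs K M n) := ⟨M, Or.inl rfl⟩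
  set n := Nat.find hex with hn
  have hspec := Nat.find_spec hex
  have hnM : n ≤ M := Nat.find_min' hex (Or.inl rfl)
  have hl : ∀ k, n = k + 1 → lockMean g zs K M n (criticalSlope g zs K M k) < z := by
    intro k hk
    have := Nat.find_min hex (m := k) (by omega)
    push Not at this
    rw [hk]
    exact this.2
  by_cases hr : n < M → z < lockMean g zs K M n (criticalSlope g zs K M n)
  · exact Or.inl ⟨n, hnM, hl, hr⟩
  · push Not at hr
    exact Or.inr ⟨n, hr.1, hr.2, hspec.resolve_left hr.1.ne⟩

theorem exists_weight {x y z : ℝ} (hx : x ≤ z) (hy : z ≤ y) :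
    ∃ t, 0 ≤ t ∧ t ≤ 1 ∧ (1 - t) * x + t * y = z := by
  rcases (hx.trans hy).eq_or_lt with rfl | hxy
  · exact ⟨0, le_rfl, zero_le_one, by linarith⟩
  · have hd : 0 < y - x := by linarith
    refine ⟨(z - x) / (y - x), div_nonneg (by linarith) hd.le, ?_, ?_⟩
    · rw [div_le_one hd]; linarith
    · field_simp; ring

theorem exists_isSupport (h : PhaseEnergy g zs c K) (hM : 2 ≤ M) (z : ℝ) :
    ∃ n t σ, IsSupport g zs K M n t σ z := by
  rcases exists_interval_or_segment g zs K M z with ⟨n, hn, hl, hr⟩ | ⟨n, hn, hl, hr⟩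
  · obtain ⟨σ, hz, hm, _⟩ := h.exists_slope_of_interval hM hn hl hr
    obtain ⟨k, t, hs, _⟩ := exists_isSupport_pure (by omega) hn hz hm
    exact ⟨k, t, σ, hs⟩
  · obtain ⟨t, ht0, ht1, rfl⟩ := exists_weight hl hr
    exact ⟨n, t, _, h.isSupport_of_segment hn ht0 ht1⟩

/-! ### Contact of the relaxed energy with supporting lines. -/

/-- The relaxed energy lies above supporting lines. -/
theorem le_relaxedEnergy_of_le (hM : 0 < M) {σ p : ℝ}
    (hp : ∀ j ≤ M, p ≤ lockValue g zs K M j σ) {θ : ℝ} (h0 : 0 ≤ θ) (h1 : θ ≤ 1) (z : ℝ) :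
    ((σ * z + p : ℝ) : EReal) ≤ relaxedEnergy g zs K M θ z := by
  obtain ⟨n, hn, t, ht0, ht1, rfl⟩ := exists_eq_add_div hM h0 h1
  refine le_trans (EReal.coe_le_coe_iff.2 ?_) (le_relaxedEnergy hn _ z σ)
  have hM' : (M : ℝ) ≠ 0 := by exact_mod_cast hM.ne'
  rw [lockLine, mul_div_cancel₀ _ hM']
  have a1 := mul_le_mul_of_nonneg_left (hp n hn.le) (sub_nonneg.2 ht1)
  have a2 := mul_le_mul_of_nonneg_left (hp (n + 1) hn) ht0
  linarith

theorem _root_.IsSupport.relaxedEnergy_eq (h : PhaseEnergy g zs c K) {n : ℕ} {t σ z : ℝ}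
    (hs : IsSupport g zs K M n t σ z) : relaxedEnergy g zs K M ((n + t) / M) z =
      ((σ * z + ((1 - t) * lockValue g zs K M n σ + t * lockValue g zs K M (n + 1) σ) : ℝ) :
        EReal) := by
  have := h.relaxedEnergy_lockMean hs.lt hs.nonneg hs.le_one σ
  rwa [hs.mean_eq] at this

/-- Contact of the relaxed energy at a phase fraction with a supporting line. -/
theorem contact_of_relaxedEnergy_le (h : PhaseEnergy g zs c K) {j : ℕ} {r σ p z : ℝ}
    (hj : j < M) (hr0 : 0 ≤ r) (hr1 : r ≤ 1) (hp : ∀ i ≤ M, p ≤ lockValue g zs K M i σ)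
    (hle : relaxedEnergy g zs K M ((j + r) / M) z ≤ ((σ * z + p : ℝ) : EReal)) :
    (r < 1 → lockValue g zs K M j σ = p) ∧ (0 < r → lockValue g zs K M (j + 1) σ = p) ∧
      (1 - r) * lockMean g zs K M j σ + r * lockMean g zs K M (j + 1) σ = z := by
  have hM : 0 < M := by omega
  have hK := h.K_pos
  obtain ⟨a0, a1⟩ := natCast_div_mem_unit hM hj.le
  obtain ⟨b0, b1⟩ := natCast_div_mem_unit (n := j + 1) hM hj
  obtain ⟨w, w', hw, he⟩ := (h.isLeast_interpValues hj hr0 hr1 z).1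
  have l1 := mul_le_mul_of_nonneg_left (h.le_mixMin_add_sq a0 a1 σ w)
    (EReal.coe_nonneg.2 (sub_nonneg.2 hr1))
  have l2 := mul_le_mul_of_nonneg_left (h.le_mixMin_add_sq b0 b1 σ w') (EReal.coe_nonneg.2 hr0)
  have l3 := (add_le_add l1 l2).trans (he ▸ hle)
  rw [← EReal.coe_mul, ← EReal.coe_mul, ← EReal.coe_add, EReal.coe_le_coe_iff] at l3
  change (1 - r) * (σ * w + lockValue g zs K M j σ + K * (w - lockMean g zs K M j σ) ^ 2) +
    r * (σ * w' + lockValue g zs K M (j + 1) σ + K * (w' - lockMean g zs K M (j + 1) σ) ^ 2) ≤ _ at l3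
  -- The hypothesis says that four nonnegative defects, of values and of means, add up to at most
  -- zero; so each vanishes.
  have q1 : 0 ≤ (1 - r) * (lockValue g zs K M j σ - p) :=
    mul_nonneg (sub_nonneg.2 hr1) (sub_nonneg.2 (hp j hj.le))
  have q2 : 0 ≤ r * (lockValue g zs K M (j + 1) σ - p) :=
    mul_nonneg hr0 (sub_nonneg.2 (hp (j + 1) hj))
  have q3 : 0 ≤ (1 - r) * (K * (w - lockMean g zs K M j σ) ^ 2) :=
    mul_nonneg (sub_nonneg.2 hr1) (by positivity)
  have q4 : 0 ≤ r * (K * (w' - lockMean g zs K M (j + 1) σ) ^ 2) :=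
    mul_nonneg hr0 (by positivity)
  have e0 : σ * z = (1 - r) * (σ * w) + r * (σ * w') := by rw [← hw]; ring
  have z1 : (1 - r) * (lockValue g zs K M j σ - p) = 0 := by linarith
  have z2 : r * (lockValue g zs K M (j + 1) σ - p) = 0 := by linarith
  have z3 : (1 - r) * (K * (w - lockMean g zs K M j σ) ^ 2) = 0 := by linarith
  have z4 : r * (K * (w' - lockMean g zs K M (j + 1) σ) ^ 2) = 0 := by linarith
  refine ⟨fun hr => ?_, fun hr => ?_, ?_⟩
  · have := (mul_eq_zero.1 z1).resolve_left (by linarith); linarith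
  · have := (mul_eq_zero.1 z2).resolve_left hr.ne'; linarith
  · have y1 : (1 - r) * (w - lockMean g zs K M j σ) = 0 := by
      rcases mul_eq_zero.1 z3 with h5 | h5
      · rw [h5, zero_mul]
      · have := (mul_eq_zero.1 h5).resolve_left hK.ne'
        rw [pow_eq_zero_iff (by norm_num)] at this
        rw [this, mul_zero]
    have y2 : r * (w' - lockMean g zs K M (j + 1) σ) = 0 := by
      rcases mul_eq_zero.1 z4 with h5 | h5
      · rw [h5, zero_mul]
      · have := (mul_eq_zero.1 h5).resolve_left hK.ne'
        rw [pow_eq_zero_iff (by norm_num)] at this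
        rw [this, mul_zero]
    linarith

theorem lockMean_eq_of_three (h : PhaseEnergy g zs c K) {i j k : ℕ} {σ : ℝ} (hij : i < j)
    (hjk : j < k) (hk : k ≤ M) (e1 : lockValue g zs K M i σ = lockValue g zs K M j σ)
    (e2 : lockValue g zs K M k σ = lockValue g zs K M j σ) :
    lockMean g zs K M i σ = lockMean g zs K M j σ ∧
      lockMean g zs K M k σ = lockMean g zs K M j σ := by
  have hM : (0 : ℝ) < M := by
    have : 0 < M := by omega
    exact_mod_cast this
  have h1 : (i : ℝ) / M < j / M := by gcongr
  have h2 : (j : ℝ) / M < k / M := by gcongr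
  exact h.saddleMean_eq_of_three (by positivity) h1 h2
    (natCast_div_mem_unit (by omega) hk).2 e1 e2

/-- On a nondegenerate segment the contact fraction is unique. -/
theorem contact_unique_of_segment (h : PhaseEnergy g zs c K) {n : ℕ} {t σ z : ℝ}
    (hs : IsSupport g zs K M n t σ z)
    (heq : lockValue g zs K M n σ = lockValue g zs K M (n + 1) σ)
    (hne : lockMean g zs K M n σ ≠ lockMean g zs K M (n + 1) σ) {θ : ℝ} (h0 : 0 ≤ θ) (h1 : θ ≤ 1)
    (hle : relaxedEnergy g zs K M θ z ≤
      ((σ * z + ((1 - t) * lockValue g zs K M n σ + t * lockValue g zs K M (n + 1) σ) : ℝ) :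
        EReal)) : θ = (n + t) / M := by
  have hn := hs.lt
  obtain ⟨j, hj, r, hr0, hr1, rfl⟩ := exists_eq_add_div (by omega : 0 < M) h0 h1
  obtain ⟨c1, c2, c3⟩ := h.contact_of_relaxedEnergy_le hj hr0 hr1 hs.le_value hle
  have hp : (1 - t) * lockValue g zs K M n σ + t * lockValue g zs K M (n + 1) σ =
      lockValue g zs K M n σ := by rw [← heq]; ring
  rw [hp] at c1 c2
  -- A third optimal index would force the means at n and n + 1 to agree. With only these two
  -- indices, the mean strain determines the weight.
  have only : ∀ i ≤ M, lockValue g zs K M i σ = lockValue g zs K M n σ → i = n ∨ i = n + 1 := by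
    intro i hi hv
    by_contra hno
    push Not at hno
    rcases lt_or_gt_of_ne hno.1 with hlt | hgt
    · exact hne (h.lockMean_eq_of_three hlt (Nat.lt_succ_self n) hn hv heq.symm).2.symm
    · exact hne (h.lockMean_eq_of_three (Nat.lt_succ_self n) (by omega : n + 1 < i) hi heq
        (hv.trans heq)).1
  have hmean := hs.mean_eq
  have hd : lockMean g zs K M (n + 1) σ - lockMean g zs K M n σ ≠ 0 := sub_ne_zero.2 hne.symm
  have fin : ∀ s : ℝ, (1 - s) * lockMean g zs K M n σ + s * lockMean g zs K M (n + 1) σ = z →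
      s = t := by
    intro s hs'
    have : (s - t) * (lockMean g zs K M (n + 1) σ - lockMean g zs K M n σ) = 0 := by linarith
    have := (mul_eq_zero.1 this).resolve_right hd
    linarith
  have cast : ((j : ℝ) + r = n + t) → ((j : ℝ) + r) / M = (n + t) / M := fun e => by rw [e]
  apply cast
  rcases hr1.eq_or_lt with rfl | hr1
  · rcases only (j + 1) hj (c2 one_pos) with e | e
    · have := fin 0 (by rw [← e]; linarith)
      rw [← this, ← e]; push_cast; ring
    · have e' : j = n := by omega
      subst e'
      rw [fin 1 c3]
  · rcases only j hj.le (c1 hr1) with e | e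
    · subst e
      rw [fin r c3]
    · have hr : r = 0 := by
        by_contra hr
        rcases only (j + 1) hj (c2 (lt_of_le_of_ne hr0 (Ne.symm hr))) with e2 | e2 <;> omega
      subst hr
      have := fin 1 (by rw [← e]; linarith)
      rw [← this, e]; push_cast; ring

/-! ### Nondegeneracy in the strictly convex, nonconvex case. -/

/-- In the strict nonconvex case, means at neighbouring fractions are distinct. -/
theorem lockMean_lt_succ (h : PhaseEnergy g zs c K) (hnc : ¬ ConvexOn ℝ Set.univ g)
    (hsl : StrictConvexOn ℝ (Set.Iic zs) g) (hsr : StrictConvexOn ℝ (Set.Ici zs) g) {n : ℕ}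
    (hn : n < M) (σ : ℝ) : lockMean g zs K M n σ < lockMean g zs K M (n + 1) σ := by
  refine lt_of_le_of_ne (h.lockMean_le_succ hn σ) fun heq => hnc ?_
  have hM : 0 < M := by omega
  have hM' : (0 : ℝ) < M := by exact_mod_cast hM
  obtain ⟨a0, a1⟩ := natCast_div_mem_unit hM hn.le
  obtain ⟨b0, b1⟩ := natCast_div_mem_unit (n := n + 1) hM hn
  have s1 := h.isSaddle a0 a1 σ
  have s2 := h.isSaddle b0 b1 σ
  have m1 : lockMean g zs K M n σ = (1 - (n : ℝ) / M) * (saddlePair g zs K (n / M) σ).1 +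
    (n : ℝ) / M * (saddlePair g zs K (n / M) σ).2 := rfl
  have m2 : lockMean g zs K M (n + 1) σ =
    (1 - ((n + 1 : ℕ) : ℝ) / M) * (saddlePair g zs K ((n + 1 : ℕ) / M) σ).1 +
    ((n + 1 : ℕ) : ℝ) / M * (saddlePair g zs K ((n + 1 : ℕ) / M) σ).2 := rfl
  generalize saddlePair g zs K (n / M) σ = q1 at *
  generalize saddlePair g zs K ((n + 1 : ℕ) / M) σ = q2 at *
  obtain ⟨a, b⟩ := q1
  obtain ⟨a', b'⟩ := q2
  have l1 := s1.min_left
  have r1 := s1.min_right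
  have l2 := s2.min_left
  have r2 := s2.min_right
  simp only at l1 r1 l2 r2 m1 m2
  -- Equal means at the same σ give the same slope for both saddle points, so strict convexity
  -- identifies them.
  rw [← m1] at l1 r1
  rw [← m2, ← heq] at l2 r2
  have ea : a = a' := argmin_unique hsl s1.left_le s2.left_le l1 l2
  have eb : b = b' := argmin_unique hsr s1.le_right s2.le_right r1 r2
  subst ea eb
  -- The same pair has the same mean under two different weights.
  have hab : a = b := by
    have h3 : ((n : ℝ) / M - ((n + 1 : ℕ) : ℝ) / M) * (b - a) = 0 := by linarith
    have h4 : (n : ℝ) / M - ((n + 1 : ℕ) : ℝ) / M = -(1 / M) := by push_cast; ring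
    rw [h4] at h3
    have h5 := (mul_eq_zero.1 h3).resolve_left (by
      have : 0 < 1 / (M : ℝ) := by positivity
      linarith)
    linarith
  have haz : a = zs := le_antisymm s1.left_le (hab ▸ s1.le_right)
  subst hab haz
  refine convexOn_univ_of_support h.conv_left h.conv_right
    (τ := σ - 2 * K * lockMean g a K M n σ) fun x => ?_
  rcases le_total x a with hx | hx
  · exact l1 x hx
  · exact r1 x hx

/-- In the regular nonconvex case, means at intermediate fractions are strictly increasing in
the slope. -/
theorem lockMean_strictMono (h : PhaseEnergy g zs c K) (hnc : ¬ ConvexOn ℝ Set.univ g)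
    (hd : ∀ x, x ≠ zs → DifferentiableAt ℝ g x) {n : ℕ} (hn0 : 0 < n) (hn : n < M) :
    StrictMono (lockMean g zs K M n) := by
  intro σ₁ σ₂ hσ
  have hM : 0 < M := by omega
  have hM' : (0 : ℝ) < M := by exact_mod_cast hM
  refine lt_of_le_of_ne (h.lockMean_mono hM hn.le hσ.le) fun heq => hnc ?_
  obtain ⟨a0, a1⟩ := natCast_div_mem_unit hM hn.le
  have p0 : 0 < (n : ℝ) / M := by positivity
  have p1 : 0 < 1 - (n : ℝ) / M := by
    rw [sub_pos, div_lt_one hM']; exact_mod_cast hn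
  have s1 := h.isSaddle a0 a1 σ₁
  have s2 := h.isSaddle a0 a1 σ₂
  have m1 : lockMean g zs K M n σ₁ = (1 - (n : ℝ) / M) * (saddlePair g zs K (n / M) σ₁).1 +
    (n : ℝ) / M * (saddlePair g zs K (n / M) σ₁).2 := rfl
  have m2 : lockMean g zs K M n σ₂ = (1 - (n : ℝ) / M) * (saddlePair g zs K (n / M) σ₂).1 +
    (n : ℝ) / M * (saddlePair g zs K (n / M) σ₂).2 := rfl
  generalize saddlePair g zs K (n / M) σ₁ = q1 at *
  generalize saddlePair g zs K (n / M) σ₂ = q2 at *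
  obtain ⟨a, b⟩ := q1
  obtain ⟨a', b'⟩ := q2
  have l1 := s1.min_left
  have r1 := s1.min_right
  have l2 := s2.min_left
  have r2 := s2.min_right
  have ha := s1.left_le
  have hb := s1.le_right
  have ha' := s2.left_le
  have hb' := s2.le_right
  simp only at l1 r1 l2 r2 m1 m2 ha hb ha' hb'
  rw [← m1] at l1 r1
  rw [← m2, ← heq] at l2 r2
  set z := lockMean g zs K M n σ₁
  -- Equal means for different σ give different slopes. Minimizers are nondecreasing in the slope,
  -- and a fixed mean with positive weights keeps both of them in place.
  have hτ : 0 < (σ₂ - 2 * K * z) - (σ₁ - 2 * K * z) := by linarith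
  have oa : 0 ≤ a' - a := by
    have := l1 a' ha'
    have := l2 a ha
    refine nonneg_of_mul_nonneg_right (?_ : 0 ≤ ((σ₂ - 2 * K * z) - (σ₁ - 2 * K * z)) * (a' - a)) hτ
    linarith
  have ob : 0 ≤ b' - b := by
    have := r1 b' hb'
    have := r2 b hb
    refine nonneg_of_mul_nonneg_right (?_ : 0 ≤ ((σ₂ - 2 * K * z) - (σ₁ - 2 * K * z)) * (b' - b)) hτ
    linarith
  have hsum : (1 - (n : ℝ) / M) * (a' - a) + (n : ℝ) / M * (b' - b) = 0 := by linarith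
  have qa := mul_nonneg p1.le oa
  have qb := mul_nonneg p0.le ob
  have ea : a' = a := by
    have := (mul_eq_zero.1 (by linarith : (1 - (n : ℝ) / M) * (a' - a) = 0)).resolve_left p1.ne'
    linarith
  have eb : b' = b := by
    have := (mul_eq_zero.1 (by linarith : (n : ℝ) / M * (b' - b) = 0)).resolve_left p0.ne'
    linarith
  subst ea eb
  -- Away from zs, a point that minimizes for two slopes would have two derivatives.
  have haz : a' = zs := by
    by_contra hne
    have e1 := slope_eq_deriv_of_isMin (Iic_mem_nhds (lt_of_le_of_ne ha hne)) (hd _ hne) l1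
    have e2 := slope_eq_deriv_of_isMin (Iic_mem_nhds (lt_of_le_of_ne ha hne)) (hd _ hne) l2
    linarith
  have hbz : b' = zs := by
    by_contra hne
    have e1 := slope_eq_deriv_of_isMin (Ici_mem_nhds (lt_of_le_of_ne hb (Ne.symm hne)))
      (hd _ hne) r1
    have e2 := slope_eq_deriv_of_isMin (Ici_mem_nhds (lt_of_le_of_ne hb (Ne.symm hne)))
      (hd _ hne) r2
    linarith
  rw [haz] at l1
  rw [hbz] at r1
  refine convexOn_univ_of_support h.conv_left h.conv_right (τ := σ₁ - 2 * K * z) fun x => ?_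
  rcases le_total x zs with hx | hx
  · exact l1 x hx
  · exact r1 x hx

theorem criticalSlope_lt_succ (h : PhaseEnergy g zs c K) (hnc : ¬ ConvexOn ℝ Set.univ g)
    (hsl : StrictConvexOn ℝ (Set.Iic zs) g) (hsr : StrictConvexOn ℝ (Set.Ici zs) g) {n : ℕ}
    (hn : n + 1 < M) : criticalSlope g zs K M n < criticalSlope g zs K M (n + 1) := by
  refine lt_of_le_of_ne (h.criticalSlope_mono hn) fun heq => ?_
  have h1 := (h.criticalSlope_spec (by omega : n < M)).1
  have h2 := (h.criticalSlope_spec hn).1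
  rw [← heq] at h2
  have h3 := (h.lockMean_eq_of_three (Nat.lt_succ_self n) (Nat.lt_succ_self (n + 1)) hn h1
    h2.symm).1
  exact absurd h3 (h.lockMean_lt_succ hnc hsl hsr (by omega) _).ne

/-- In the strict nonconvex case, neighbouring states are both optimal for one slope only. -/
theorem slope_unique (h : PhaseEnergy g zs c K) (hnc : ¬ ConvexOn ℝ Set.univ g)
    (hsl : StrictConvexOn ℝ (Set.Iic zs) g) (hsr : StrictConvexOn ℝ (Set.Ici zs) g) {n : ℕ}
    (hn : n < M) {σ σ' : ℝ} (e : lockValue g zs K M n σ = lockValue g zs K M (n + 1) σ)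
    (e' : lockValue g zs K M n σ' = lockValue g zs K M (n + 1) σ') : σ = σ' := by
  have key : ∀ σ σ', σ < σ' → lockValue g zs K M n σ = lockValue g zs K M (n + 1) σ →
      lockValue g zs K M n σ' = lockValue g zs K M (n + 1) σ' → False := by
    intro σ σ' hlt e e'
    have := h.saddleMean_eq_of_saddleValue_sub_eq (natCast_div_mem_unit (by omega) hn.le).1
      (natCast_div_mem_unit (n := n + 1) (by omega) hn).2 (natCast_div_le_succ (by omega) n) hlt
      (by simp only [lockValue] at e e'; linarith)
    exact absurd this (h.lockMean_lt_succ hnc hsl hsr hn σ').ne'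
  rcases lt_trichotomy σ σ' with hlt | heq | hgt
  · exact (key _ _ hlt e e').elim
  · exact heq
  · exact (key _ _ hgt e' e).elim

/-- The relaxed energy at the fraction `n / M`. -/
theorem relaxedEnergy_natCast_div (h : PhaseEnergy g zs c K) (hM : 0 < M) {n : ℕ} (hn : n ≤ M)
    (z : ℝ) : relaxedEnergy g zs K M (n / M) z = mixMin g zs K (n / M) z := by
  rcases hn.eq_or_lt with rfl | hnM
  · obtain ⟨k, rfl⟩ : ∃ k, n = k + 1 := ⟨n - 1, by omega⟩
    obtain ⟨w, w', hw, he⟩ := (h.isLeast_interpValues (Nat.lt_succ_self k) zero_le_one le_rfl z).1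
    have e1 : w' = z := by linarith
    rw [sub_self, EReal.coe_zero, zero_mul, zero_add, EReal.coe_one, one_mul, e1] at he
    rw [← he]; push_cast; rfl
  · obtain ⟨w, w', hw, he⟩ := (h.isLeast_interpValues hnM le_rfl zero_le_one z).1
    have e1 : w = z := by linarith
    rw [sub_zero, EReal.coe_zero, zero_mul, add_zero, EReal.coe_one, one_mul, e1, add_zero] at he
    exact he

end PhaseEnergy

end

/-! ### Translation to the phase-constrained relaxation, its envelope and the phase set. -/

noncomputable section

section

variable {f : ℝ → ℝ} {m : ℕ → ℝ} {M : ℕ} {zs c : ℝ}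

/-- On `[0, 1]` the extended phase-constrained relaxation is the relaxed energy. -/
theorem QhatExt_eq (hM : 2 ≤ M) (hmM : 0 ≤ m M) (hconc : IsConcentrated m M)
    (h : PhaseEnergy (nnEnergy f m) zs c (2 * m M * (M : ℝ) ^ 2)) {θ : ℝ} (h0 : 0 ≤ θ)
    (h1 : θ ≤ 1) (z : ℝ) : QhatExt f m zs θ z =
      relaxedEnergy (nnEnergy f m) zs (2 * m M * (M : ℝ) ^ 2) M θ z := by
  rw [QhatExt]
  split_ifs with hrat
  · obtain ⟨q, rfl⟩ := hrat
    exact QhatPhase_eq hM hmM hconc h h0 h1 z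
  · have h0' : 0 < θ := lt_of_le_of_ne h0 fun e => hrat ⟨0, by rw [← e]; simp⟩
    have h1' : θ < 1 := lt_of_le_of_ne h1 fun e => hrat ⟨1, by rw [e]; simp⟩
    have : (𝓝[Set.range ((↑) : ℚ → ℝ)] θ).NeBot :=
      mem_closure_iff_nhdsWithin_neBot.1 (Rat.denseRange_cast θ)
    have hcongr : ∀ᶠ t in 𝓝[Set.range ((↑) : ℚ → ℝ)] θ, QhatPhase f m zs t z =
        relaxedEnergy (nnEnergy f m) zs (2 * m M * (M : ℝ) ^ 2) M t z := by
      filter_upwards [self_mem_nhdsWithin,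
        mem_nhdsWithin_of_mem_nhds (Ioo_mem_nhds h0' h1')] with t ht ht'
      obtain ⟨q, rfl⟩ := ht
      exact QhatPhase_eq hM hmM hconc h ht'.1.le ht'.2.le z
    rw [liminf_congr hcongr]
    exact ((h.continuousAt_relaxedEnergy (by omega) h0' h1' z).mono_left
      nhdsWithin_le_nhds).liminf_eq

theorem QhatSc_eq (hM : 2 ≤ M) (hmM : 0 ≤ m M) (hconc : IsConcentrated m M)
    (h : PhaseEnergy (nnEnergy f m) zs c (2 * m M * (M : ℝ) ^ 2)) {θ : ℝ}
    (hθ : θ ∈ Set.Icc (0 : ℝ) 1) (z : ℝ) : QhatSc f m zs θ z =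
      relaxedEnergy (nnEnergy f m) zs (2 * m M * (M : ℝ) ^ 2) M θ z := by
  have hcongr : ∀ᶠ t in 𝓝[Set.Icc (0 : ℝ) 1] θ, QhatExt f m zs t z =
      relaxedEnergy (nnEnergy f m) zs (2 * m M * (M : ℝ) ^ 2) M t z := by
    filter_upwards [self_mem_nhdsWithin] with t ht
    exact QhatExt_eq hM hmM hconc h ht.1 ht.2 z
  rw [QhatSc, liminf_congr hcongr]
  refine le_antisymm (liminf_le_of_frequently_le' ?_) ?_
  -- The point θ belongs to its own neighbourhoods, so the envelope is at most the value; lower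
  -- semicontinuity gives the converse.
  · exact Frequently.filter_mono (f := pure θ) (by simp) (pure_le_nhdsWithin hθ)
  · exact ((lowerSemicontinuous_relaxedEnergy _ _ _ _ z).lowerSemicontinuousWithinAt _
      θ).le_liminf

theorem PValues_eq (n : ℕ) (z : ℝ) : PValues f m zs M n z =
    mixValues (nnEnergy f m) zs (2 * m M * (M : ℝ) ^ 2) (n / M) z := by
  ext v
  constructor
  · rintro ⟨a, b, ha, hb, hab, rfl⟩
    refine ⟨a, b, ha, hb, hab, ?_⟩
    rw [mixEnergy, hab]
    congr 1; ring
  · rintro ⟨a, b, ha, hb, hab, rfl⟩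
    refine ⟨a, b, ha, hb, hab, ?_⟩
    rw [mixEnergy, hab]
    congr 1; ring

theorem PMn_eq (n : ℕ) (z : ℝ) : PMn f m zs M n z =
    mixMin (nnEnergy f m) zs (2 * m M * (M : ℝ) ^ 2) (n / M) z := by
  rw [PMn, PValues_eq, mixMin]

theorem interpolationValues_eq (hM : 0 < M) (n : ℕ) (t z : ℝ) :
    interpolationValues f m zs M n ((n + t) / M) z =
      interpValues (nnEnergy f m) zs (2 * m M * (M : ℝ) ^ 2) M n t z := by
  have hM' : (M : ℝ) ≠ 0 := by exact_mod_cast hM.ne'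
  have e1 : (M : ℝ) * (((n : ℝ) + 1) / M - (n + t) / M) = 1 - t := by field_simp; ring
  have e2 : (M : ℝ) * (((n : ℝ) + t) / M - n / M) = t := by field_simp; ring
  simp only [interpolationValues, interpValues, e1, e2, PMn_eq]

/-- The shape of the relaxation: value at a mean strain with a supporting slope. -/
theorem IsSupport.Qhat_eq {n : ℕ} {t σ z : ℝ}
    (hlim : ∀ {n : ℕ} {t σ z : ℝ},
      IsSupport (nnEnergy f m) zs (2 * m M * (M : ℝ) ^ 2) M n t σ z → Tendsto (relaxSeq f m z) atTop
      (𝓝 (σ * z + ((1 - t) * lockValue (nnEnergy f m) zs (2 * m M * (M : ℝ) ^ 2) M n σ +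
      t * lockValue (nnEnergy f m) zs (2 * m M * (M : ℝ) ^ 2) M (n + 1) σ))))
    (hs : IsSupport (nnEnergy f m) zs (2 * m M * (M : ℝ) ^ 2) M n t σ z) :
    Qhat f m z = σ * z + ((1 - t) * lockValue (nnEnergy f m) zs (2 * m M * (M : ℝ) ^ 2) M n σ +
      t * lockValue (nnEnergy f m) zs (2 * m M * (M : ℝ) ^ 2) M (n + 1) σ) :=
  (hlim hs).limUnder_eq

theorem mem_phaseSet_iff (hM : 2 ≤ M) (hmM : 0 ≤ m M) (hconc : IsConcentrated m M)
    (h : PhaseEnergy (nnEnergy f m) zs c (2 * m M * (M : ℝ) ^ 2)) {z θ : ℝ} :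
    θ ∈ phaseSet f m zs z ↔ θ ∈ Set.Icc (0 : ℝ) 1 ∧
      relaxedEnergy (nnEnergy f m) zs (2 * m M * (M : ℝ) ^ 2) M θ z = (Qhat f m z : EReal) := by
  constructor
  · rintro ⟨h1, h2⟩
    exact ⟨h1, by rwa [QhatSc_eq hM hmM hconc h h1] at h2⟩
  · rintro ⟨h1, h2⟩
    exact ⟨h1, by rwa [QhatSc_eq hM hmM hconc h h1]⟩

theorem IsSupport.mem_phaseSet (hM : 2 ≤ M) (hmM : 0 ≤ m M) (hconc : IsConcentrated m M)
    (h : PhaseEnergy (nnEnergy f m) zs c (2 * m M * (M : ℝ) ^ 2))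
    (hQ : ∀ {n : ℕ} {t σ z : ℝ}, IsSupport (nnEnergy f m) zs (2 * m M * (M : ℝ) ^ 2) M n t σ z →
      Qhat f m z = σ * z + ((1 - t) * lockValue (nnEnergy f m) zs (2 * m M * (M : ℝ) ^ 2) M n σ +
      t * lockValue (nnEnergy f m) zs (2 * m M * (M : ℝ) ^ 2) M (n + 1) σ))
    {n : ℕ} {t σ z : ℝ} (hs : IsSupport (nnEnergy f m) zs (2 * m M * (M : ℝ) ^ 2) M n t σ z) :
    ((n : ℝ) + t) / M ∈ phaseSet f m zs z := by
  have hM' : (0 : ℝ) < M := by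
    have : 0 < M := by omega
    exact_mod_cast this
  refine (mem_phaseSet_iff hM hmM hconc h).2 ⟨⟨?_, ?_⟩, ?_⟩
  · have := hs.nonneg; positivity
  · rw [div_le_one hM']
    have h1 : (n : ℝ) + 1 ≤ M := by exact_mod_cast hs.lt
    linarith [hs.le_one]
  · rw [hs.relaxedEnergy_eq h, hQ hs]

end

end

/-! ### Assembly of the theorem. -/

theorem mainTheorem1 (f : ℝ → ℝ) (m : ℕ → ℝ) (M : ℕ) (zs c : ℝ)
    (hM : 2 ≤ M)
    (hm : ∀ n, 0 ≤ m n) (hconc : IsConcentrated m M) (hmM : 0 < m M)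
    (hbi : IsBiconvex f zs) (hlsc : LowerSemicontinuous f)
    (hc : 0 < c) (hf0 : ∀ z, 0 ≤ f z) (hup : ∀ z, f z ≤ c * (z ^ 2 + 1))
    (hlow : ∀ z, (1 / c) * z ^ 2 ≤ f z + m 1 * z ^ 2) :
    -- the limit defining the relaxation exists, the minima defining `P^{M,n}` are attained,
    -- and the phase function is well defined
    (∀ z, Tendsto (relaxSeq f m z) atTop (𝓝 (Qhat f m z))) ∧
    (∀ n ≤ M, ∀ z, (PValues f m zs M n z).Nonempty →
      IsLeast (PValues f m zs M n z) (PMn f m zs M n z)) ∧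
    (∀ z, IsLeast (phaseSet f m zs z) (phaseFun f m zs z)) ∧
    -- interpolation between successive locking states
    (∀ n < M, ∀ θ : ℚ, (n : ℝ) / M ≤ (θ : ℝ) → (θ : ℝ) ≤ ((n : ℝ) + 1) / M → ∀ z : ℝ,
      IsLeast (interpolationValues f m zs M n θ z) (QhatPhase f m zs θ z)) ∧
    (∀ n ≤ M, ∀ z : ℝ, QhatPhase f m zs ((n : ℝ) / M) z = PMn f m zs M n z) ∧
    -- the relaxation as an envelope of the energies at the fractions `n / M`
    (∀ z : ℝ, (Qhat f m z : EReal) =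
      convexEnvelope (fun x => ⨅ n ∈ Finset.range (M + 1), PMn f m zs M n x) z) ∧
    -- the shape of the relaxation and of the phase function
    (∃ sl sr : ℕ → EReal,
      sl 0 = ⊥ ∧ sr M = ⊤ ∧
      (∀ n ≤ M, sl n ≤ sr n) ∧ (∀ n < M, sr n ≤ sl (n + 1)) ∧
      sl 0 < sr 0 ∧ sl M < sr M ∧
      (∀ n ≤ M, ∀ z : ℝ, sl n < z → z < sr n → (Qhat f m z : EReal) = PMn f m zs M n z) ∧
      (∀ n < M, ∃ α β : ℝ, ∀ z : ℝ, sr n ≤ z → z ≤ sl (n + 1) → Qhat f m z = α * z + β) ∧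
      (∀ n ≤ M, ∀ z : ℝ, sl n < z → z < sr n → phaseFun f m zs z = (n : ℝ) / M) ∧
      (∀ n < M, ∃ α β : ℝ, ∀ z : ℝ, sr n ≤ z → z ≤ sl (n + 1) →
        phaseFun f m zs z = α * z + β) ∧
      -- in the genuinely non-convex, regular case no interval is degenerate
      (¬ ConvexOn ℝ Set.univ (nnEnergy f m) →
        StrictConvexOn ℝ (Set.Iic zs) (nnEnergy f m) →
        StrictConvexOn ℝ (Set.Ici zs) (nnEnergy f m) →
        (∀ z, z ≠ zs → DifferentiableAt ℝ f z) →
        (∀ n ≤ M, sl n < sr n) ∧ (∀ n < M, sr n < sl (n + 1)))) ∧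
    -- the locking states
    (¬ ConvexOn ℝ Set.univ (nnEnergy f m) →
      StrictConvexOn ℝ (Set.Iic zs) (nnEnergy f m) →
      StrictConvexOn ℝ (Set.Ici zs) (nnEnergy f m) →
      (∀ z, z ≠ zs → DifferentiableAt ℝ f z) →
      {θ : ℝ | IsLockingState f m zs θ} = {θ : ℝ | ∃ n ≤ M, θ = (n : ℝ) / M} ∧
      (∀ z : ℝ, (Qhat f m z : EReal) =
        convexEnvelope
          (fun x => ⨅ θ ∈ {θ : ℝ | IsLockingState f m zs θ}, QhatExt f m zs θ x) z)) := by
  have h := phaseEnergy_nnEnergy hM hm hmM hbi hlsc hc hlow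
  have hM0 : 0 < M := by omega
  have hM' : (0 : ℝ) < M := by exact_mod_cast hM0
  have hext : ∀ {θ : ℝ}, 0 ≤ θ → θ ≤ 1 → ∀ z, _ := fun h0 h1 z =>
    QhatExt_eq hM hmM.le hconc h (h0) (h1) z
  have hphase : ∀ {θ : ℚ}, (0 : ℝ) ≤ θ → (θ : ℝ) ≤ 1 → ∀ z, _ := fun h0 h1 z =>
    QhatPhase_eq hM hmM.le hconc h h0 h1 z
  have hPv : ∀ n z, PValues f m zs M n z = _ := fun n z => PValues_eq n z
  have hP : ∀ n z, PMn f m zs M n z = _ := fun n z => PMn_eq n z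
  have hiv : ∀ n t z, interpolationValues f m zs M n ((n + t) / M) z = _ := fun n t z =>
    interpolationValues_eq hM0 n t z
  have hmem : ∀ {z θ}, θ ∈ phaseSet f m zs z ↔ _ := mem_phaseSet_iff hM hmM.le hconc h
  have hlim : ∀ {n t σ z}, IsSupport (nnEnergy f m) zs (2 * m M * (M : ℝ) ^ 2) M n t σ z → _ :=
    fun hs => tendsto_relaxSeq hM hm hconc hc hf0 hup h hs.lt hs.nonneg hs.le_one hs.mean_eq
      hs.le_value
  have hQ : ∀ {n t σ z}, IsSupport (nnEnergy f m) zs (2 * m M * (M : ℝ) ^ 2) M n t σ z → _ :=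
    fun hs => hs.Qhat_eq hlim
  have hmemS := fun {n t σ z}
    (hs : IsSupport (nnEnergy f m) zs (2 * m M * (M : ℝ) ^ 2) M n t σ z) =>
    hs.mem_phaseSet hM hmM.le hconc h hQ
  set g := nnEnergy f m with hg
  set K := 2 * m M * (M : ℝ) ^ 2 with hK
  -- the data at a point of a locking interval
  have hint : ∀ n ≤ M, ∀ z : ℝ,
      (∀ k, n = k + 1 → lockMean g zs K M n (criticalSlope g zs K M k) < z) →
      (n < M → z < lockMean g zs K M n (criticalSlope g zs K M n)) →
      (Qhat f m z : EReal) = PMn f m zs M n z ∧ IsLeast (phaseSet f m zs z) ((n : ℝ) / M) := by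
    intro n hn z hl hr
    obtain ⟨σ, rfl, hmin, hstrict⟩ := h.exists_slope_of_interval hM hn hl hr
    obtain ⟨k, t, hs, hkt, hv⟩ := PhaseEnergy.exists_isSupport_pure hM0 hn rfl hmin
    obtain ⟨a0, a1⟩ := natCast_div_mem_unit hM0 hn
    refine ⟨?_, ?_, ?_⟩
    · rw [hQ hs, hv, hP]
      exact (h.mixMin_saddleMean a0 a1 σ).symm
    · rw [← hkt]; exact hmemS hs
    -- A smaller contact fraction would give positive weight to an index below n, and all of these
    -- are strictly worse at σ.
    · intro θ hθ
      obtain ⟨⟨h0, h1⟩, he⟩ := hmem.1 hθ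
      obtain ⟨j, hj, r, hr0, hr1, rfl⟩ := exists_eq_add_div hM0 h0 h1
      rw [hQ hs, hv] at he
      obtain ⟨c1, c2, _⟩ := h.contact_of_relaxedEnergy_le hj hr0 hr1 hmin he.le
      rw [div_le_div_iff_of_pos_right hM']
      by_contra hlt
      push Not at hlt
      rcases hr1.eq_or_lt with rfl | hr1
      · have hlt' : j + 1 < n := by exact_mod_cast hlt
        exact absurd (c2 one_pos) (hstrict _ hlt').ne'
      · have hlt' : j < n := by
          have : (j : ℝ) < n := by linarith
          exact_mod_cast this
        exact absurd (c1 hr1) (hstrict _ hlt').ne'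
  have henv : ∀ z : ℝ, (Qhat f m z : EReal) =
      convexEnvelope (fun x => ⨅ n ∈ Finset.range (M + 1), PMn f m zs M n x) z := by
    intro z
    obtain ⟨n, t, σ, hs⟩ := h.exists_isSupport hM z
    refine le_antisymm ?_ (iSup₂_le fun φ hφ => ?_)
    · rw [hQ hs]
      set p := (1 - t) * lockValue g zs K M n σ + t * lockValue g zs K M (n + 1) σ with hp
      refine le_iSup₂_of_le (fun x => σ * x + p) ⟨?_, fun x => ?_⟩ le_rfl
      · refine ⟨convex_univ, fun x _ y _ a b _ _ hab => ?_⟩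
        obtain rfl : b = 1 - a := by linarith
        simp only [smul_eq_mul]
        exact le_of_eq (by ring)
      · refine le_iInf₂ fun j hj => ?_
        have hjM : j ≤ M := by rw [Finset.mem_range] at hj; omega
        obtain ⟨a0, a1⟩ := natCast_div_mem_unit hM0 hjM
        rw [hP]
        refine le_trans (EReal.coe_le_coe_iff.2 ?_) (h.le_mixMin a0 a1 σ x)
        have hle := hs.le_value j hjM
        change σ * x + p ≤ σ * x + lockValue g zs K M j σ
        linarith
    -- At the two optimal means the minorant lies below the supporting line; by convexity it does so
    -- at their mixture z.
    · obtain ⟨hconv, hle⟩ := hφ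
      have hn := hs.lt
      have bound : ∀ j ≤ M, φ (lockMean g zs K M j σ) ≤
          σ * lockMean g zs K M j σ + lockValue g zs K M j σ := by
        intro j hj
        obtain ⟨a0, a1⟩ := natCast_div_mem_unit hM0 hj
        rw [← EReal.coe_le_coe_iff]
        refine (hle _).trans ((iInf₂_le j (Finset.mem_range.2 (by omega))).trans ?_)
        rw [hP]
        exact (h.mixMin_saddleMean a0 a1 σ).le
      rw [hQ hs, EReal.coe_le_coe_iff]
      have h1 := hconv.2 (Set.mem_univ (lockMean g zs K M n σ))
        (Set.mem_univ (lockMean g zs K M (n + 1) σ)) (sub_nonneg.2 hs.le_one) hs.nonneg (by ring)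
      simp only [smul_eq_mul] at h1
      rw [hs.mean_eq] at h1
      have b1 := mul_le_mul_of_nonneg_left (bound n hn.le) (sub_nonneg.2 hs.le_one)
      have b2 := mul_le_mul_of_nonneg_left (bound (n + 1) hn) hs.nonneg
      have e : σ * z = (1 - t) * (σ * lockMean g zs K M n σ) +
        t * (σ * lockMean g zs K M (n + 1) σ) := by rw [← hs.mean_eq]; ring
      linarith
  have hqn : ∀ n ≤ M, ∀ z : ℝ, relaxedEnergy g zs K M ((n : ℝ) / M) z = PMn f m zs M n z := by
    intro n hn z
    rw [hP]; exact h.relaxedEnergy_natCast_div hM0 hn z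
  refine ⟨?_, ?_, ?_, ?_, ?_, henv, ?_, ?_⟩
  · intro z
    obtain ⟨n, t, σ, hs⟩ := h.exists_isSupport hM z
    rw [hQ hs]; exact hlim hs
  · intro n hn z hne
    rw [hP, hPv] at *
    exact h.isLeast_mixValues hM hn hne
  · intro z
    obtain ⟨n, t, σ, hs⟩ := h.exists_isSupport hM z
    -- The relaxed energy is never below the supporting line, so the defining equation is an
    -- inequality, and lower semicontinuity makes the set compact.
    have hset : phaseSet f m zs z = Set.Icc (0 : ℝ) 1 ∩
        (fun θ => relaxedEnergy g zs K M θ z) ⁻¹' Set.Iic (Qhat f m z : EReal) := by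
      ext θ
      rw [hmem]
      refine and_congr_right fun hθ => ⟨fun e => e.le, fun hle => le_antisymm hle ?_⟩
      rw [hQ hs]
      exact PhaseEnergy.le_relaxedEnergy_of_le hM0 hs.le_value hθ.1 hθ.2 z
    have hcpt : IsCompact (phaseSet f m zs z) := by
      rw [hset]
      exact isCompact_Icc.inter_right
        ((lowerSemicontinuous_relaxedEnergy g zs K M z).isClosed_preimage _)
    exact hcpt.isLeast_sInf ⟨_, hmemS hs⟩
  · intro n hn θ hθ1 hθ2 z
    rw [div_le_iff₀ hM'] at hθ1
    rw [le_div_iff₀ hM'] at hθ2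
    have e : (θ : ℝ) = (n + (θ * M - n)) / M := by field_simp; ring
    have h0 : (0 : ℝ) ≤ θ := by
      refine nonneg_of_mul_nonneg_left ?_ hM'
      exact (Nat.cast_nonneg n).trans hθ1
    have h1 : (θ : ℝ) ≤ 1 := by
      have h2 : (n : ℝ) + 1 ≤ M := by exact_mod_cast hn
      refine le_of_mul_le_mul_right ?_ hM'
      linarith
    rw [hphase h0 h1, e, hiv]
    exact h.isLeast_interpValues hn (by linarith) (by linarith) z
  · intro n hn z
    obtain ⟨a0, a1⟩ := natCast_div_mem_unit hM0 hn
    have e : ((n : ℝ) / M) = (((n : ℚ) / M : ℚ) : ℝ) := by push_cast; rfl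
    rw [← hqn n hn]
    rw [e] at a0 a1 ⊢
    exact hphase a0 a1 z
  -- The ends of the n-th interval are the means of state n at the slopes where it takes over from n
  -- - 1 and where it gives way to n + 1.
  · refine ⟨fun n => if n = 0 then ⊥ else ((lockMean g zs K M n (criticalSlope g zs K M (n - 1)) : ℝ)
      : EReal), fun n => if n < M then ((lockMean g zs K M n (criticalSlope g zs K M n) : ℝ) : EReal)
      else ⊤, by simp, by simp, ?_, ?_, ?_, ?_, ?_, ?_, ?_, ?_, ?_⟩
    · intro n hn
      by_cases hn0 : n = 0
      · simp [hn0]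
      by_cases hnM : n < M
      · simp only [hn0, hnM, if_true, if_false, EReal.coe_le_coe_iff]
        refine h.lockMean_mono hM0 hn ?_
        obtain ⟨k, rfl⟩ : ∃ k, n = k + 1 := ⟨n - 1, by omega⟩
        exact h.criticalSlope_mono hnM
      · simp [hnM]
    · intro n hn
      simp only [hn, if_true, Nat.succ_ne_zero, if_false, Nat.add_sub_cancel,
        EReal.coe_le_coe_iff]
      exact h.lockMean_le_succ hn _
    · simp [hM0, EReal.bot_lt_coe]
    · simp [hM0.ne', EReal.coe_lt_top]
    · intro n hn z hl hr
      refine (hint n hn z ?_ ?_).1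
      · rintro k rfl; simpa using hl
      · intro hnM; simpa [hnM] using hr
    · intro n hn
      refine ⟨criticalSlope g zs K M n, lockValue g zs K M n (criticalSlope g zs K M n),
        fun z hl hr => ?_⟩
      simp only [hn, if_true, Nat.succ_ne_zero, if_false, Nat.add_sub_cancel,
        EReal.coe_le_coe_iff] at hl hr
      obtain ⟨t, ht0, ht1, rfl⟩ := PhaseEnergy.exists_weight hl hr
      rw [hQ (h.isSupport_of_segment hn ht0 ht1), ← (h.criticalSlope_spec hn).1]
      ring
    · intro n hn z hl hr
      refine (hint n hn z ?_ ?_).2.csInf_eq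
      · rintro k rfl; simpa using hl
      · intro hnM; simpa [hnM] using hr
    · intro n hn
      simp only [hn, if_true, Nat.succ_ne_zero, if_false, Nat.add_sub_cancel,
        EReal.coe_le_coe_iff]
      set σ := criticalSlope g zs K M n with hσ
      -- A degenerate segment is one point, where any value is affine. Otherwise the contact
      -- fraction (n + t)/M is unique and t is affine in z.
      by_cases heq : lockMean g zs K M n σ = lockMean g zs K M (n + 1) σ
      · refine ⟨0, phaseFun f m zs (lockMean g zs K M n σ), fun z hl hr => ?_⟩
        rw [le_antisymm (heq ▸ hr) hl]; ring
      · have hd : lockMean g zs K M (n + 1) σ - lockMean g zs K M n σ ≠ 0 :=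
          sub_ne_zero.2 (Ne.symm heq)
        refine ⟨1 / (M * (lockMean g zs K M (n + 1) σ - lockMean g zs K M n σ)),
          (n - lockMean g zs K M n σ / (lockMean g zs K M (n + 1) σ - lockMean g zs K M n σ)) / M,
          fun z hl hr => ?_⟩
        obtain ⟨t, ht0, ht1, ht⟩ := PhaseEnergy.exists_weight hl hr
        have hs := h.isSupport_of_segment hn ht0 ht1
        rw [← hσ, ht] at hs
        have hleast : IsLeast (phaseSet f m zs z) (((n : ℝ) + t) / M) := by
          refine ⟨hmemS hs, fun θ hθ => ?_⟩
          obtain ⟨⟨h0, h1⟩, he⟩ := hmem.1 hθ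
          rw [hQ hs] at he
          exact (h.contact_unique_of_segment hs (h.criticalSlope_spec hn).1 heq h0 h1 he.le).ge
        rw [phaseFun, hleast.csInf_eq, ← ht]
        field_simp
        ring
    · intro hnc hsl hsr hd
      have hd' : ∀ x, x ≠ zs → DifferentiableAt ℝ g x := fun x hx =>
        (hd x hx).add (by fun_prop)
      constructor
      · intro n hn
        by_cases hn0 : n = 0
        · subst hn0; simp [hM0, EReal.bot_lt_coe]
        by_cases hnM : n < M
        · simp only [hn0, hnM, if_true, if_false, EReal.coe_lt_coe_iff]
          refine h.lockMean_strictMono hnc hd' (by omega) hnM ?_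
          obtain ⟨k, rfl⟩ : ∃ k, n = k + 1 := ⟨n - 1, by omega⟩
          exact h.criticalSlope_lt_succ hnc hsl hsr hnM
        · simp [hn0, hnM, EReal.coe_lt_top]
      · intro n hn
        simp only [hn, if_true, Nat.succ_ne_zero, if_false, Nat.add_sub_cancel,
          EReal.coe_lt_coe_iff]
        exact h.lockMean_lt_succ hnc hsl hsr hn _
  · intro hnc hsl hsr hd
    have hd' : ∀ x, x ≠ zs → DifferentiableAt ℝ g x := fun x hx =>
      (hd x hx).add (by fun_prop)
    have hlock : {θ : ℝ | IsLockingState f m zs θ} = {θ : ℝ | ∃ n ≤ M, θ = (n : ℝ) / M} := by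
      ext θ
      constructor
      · rintro ⟨⟨h0, h1⟩, α, β, hαβ, hcontact⟩
        obtain ⟨j, hj, r, hr0, hr1, hθ⟩ := exists_eq_add_div hM0 h0 h1
        rcases hr0.eq_or_lt with rfl | hr0'
        · exact ⟨j, hj.le, by rw [hθ, add_zero]⟩
        rcases hr1.eq_or_lt with rfl | hr1'
        · exact ⟨j + 1, hj, by rw [hθ]; push_cast; rfl⟩
        exfalso
        -- At an intermediate fraction, contact requires j and j + 1 to be optimal at the same
        -- slope. That slope is unique, hence so is z, contrary to contact on an interval.
        have key : ∀ z ∈ Set.Ioo α β, ∃ σ, lockValue g zs K M j σ = lockValue g zs K M (j + 1) σ ∧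
            (1 - r) * lockMean g zs K M j σ + r * lockMean g zs K M (j + 1) σ = z := by
          intro z hz
          obtain ⟨n, t, σ, hs⟩ := h.exists_isSupport hM z
          have he := hcontact z hz
          rw [hext h0 h1, hQ hs, hθ] at he
          obtain ⟨c1, c2, c3⟩ := h.contact_of_relaxedEnergy_le hj hr0 hr1 hs.le_value he.le
          exact ⟨σ, (c1 hr1').trans (c2 hr0').symm, c3⟩
        obtain ⟨σ₁, v1, z1⟩ := key ((2 * α + β) / 3) ⟨by linarith, by linarith⟩
        obtain ⟨σ₂, v2, z2⟩ := key ((α + 2 * β) / 3) ⟨by linarith, by linarith⟩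
        rw [h.slope_unique hnc hsl hsr hj v1 v2] at z1
        linarith
      · rintro ⟨n, hn, rfl⟩
        obtain ⟨a0, a1⟩ := natCast_div_mem_unit hM0 hn
        refine ⟨⟨a0, a1⟩, ?_⟩
        have contact : ∀ α β : ℝ, α < β →
            (∀ k, n = k + 1 → lockMean g zs K M n (criticalSlope g zs K M k) ≤ α) →
            (n < M → β ≤ lockMean g zs K M n (criticalSlope g zs K M n)) →
            ∃ a b : ℝ, a < b ∧ ∀ z ∈ Set.Ioo a b,
              QhatExt f m zs ((n : ℝ) / M) z = (Qhat f m z : EReal) := by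
          intro α β hαβ hl hr
          refine ⟨α, β, hαβ, fun z hz => ?_⟩
          rw [hext a0 a1]
          exact (hmem.1 (hint n hn z (fun k hk => (hl k hk).trans_lt hz.1)
            (fun hnM => hz.2.trans_le (hr hnM))).2.1).2
        -- The intervals of the pure phases are unbounded on one side, and a piece of unit length is
        -- enough there.
        by_cases hn0 : n = 0
        · subst hn0
          refine contact (lockMean g zs K M 0 (criticalSlope g zs K M 0) - 1) _ (by linarith)
            (fun k hk => by omega) (fun _ => le_rfl)
        obtain ⟨k, rfl⟩ : ∃ k, n = k + 1 := ⟨n - 1, by omega⟩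
        rcases hn.eq_or_lt with hnM | hnM
        · refine contact _ (lockMean g zs K M (k + 1) (criticalSlope g zs K M k) + 1)
            (by linarith) (fun k' hk' => ?_) (fun hlt => by omega)
          obtain rfl : k = k' := by omega
          exact le_rfl
        · refine contact _ _ (h.lockMean_strictMono hnc hd' (by omega) hnM
            (h.criticalSlope_lt_succ hnc hsl hsr hnM)) (fun k' hk' => ?_) (fun _ => le_rfl)
          obtain rfl : k = k' := by omega
          exact le_rfl
    refine ⟨hlock, fun z => ?_⟩
    rw [henv z]
    congr 1
    funext x
    rw [hlock]
    refine le_antisymm (le_iInf₂ fun θ hθ => ?_) (le_iInf₂ fun n hn => ?_)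
    · obtain ⟨n, hn, rfl⟩ := hθ
      obtain ⟨a0, a1⟩ := natCast_div_mem_unit hM0 hn
      rw [hext a0 a1, hqn n hn]
      exact iInf₂_le n (Finset.mem_range.2 (by omega))
    · have hn' : n ≤ M := by rw [Finset.mem_range] at hn; omega
      obtain ⟨a0, a1⟩ := natCast_div_mem_unit hM0 hn'
      rw [← hqn n hn', ← hext a0 a1]
      exact iInf₂_le ((n : ℝ) / M) ⟨n, hn', rfl⟩
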